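/- Let $L$ be a finite relational language in which every relation symbol has arity at least $2$, and fix $\overline\alpha : L \to (0,1)\cap\mathbb{Q}$. Let $K_L$ be the class of finite $L$-structures (including the empty one) in which every $E\in L$ is interpreted symmetrically and irreflexively (if $E(\bar a)$ holds, then $\bar a$ has no repetitions and $E$ holds of every permutation of $\bar a$). For $A\in K_L$ put $\delta(A)=|A|-\sum_{E\in L}\overline\alpha(E)N_E(A)$, where $N_E(A)$ is the number of subsets of $A$ on which $E$ holds, and let $K_{\overline\alpha}$ be the class of all $A\in K_L$ with $\delta(A')\ge 0$ for all $A'\subseteq A$. For finite $A\subseteq B$ write $A\le B$ if $\delta(A)\le\delta(A')$ whenever $A\subseteq A'\subseteq B$; for a finite substructure $A$ of an arbitrary structure $M$ whose finite substructures are in $K_L$, write $A\le M$ if $A\le B$ for every finite $B$ with $A\subseteq B\subseteq M$. Let $S_{\overline\alpha}$ be the first-order theory whose models are the $L$-structures $M$ such that (1) every finite substructure of $M$ is in $K_{\overline\alpha}$, and (2) for all $A\le B$ in $K_{\overline\alpha}$, every embedding $A\to M$ extends to an embedding $B\to M$. For $M\models S_{\overline\alpha}$ let $\dim(M)=\max\{\delta(B)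 : B \text{ finite},\ B\le M\}$, and $\dim(M)=\infty$ if there is no maximum. Theorem. If $M$ and $N$ are countable models of $S_{\overline\alpha}$ with $\dim(M)\le\dim(N)$, then there is an elementary embedding $M\to N$. Moreover, there is an elementary chain $M_0\preccurlyeq M_1\preccurlyeq\dots\preccurlyeq M_n\preccurlyeq\dots\preccurlyeq M_\omega$ of countable models of $S_{\overline\alpha}$, indexed by the ordinals $\beta\le\omega$ (so $M_\beta\preccurlyeq M_\gamma$ whenever $\beta\le\gamma\le\omega$), such that every countable model of $S_{\overline\alpha}$ is isomorphic to some $M_\beta$ with $\beta\le\omega$. -/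

import Mathlib

open FirstOrder FirstOrder.Language

universe u v w w'

namespace BaldwinShi

/-- The number of distinct subsets of `A` on which the relation symbol `E` holds in `M`. -/
noncomputable def numEdges {L : FirstOrder.Language.{u, v}} {M : Type w} [L.Structure M]
    (E : Σ n, L.Relations n) (A : Finset M) : ℕ :=
  {s : Finset M | s ⊆ A ∧ ∃ x : Fin E.1 → M,
    Structure.RelMap E.2 x ∧ Set.range x = (s : Set M)}.ncard

/-- The rank `δ(A) = |A| - ∑_E α(E) N_E(A)` of the (substructure of `M` with universe the)
finite set `A`. In a relational language every subset of `M` is a substructure. -/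
noncomputable def delta {L : FirstOrder.Language.{u, v}} [Fintype (Σ n, L.Relations n)]
    (α : (Σ n, L.Relations n) → ℚ) {M : Type w} [L.Structure M] (A : Finset M) : ℚ :=
  (A.card : ℚ) - ∑ E : (Σ n, L.Relations n), α E * (numEdges E A : ℚ)

/-- Every relation symbol is interpreted irreflexively (the entries of a related tuple are
pairwise distinct) and symmetrically. -/
def SymmIrrefl (L : FirstOrder.Language.{u, v}) (M : Type w) [L.Structure M] : Prop :=
  ∀ (n : ℕ) (E : L.Relations n) (x : Fin n → M), Structure.RelMap E x →
    Function.Injective x ∧ ∀ π : Equiv.Perm (Fin n), Structure.RelMap E (x ∘ π)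

/-- For finite `M` this is membership in the class `K_α`; for arbitrary `M` it says that all
finite substructures of `M` are in `K_α`. (Being symmetric and irreflexive is a condition on
finite substructures, so no finiteness has to be mentioned in the first clause.) -/
def InK {L : FirstOrder.Language.{u, v}} [Fintype (Σ n, L.Relations n)]
    (α : (Σ n, L.Relations n) → ℚ) (M : Type w) [L.Structure M] : Prop :=
  SymmIrrefl L M ∧ ∀ A : Finset M, 0 ≤ delta α A

/-- `A ≤ B` for finite substructures `A`, `B` of `M`: `A ⊆ B`, and `δ(A) ≤ δ(A')` whenever
`A ⊆ A' ⊆ B`. -/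
def StrongLE {L : FirstOrder.Language.{u, v}} [Fintype (Σ n, L.Relations n)]
    (α : (Σ n, L.Relations n) → ℚ) {M : Type w} [L.Structure M] (A B : Finset M) : Prop :=
  A ⊆ B ∧ ∀ A' : Finset M, A ⊆ A' → A' ⊆ B → delta α A ≤ delta α A'

/-- `A ≤ M` for a finite substructure `A` of a structure `M`, possibly infinite. -/
def Strong {L : FirstOrder.Language.{u, v}} [Fintype (Σ n, L.Relations n)]
    (α : (Σ n, L.Relations n) → ℚ) {M : Type w} [L.Structure M] (A : Finset M) : Prop :=
  ∀ B : Finset M, A ⊆ B → StrongLE α A B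

/-- The atomic diagram of a finite structure `I`, with the elements of `I` as variables:
the variables are pairwise distinct, and they satisfy a relation exactly if it holds in `I`. -/
noncomputable def diagram (L : FirstOrder.Language.{u, v}) [Fintype (Σ n, L.Relations n)]
    (I : Type) [Finite I] [L.Structure I] : L.Formula I :=
  open Classical in
  (Formula.iInf fun p : {p : I × I // p.1 ≠ p.2} =>
      ∼(Term.equal (var p.1.1 : L.Term I) (var p.1.2))) ⊓
  (Formula.iInf fun p : (Σ E : (Σ n, L.Relations n), Fin E.1 → I) =>
      if Structure.RelMap p.1.2 p.2 then p.1.2.formula (fun i => (var (p.2 i) : L.Term I))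
      else ∼(p.1.2.formula (fun i => (var (p.2 i) : L.Term I))))

/-- The sentence "no substructure is isomorphic to `I`". -/
noncomputable def omitSentence (L : FirstOrder.Language.{u, v}) [Fintype (Σ n, L.Relations n)]
    (I : Type) [Finite I] [L.Structure I] : L.Sentence :=
  ∼(((diagram L I).relabel (Sum.inr : I → Empty ⊕ I)).iExs I)

/-- The sentence "every embedding of `A` extends along `e : A → B` to an embedding of `B`", that
is `∀ x, (Δ_A(x) → ∃ y, Δ_B(y) ∧ ⋀ a, y (e a) = x a)`. -/
noncomputable def extSentence {L : FirstOrder.Language.{u, v}} [Fintype (Σ n, L.Relations n)]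
    {A B : Type} [Finite A] [Finite B] [L.Structure A] [L.Structure B] (e : A ↪[L] B) :
    L.Sentence :=
  (((diagram L A).imp
      (((diagram L B).relabel (Sum.inr : B → A ⊕ B) ⊓
        Formula.iInf fun a : A =>
          Term.equal (var (Sum.inr (e a)) : L.Term (A ⊕ B)) (var (Sum.inl a))).iExs B)).relabel
    (Sum.inr : A → Empty ⊕ A)).iAlls A

/-- The theory `S_α`: (1) no finite structure outside `K_α` embeds; (2) for all `A ≤ B` from
`K_α`, every embedding of `A` extends to an embedding of `B`. (Each finite structure is
represented by its isomorphic copies with universe `Fin n`, and the inclusion of `A` in `B` by an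
embedding `e : A → B`. As `B` is in `K_α`, so is `A`.) -/
def theoryS {L : FirstOrder.Language.{u, v}} [Fintype (Σ n, L.Relations n)]
    (α : (Σ n, L.Relations n) → ℚ) : L.Theory :=
  {φ | ∃ (n : ℕ) (_ : L.Structure (Fin n)), ¬ InK α (Fin n) ∧ φ = omitSentence L (Fin n)} ∪
  {φ | ∃ (m n : ℕ) (_ : L.Structure (Fin m)) (_ : L.Structure (Fin n)) (e : Fin m ↪[L] Fin n),
    InK α (Fin n) ∧ StrongLE α (Finset.univ.map e.toEmbedding) Finset.univ ∧ φ = extSentence e}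

/-- `dim(M/A) = max {δ(B/A) : A ≤ B ≤ M}` where `δ(B/A) = δ(B) - δ(A)`, and `∞` if there is no
maximum (meant for `A ≤ M`). -/
noncomputable def dimOver {L : FirstOrder.Language.{u, v}} [Fintype (Σ n, L.Relations n)]
    (α : (Σ n, L.Relations n) → ℚ) {M : Type w} [L.Structure M] (A : Finset M) : WithTop ℚ :=
  open Classical in
  if h : ∃ d : ℚ, IsGreatest
      {d | ∃ B : Finset M, StrongLE α A B ∧ Strong α B ∧ d = delta α B - delta α A} d
  then (h.choose : WithTop ℚ) else ⊤

/-- `dim(M) = dim(M/∅)`. -/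
noncomputable def dim {L : FirstOrder.Language.{u, v}} [Fintype (Σ n, L.Relations n)]
    (α : (Σ n, L.Relations n) → ℚ) (M : Type w) [L.Structure M] : WithTop ℚ :=
  dimOver α (∅ : Finset M)


theorem realize_diagram {L : FirstOrder.Language.{u, v}} [L.IsRelational]
    [Fintype (Σ n, L.Relations n)] {I : Type} [Finite I] [L.Structure I]
    {M : Type w} [L.Structure M] (x : I → M) :
    (diagram L I).Realize x ↔ ∃ f : I ↪[L] M, ⇑f = x := by
  classical
  have key : (diagram L I).Realize x ↔
      (∀ p : {p : I × I // p.1 ≠ p.2}, x p.1.1 ≠ x p.1.2) ∧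
      ∀ p : (Σ E : (Σ n, L.Relations n), Fin E.1 → I),
        (Structure.RelMap p.1.2 (x ∘ p.2) ↔ Structure.RelMap p.1.2 p.2) := by
    unfold diagram
    rw [Formula.realize_inf, Formula.realize_iInf, Formula.realize_iInf]
    refine and_congr (forall_congr' fun p => ?_) (forall_congr' fun p => ?_)
    · simp [Formula.realize_not, Formula.realize_equal]
    · split_ifs with h
      · simp [Formula.realize_rel, h, Function.comp_def]
      · simp [Formula.realize_rel, h, Function.comp_def]
  rw [key]
  constructor
  · rintro ⟨hi, hr⟩
    exact ⟨⟨⟨x, fun a b hab => by_contra fun hne => hi ⟨(a, b), hne⟩ hab⟩,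
      fun {n} f => isEmptyElim f, fun {n} R y => hr ⟨⟨n, R⟩, y⟩⟩, rfl⟩
  · rintro ⟨f, rfl⟩
    exact ⟨fun p hp => p.2 (f.injective hp), fun p => f.map_rel p.1.2 p.2⟩

theorem realize_omitSentence {L : FirstOrder.Language.{u, v}} [L.IsRelational]
    [Fintype (Σ n, L.Relations n)] {I : Type} [Finite I] [L.Structure I]
    (M : Type w) [L.Structure M] :
    M ⊨ omitSentence L I ↔ IsEmpty (I ↪[L] M) := by
  unfold omitSentence
  rw [Sentence.Realize, Formula.realize_not, Formula.realize_iExs]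
  simp only [Formula.realize_relabel, Sum.elim_comp_inr, realize_diagram]
  constructor
  · intro h
    exact ⟨fun f => h ⟨f, f, rfl⟩⟩
  · rintro h ⟨_, f, _⟩
    exact h.elim f

theorem realize_extSentence {L : FirstOrder.Language.{u, v}} [L.IsRelational]
    [Fintype (Σ n, L.Relations n)] {A B : Type} [Finite A] [Finite B] [L.Structure A]
    [L.Structure B] (e : A ↪[L] B) (M : Type w) [L.Structure M] :
    M ⊨ extSentence e ↔ ∀ f : A ↪[L] M, ∃ g : B ↪[L] M, ∀ a, g (e a) = f a := by
  unfold extSentence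
  rw [Sentence.Realize, Formula.realize_iAlls]
  simp only [Formula.realize_relabel, Sum.elim_comp_inr, Formula.realize_imp,
    Formula.realize_iExs, Formula.realize_inf, realize_diagram, Formula.realize_iInf,
    Formula.realize_equal, Term.realize_var, Sum.elim_inl, Sum.elim_inr]
  constructor
  · intro h f
    obtain ⟨_, ⟨g, rfl⟩, hg⟩ := h f ⟨f, rfl⟩
    exact ⟨g, hg⟩
  · rintro h _ ⟨f, rfl⟩
    obtain ⟨g, hg⟩ := h f
    exact ⟨g, ⟨g, rfl⟩, hg⟩

theorem delta_map {L : FirstOrder.Language.{u, v}} [Fintype (Σ n, L.Relations n)]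
    (α : (Σ n, L.Relations n) → ℚ) {M : Type w} {N : Type w'} [L.Structure M] [L.Structure N]
    (f : M ↪[L] N) (A : Finset M) : delta α (A.map f.toEmbedding) = delta α A := by
  classical
  have hE : ∀ E, numEdges E (A.map f.toEmbedding) = numEdges (L := L) E A := by
    intro E
    unfold numEdges
    rw [← Set.ncard_image_of_injective _ (Finset.map_injective f.toEmbedding)]
    congr 1
    ext s
    simp only [Set.mem_ofPred_eq, Set.mem_image]
    constructor
    · rintro ⟨hs, x, hx, hxs⟩
      obtain ⟨t, ht, rfl⟩ := Finset.subset_map_iff.1 hs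
      have : ∀ i, ∃ y ∈ t, f y = x i := by
        intro i
        have : x i ∈ Set.range x := ⟨i, rfl⟩
        rw [hxs] at this
        simp only [Finset.coe_map, Set.mem_image, Finset.mem_coe] at this
        exact this
      choose y hyt hyx using this
      obtain rfl : f ∘ y = x := funext hyx
      refine ⟨t, ⟨ht, y, (f.map_rel _ _).1 hx, ?_⟩, rfl⟩
      rw [Set.range_comp, Finset.coe_map] at hxs
      exact f.injective.image_injective hxs
    · rintro ⟨t, ⟨ht, y, hy, hyt⟩, rfl⟩
      refine ⟨Finset.map_subset_map.2 ht, f ∘ y, (f.map_rel _ _).2 hy, ?_⟩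
      rw [Set.range_comp, hyt, Finset.coe_map]
      rfl
  simp only [delta, hE, Finset.card_map]

/-- The models of the theory `S_α` are the structures in the class `K̄_α` with the extension
property. -/
theorem model_theoryS_iff {L : FirstOrder.Language.{u, v}} [L.IsRelational]
    [Fintype (Σ n, L.Relations n)] (α : (Σ n, L.Relations n) → ℚ)
    (M : Type w) [L.Structure M] :
    M ⊨ theoryS α ↔ InK α M ∧
      ∀ (m n : ℕ) (_ : L.Structure (Fin m)) (_ : L.Structure (Fin n)) (e : Fin m ↪[L] Fin n),
        InK α (Fin n) → StrongLE α (Finset.univ.map e.toEmbedding) Finset.univ →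
        ∀ f : Fin m ↪[L] M, ∃ g : Fin n ↪[L] M, ∀ a, g (e a) = f a := by
  classical
  rw [Theory.model_iff]
  constructor
  · intro h
    refine ⟨?_, fun m n _ _ e hB he => (realize_extSentence e M).1
      (h _ (Or.inr ⟨m, n, _, _, e, hB, he, rfl⟩))⟩
    have main : ∀ A : Finset M, ∃ (n : ℕ) (_ : L.Structure (Fin n)) (f : Fin n ↪[L] M),
        Finset.univ.map f.toEmbedding = A ∧ InK α (Fin n) := by
      intro A
      let φ : Fin A.card ↪ M := A.equivFin.symm.toEmbedding.trans (Function.Embedding.subtype _)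
      let _ : L.Structure (Fin A.card) :=
        ⟨fun {n} g => isEmptyElim g, fun {n} R x => Structure.RelMap R (φ ∘ x)⟩
      let f : Fin A.card ↪[L] M := ⟨φ, fun {n} g => isEmptyElim g, fun {n} R x => Iff.rfl⟩
      refine ⟨A.card, inferInstance, f, ?_, ?_⟩
      · ext a
        simp only [Finset.mem_map, Finset.mem_univ, true_and]
        constructor
        · rintro ⟨i, rfl⟩
          exact (A.equivFin.symm i).2
        · intro ha
          exact ⟨A.equivFin ⟨a, ha⟩, by simp [f, φ]⟩
      · by_contra hn
        exact ((realize_omitSentence M).1 (h _ (Or.inl ⟨_, _, hn, rfl⟩))).elim f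
    constructor
    · intro n E x hx
      obtain ⟨k, _, f, hf, hK⟩ := main (Finset.univ.image x)
      have : ∀ i, ∃ j, f j = x i := by
        intro i
        have : x i ∈ Finset.univ.map f.toEmbedding := by rw [hf]; simp
        simp only [Finset.mem_map, Finset.mem_univ, true_and] at this
        exact this
      choose y hy using this
      obtain rfl : f ∘ y = x := funext hy
      obtain ⟨h1, h2⟩ := hK.1 n E y ((f.map_rel _ _).1 hx)
      exact ⟨f.injective.comp h1, fun π => (f.map_rel _ (y ∘ π)).2 (h2 π)⟩
    · intro A
      obtain ⟨k, _, f, rfl, hK⟩ := main A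
      rw [delta_map]
      exact hK.2 _
  · rintro ⟨hM, hext⟩ φ (⟨n, _, hn, rfl⟩ | ⟨m, n, _, _, e, hB, he, rfl⟩)
    · refine (realize_omitSentence M).2 ⟨fun f => hn ⟨?_, fun A => ?_⟩⟩
      · intro k E x hx
        obtain ⟨h1, h2⟩ := hM.1 k E (f ∘ x) ((f.map_rel _ _).2 hx)
        exact ⟨h1.of_comp, fun π => (f.map_rel _ (x ∘ π)).1 (h2 π)⟩
      · rw [← delta_map α f]
        exact hM.2 _
    · exact (realize_extSentence e M).2 (hext m n _ _ e hB he)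

end BaldwinShi

/-!
The rank `δ` depends on a structure only through the hypergraph of its related sets, so the
combinatorics is done for hypergraphs with weighted edges, encoded by predicates `R E s` (`rk`,
`IsoOn`, `amalgam`). What drives everything is submodularity of the rank, together with the
existence of gadgets: hypergraphs over a base set `P` which take a weight `w` away from the rank of
`P`, but which are visible only to sets containing all of `P`. An edge is a gadget of weight `α E`.
Gadgets glued along a common center, of total weight slightly more than `1`, form a gadget again,
whose weight is the excess over `1`. A gadget of least weight `ε` exists, because weights are
multiples of the reciprocal of a common denominator; minimality forces `1` and all `α E` to be
multiples of `ε`, and stars of gadgets of weight `ε` provide gadgets of weight `ε` over arbitrarily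
large bases (`exists_gadget_unit`). So the rank of a finite hypergraph can be lowered by any
multiple of `ε`, without changing what smaller sets see (`exists_rank_drop`).

Now let `N` be a model and `A` a strong subset, and let `B` be a strong extension of `A` whose rank
is at most that of some finite strong `C ⊆ N`, where `C` may be taken to contain `A`. Amalgamate
`B` with `C` over `A`, and lower the rank of the amalgam to that of `C`. Then `C` is strong in the
result `D`, which therefore embeds in `N` over `C`, and as `δ(D) = δ(C)` the image of `D` is strong
in `N`; the image of `B` is strong in that of `D`. So `B` embeds strongly over `A`
(`exists_amalgam_drop`, `exists_strong_extension`): a back-and-forth step which is limited only by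
the ranks of the strong sets. Hence, if the ranks of strong sets in countable `M` and in `N` bound
each other, isomorphisms between finite strong sets form a back-and-forth system.

Isomorphisms between finite strong sets preserve all formulas even when the dimensions differ
(`IsStrongIso.realize_iff`). For every model contains `m` points that look independent to sets of
fewer than `m` elements (`exists_locally_free`), so its ultrapowers have strong sets of arbitrarily
large rank, the back-and-forth system between ultrapowers is unrestricted, and the diagonal
embedding is elementary and maps strong sets to strong sets. If `dim M ≤ dim N` and `M` is
countable, going forth only gives a map `M → N` all of whose finite restrictions extend to such
isomorphisms, so an elementary embedding; going back as well gives an isomorphism if the dimensions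
are equal.

For the chain, take a countable model `V` of infinite dimension, obtained by a construction in `ω`
steps (`exists_countable_model`), and in it an increasing sequence of strong sets `A k` of rank
`k * ε` (`exists_strong_succ`). The union of the finite `B ⊇ A k` with `δ(B) = δ(A k)` is a model of
dimension `k * ε`, since the set `D` above has the rank of `C` (`model_dimClosure`), and its strong
sets are strong in `V`, so the inclusions between these models are elementary. All ranks are
multiples of `ε`, so every countable model has the dimension of a member of the chain or of `V`.
Without relation symbols there is no `ε`, but then all models are infinite sets and the chain can
be constant (`exists_chain`).
-/

namespace BaldwinShi

open scoped Classical

/-! ### Hypergraphs and their ranks -/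

section

variable {ι V W : Type*}

/-- `f` is an isomorphism between the hypergraphs induced by `R` on `Y` and by `S` on `f '' Y`. -/
def IsoOn (R : ι → Finset V → Prop) (S : ι → Finset W → Prop) (f : V → W) (Y : Finset V) : Prop :=
  Set.InjOn f Y ∧ ∀ E s, s ⊆ Y → (R E s ↔ S E (s.image f))

theorem IsoOn.mono {R : ι → Finset V → Prop} {S : ι → Finset W → Prop} {f : V → W}
    {X Y : Finset V} (h : IsoOn R S f Y) (hX : X ⊆ Y) : IsoOn R S f X :=
  ⟨h.1.mono (Finset.coe_subset.2 hX), fun E s hs => h.2 E s (hs.trans hX)⟩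

theorem IsoOn.congr {R : ι → Finset V → Prop} {S : ι → Finset W → Prop} {f g : V → W}
    {Y : Finset V} (h : IsoOn R S f Y) (hfg : ∀ y ∈ Y, g y = f y) : IsoOn R S g Y := by
  refine ⟨h.1.congr fun y hy => (hfg y hy).symm, fun E s hs => ?_⟩
  rw [h.2 E s hs, Finset.image_congr fun y hy => hfg y (hs hy)]

theorem IsoOn.comp {U : Type*} {R : ι → Finset V → Prop} {S : ι → Finset W → Prop}
    {T : ι → Finset U → Prop} {f : V → W} {g : W → U} {Y : Finset V}
    (hg : IsoOn S T g (Y.image f)) (hf : IsoOn R S f Y) : IsoOn R T (g ∘ f) Y := by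
  refine ⟨?_, fun E s hs => ?_⟩
  · refine hg.1.comp hf.1 fun y hy => ?_
    simpa using ⟨y, hy, rfl⟩
  · rw [hf.2 E s hs, hg.2 E _ (Finset.image_subset_image hs), Finset.image_image]

theorem IsoOn.exists_inverse [Nonempty V] {R : ι → Finset V → Prop} {S : ι → Finset W → Prop}
    {f : V → W} {Y : Finset V} (h : IsoOn R S f Y) :
    ∃ g : W → V, (∀ y ∈ Y, g (f y) = y) ∧ IsoOn S R g (Y.image f) := by
  refine ⟨Function.invFunOn f Y, fun y hy => h.1.leftInvOn_invFunOn hy, ?_⟩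
  have hl : ∀ y ∈ Y, Function.invFunOn f Y (f y) = y := fun y hy => h.1.leftInvOn_invFunOn hy
  refine ⟨?_, fun E s hs => ?_⟩
  · intro a ha b hb hab
    simp only [Finset.coe_image, Set.mem_image, Finset.mem_coe] at ha hb
    obtain ⟨a, ha, rfl⟩ := ha
    obtain ⟨b, hb, rfl⟩ := hb
    rw [hl a ha, hl b hb] at hab
    rw [hab]
  · obtain ⟨t, ht, rfl⟩ := Finset.subset_image_iff.1 hs
    have : (t.image f).image (Function.invFunOn f Y) = t := by
      rw [Finset.image_image]
      conv_rhs => rw [← Finset.image_id (s := t)]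
      exact Finset.image_congr fun y hy => hl y (ht hy)
    rw [this, h.2 E t (by exact_mod_cast ht)]

theorem IsoOn.of_comp {U : Type*} {S : ι → Finset W → Prop} {R : ι → Finset V → Prop}
    {T : ι → Finset U → Prop} {φ : W → V} {g : V → U} {Y : Finset W} (hφ : IsoOn S R φ Y)
    (h : IsoOn S T (g ∘ φ) Y) : IsoOn R T g (Y.image φ) := by
  refine ⟨?_, fun E s hs => ?_⟩
  · intro a ha b hb hab
    simp only [Finset.coe_image, Set.mem_image, Finset.mem_coe] at ha hb
    obtain ⟨a, ha, rfl⟩ := ha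
    obtain ⟨b, hb, rfl⟩ := hb
    rw [h.1 ha hb hab]
  · obtain ⟨t, ht, rfl⟩ := Finset.subset_image_iff.1 hs
    have ht' : t ⊆ Y := by exact_mod_cast ht
    rw [← hφ.2 E t ht', h.2 E t ht', Finset.image_image]

/-- The free amalgam of a hypergraph `R` on `U` with a hypergraph `S` on `Y` along the part `X` of
`Y` that `g` sends into `U`. -/
def amalgam (R : ι → Finset V → Prop) (S : ι → Finset W → Prop) (g : W → V) (Y : Finset W) :
    ι → Finset V → Prop :=
  fun E s => R E s ∨ ∃ t ⊆ Y, S E t ∧ t.image g = s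

section amalgam

variable {R : ι → Finset V → Prop} {S : ι → Finset W → Prop} {g : W → V} {U : Finset V}
  {X Y : Finset W}

theorem image_subset_iff_of_injOn (hg : Set.InjOn g Y) {t Z : Finset W} (ht : t ⊆ Y)
    (hZ : Z ⊆ Y) : t.image g ⊆ Z.image g ↔ t ⊆ Z := by
  refine ⟨fun h x hx => ?_, fun h => Finset.image_subset_image h⟩
  obtain ⟨y, hy, hyx⟩ := Finset.mem_image.1 (h (Finset.mem_image_of_mem g hx))
  rwa [← hg (hZ hy) (ht hx) hyx]

theorem amalgam_left (hU : ∀ y ∈ Y, g y ∈ U ↔ y ∈ X) (hiso : IsoOn S R g X) {E : ι}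
    {s : Finset V} (hs : s ⊆ U) : amalgam R S g Y E s ↔ R E s := by
  refine ⟨?_, Or.inl⟩
  rintro (h | ⟨t, ht, hE, rfl⟩)
  · exact h
  · refine (hiso.2 E t fun y hy => ?_).1 hE
    exact (hU y (ht hy)).1 (hs (Finset.mem_image_of_mem g hy))

theorem isoOn_amalgam (hg : Set.InjOn g Y) (hR : ∀ E s, R E s → s ⊆ U)
    (hU : ∀ y ∈ Y, g y ∈ U ↔ y ∈ X) (hiso : IsoOn S R g X) :
    IsoOn S (amalgam R S g Y) g Y := by
  refine ⟨hg, fun E s hs => ⟨fun h => Or.inr ⟨s, hs, h, rfl⟩, ?_⟩⟩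
  rintro (h | ⟨t, ht, hE, hts⟩)
  · refine (hiso.2 E s fun y hy => ?_).2 h
    exact (hU y (hs hy)).1 (hR E _ h (Finset.mem_image_of_mem g hy))
  · have : t = s := Finset.Subset.antisymm ((image_subset_iff_of_injOn hg ht hs).1 hts.le)
      ((image_subset_iff_of_injOn hg hs ht).1 hts.ge)
    rwa [← this]

end amalgam

variable [Fintype ι]

/-- The rank of a finite set `X` of vertices in a hypergraph. Hypergraphs with edges of several
sorts are encoded by a predicate: `R E s` says that `s` is an edge of sort `E`. -/
noncomputable def rk (α : ι → ℚ) (R : ι → Finset V → Prop) (X : Finset V) : ℚ :=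
  (X.card : ℚ) - ∑ E, α E * ((X.powerset.filter (R E)).card : ℚ)

theorem rk_congr (α : ι → ℚ) {R R' : ι → Finset V → Prop} {X : Finset V}
    (h : ∀ E s, s ⊆ X → (R E s ↔ R' E s)) : rk α R X = rk α R' X := by
  unfold rk
  congr 1
  refine Finset.sum_congr rfl fun E _ => ?_
  congr 3
  exact Finset.filter_congr fun s hs => h E s (Finset.mem_powerset.1 hs)

theorem rk_le_card {α : ι → ℚ} (hα : ∀ E, 0 ≤ α E) (R : ι → Finset V → Prop) (X : Finset V) :
    rk α R X ≤ X.card := by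
  unfold rk
  have : 0 ≤ ∑ E, α E * ((X.powerset.filter (R E)).card : ℚ) :=
    Finset.sum_nonneg fun E _ => mul_nonneg (hα E) (Nat.cast_nonneg _)
  linarith

@[simp] theorem rk_empty (α : ι → ℚ) {R : ι → Finset V → Prop} (h : ∀ E s, R E s → s.Nonempty) :
    rk α R ∅ = 0 := by
  have : ∀ E, ¬ R E ∅ := fun E hE => by simpa using h E _ hE
  simp [rk, Finset.filter_singleton, this]

theorem rk_eq_card (α : ι → ℚ) {R : ι → Finset V → Prop} {X : Finset V}
    (h : ∀ E s, s ⊆ X → ¬ R E s) : rk α R X = X.card := by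
  have : ∀ E, X.powerset.filter (R E) = ∅ := fun E =>
    Finset.filter_eq_empty_iff.2 fun s hs => h E s (Finset.mem_powerset.1 hs)
  simp [rk, this]

/-- The weights are positive, so a set whose rank is its cardinality contains no edges. -/
theorem not_edge_of_card_le_rk {α : ι → ℚ} (hα : ∀ E, 0 < α E) {R : ι → Finset V → Prop}
    {X : Finset V} (h : (X.card : ℚ) ≤ rk α R X) {E : ι} {s : Finset V} (hs : s ⊆ X) :
    ¬ R E s := by
  intro hE
  have h0 : ∀ F ∈ Finset.univ, 0 ≤ α F * ((X.powerset.filter (R F)).card : ℚ) :=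
    fun F _ => mul_nonneg (hα F).le (Nat.cast_nonneg _)
  have h1 := Finset.single_le_sum h0 (Finset.mem_univ E)
  have h2 : 0 < (X.powerset.filter (R E)).card :=
    Finset.card_pos.2 ⟨s, Finset.mem_filter.2 ⟨Finset.mem_powerset.2 hs, hE⟩⟩
  have h3 : 0 < α E * ((X.powerset.filter (R E)).card : ℚ) :=
    mul_pos (hα E) (by exact_mod_cast h2)
  unfold rk at h
  linarith

theorem rk_or (α : ι → ℚ) {R S : ι → Finset V → Prop} {X : Finset V}
    (h : ∀ E s, s ⊆ X → R E s → ¬ S E s) :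
    rk α (fun E s => R E s ∨ S E s) X = rk α R X + rk α S X - X.card := by
  have key : ∀ E, (X.powerset.filter fun s => R E s ∨ S E s).card =
      (X.powerset.filter (R E)).card + (X.powerset.filter (S E)).card := by
    intro E
    rw [Finset.filter_or, Finset.card_union_of_disjoint]
    exact Finset.disjoint_filter.2 fun s hs => h E s (Finset.mem_powerset.1 hs)
  simp only [rk, key, Nat.cast_add, mul_add, Finset.sum_add_distrib]
  ring

theorem rk_inter (α : ι → ℚ) {R : ι → Finset V → Prop} {U : Finset V}
    (h : ∀ E s, R E s → s ⊆ U) (X : Finset V) :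
    rk α R X = rk α R (X ∩ U) + X.card - (X ∩ U).card := by
  have key : ∀ E, X.powerset.filter (R E) = (X ∩ U).powerset.filter (R E) := by
    intro E
    ext s
    simp only [Finset.mem_filter, Finset.mem_powerset, Finset.subset_inter_iff]
    exact ⟨fun ⟨h1, h2⟩ => ⟨⟨h1, h _ _ h2⟩, h2⟩, fun ⟨h1, h2⟩ => ⟨h1.1, h2⟩⟩
  simp only [rk, key]
  ring

/-- The rank in the union of two hypergraphs without common edges, with vertex sets `D₁`, `D₂`. -/
theorem rk_glue (α : ι → ℚ) {R S : ι → Finset V → Prop} {D₁ D₂ : Finset V}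
    (hR : ∀ E s, R E s → s ⊆ D₁) (hS : ∀ E s, S E s → s ⊆ D₂)
    (h : ∀ E s, R E s → ¬ S E s) {X : Finset V} (hX : X ⊆ D₁ ∪ D₂) :
    rk α (fun E s => R E s ∨ S E s) X =
      rk α R (X ∩ D₁) + rk α S (X ∩ D₂) - (X ∩ (D₁ ∩ D₂)).card := by
  rw [rk_or α fun E s _ => h E s, rk_inter α hR X, rk_inter α hS X]
  have h1 : (X ∩ D₁) ∪ (X ∩ D₂) = X := by
    rw [← Finset.inter_union_distrib_left, Finset.inter_eq_left.2 hX]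
  have h2 : (X ∩ D₁) ∩ (X ∩ D₂) = X ∩ (D₁ ∩ D₂) := by
    ext; simp; tauto
  have h3 := Finset.card_union_add_card_inter (X ∩ D₁) (X ∩ D₂)
  rw [h1, h2] at h3
  have h4 : (X.card : ℚ) + (X ∩ (D₁ ∩ D₂)).card = (X ∩ D₁).card + (X ∩ D₂).card := by
    exact_mod_cast h3
  linarith

theorem rk_submodular {α : ι → ℚ} (hα : ∀ E, 0 ≤ α E) (R : ι → Finset V → Prop)
    (X Y : Finset V) : rk α R (X ∪ Y) + rk α R (X ∩ Y) ≤ rk α R X + rk α R Y := by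
  have key : ∀ E, (X.powerset.filter (R E)).card + (Y.powerset.filter (R E)).card ≤
      ((X ∪ Y).powerset.filter (R E)).card + ((X ∩ Y).powerset.filter (R E)).card := by
    intro E
    rw [← Finset.card_union_add_card_inter]
    refine Nat.add_le_add (Finset.card_le_card ?_) (Finset.card_le_card ?_)
    · intro s
      simp only [Finset.mem_union, Finset.mem_filter, Finset.mem_powerset]
      rintro (⟨h1, h2⟩ | ⟨h1, h2⟩)
      · exact ⟨h1.trans Finset.subset_union_left, h2⟩
      · exact ⟨h1.trans Finset.subset_union_right, h2⟩
    · intro s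
      simp only [Finset.mem_inter, Finset.mem_filter, Finset.mem_powerset,
        Finset.subset_inter_iff]
      tauto
  have h1 : ∑ E, α E * ((X.powerset.filter (R E)).card : ℚ) +
      ∑ E, α E * ((Y.powerset.filter (R E)).card : ℚ) ≤
      ∑ E, α E * (((X ∪ Y).powerset.filter (R E)).card : ℚ) +
      ∑ E, α E * (((X ∩ Y).powerset.filter (R E)).card : ℚ) := by
    rw [← Finset.sum_add_distrib, ← Finset.sum_add_distrib]
    refine Finset.sum_le_sum fun E _ => ?_
    rw [← mul_add, ← mul_add]
    exact mul_le_mul_of_nonneg_left (by exact_mod_cast key E) (hα E)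
  have h2 : ((X ∪ Y).card : ℚ) + (X ∩ Y).card = X.card + Y.card := by
    exact_mod_cast Finset.card_union_add_card_inter X Y
  unfold rk
  linarith

theorem IsoOn.rk_image (α : ι → ℚ) {R : ι → Finset V → Prop} {S : ι → Finset W → Prop}
    {f : V → W} {X : Finset V} (h : IsoOn R S f X) :
    rk α S (X.image f) = rk α R X := by
  have hinj : ∀ s ⊆ X, ∀ t ⊆ X, s.image f = t.image f → s = t := by
    have aux : ∀ s ⊆ X, ∀ t ⊆ X, s.image f = t.image f → s ⊆ t := by
      intro s hs t ht hst x hx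
      have h1 : f x ∈ t.image f := hst ▸ Finset.mem_image_of_mem f hx
      obtain ⟨y, hy, hyx⟩ := Finset.mem_image.1 h1
      rwa [← h.1 (ht hy) (hs hx) hyx]
    exact fun s hs t ht hst => (aux s hs t ht hst).antisymm (aux t ht s hs hst.symm)
  have key : ∀ E, ((X.image f).powerset.filter (S E)).card = (X.powerset.filter (R E)).card := by
    intro E
    symm
    refine Finset.card_bij (fun s _ => s.image f) ?_ ?_ ?_
    · intro s hs
      rw [Finset.mem_filter, Finset.mem_powerset] at hs ⊢
      exact ⟨Finset.image_subset_image hs.1, (h.2 E s hs.1).1 hs.2⟩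
    · intro s hs t ht
      rw [Finset.mem_filter, Finset.mem_powerset] at hs ht
      exact hinj s hs.1 t ht.1
    · intro t ht
      rw [Finset.mem_filter, Finset.mem_powerset] at ht
      obtain ⟨s, hs, rfl⟩ := Finset.subset_image_iff.1 ht.1
      have hs' : s ⊆ X := by exact_mod_cast hs
      exact ⟨s, Finset.mem_filter.2 ⟨Finset.mem_powerset.2 hs', (h.2 E s hs').2 ht.2⟩, rfl⟩
  simp only [rk, key, Finset.card_image_of_injOn h.1]

section amalgam

variable {R : ι → Finset V → Prop} {S : ι → Finset W → Prop} {g : W → V} {U : Finset V}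
  {X Y : Finset W}

/-- Counting vertices and edges in the free amalgam: those of `S` on `X` are also in `R`. -/
theorem rk_amalgam (α : ι → ℚ) (hg : Set.InjOn g Y) (hXY : X ⊆ Y) (hR : ∀ E s, R E s → s ⊆ U)
    (hU : ∀ y ∈ Y, g y ∈ U ↔ y ∈ X) (hiso : IsoOn S R g X) {Z : Finset V}
    (hZ : Z ⊆ U ∪ Y.image g) :
    rk α (amalgam R S g Y) Z = rk α R (Z ∩ U) + rk α S (Y.filter (g · ∈ Z)) -
      rk α S (X.filter (g · ∈ Z)) := by
  set B := Y.filter (g · ∈ Z) with hB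
  set A := X.filter (g · ∈ Z) with hA
  have hAB : A ⊆ B := Finset.filter_subset_filter _ hXY
  have hcount : ∀ E, (Z.powerset.filter (amalgam R S g Y E)).card +
      (A.powerset.filter (S E)).card =
      ((Z ∩ U).powerset.filter (R E)).card + (B.powerset.filter (S E)).card := by
    intro E
    have hnew : ((B.powerset.filter (S E)) \ (A.powerset.filter (S E))).card =
        ((Z.powerset.filter (amalgam R S g Y E)) \ ((Z ∩ U).powerset.filter (R E))).card := by
      refine Finset.card_bij (fun s _ => s.image g) ?_ ?_ ?_
      · intro t ht
        simp only [Finset.mem_sdiff, Finset.mem_filter, Finset.mem_powerset] at ht ⊢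
        obtain ⟨⟨htB, hE⟩, hnot⟩ := ht
        have htY : t ⊆ Y := htB.trans (Finset.filter_subset _ _)
        refine ⟨⟨fun z hz => ?_, Or.inr ⟨t, htY, hE, rfl⟩⟩, fun h => hnot ⟨fun y hy => ?_, hE⟩⟩
        · obtain ⟨y, hy, rfl⟩ := Finset.mem_image.1 hz
          exact (Finset.mem_filter.1 (htB hy)).2
        · have := h.1 (Finset.mem_image_of_mem g hy)
          rw [Finset.mem_inter] at this
          exact Finset.mem_filter.2 ⟨(hU y (htY hy)).1 this.2, this.1⟩
      · intro s hs t ht hst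
        simp only [Finset.mem_sdiff, Finset.mem_filter, Finset.mem_powerset] at hs ht
        have hsY : s ⊆ Y := hs.1.1.trans (Finset.filter_subset _ _)
        have htY : t ⊆ Y := ht.1.1.trans (Finset.filter_subset _ _)
        exact Finset.Subset.antisymm ((image_subset_iff_of_injOn hg hsY htY).1 hst.le)
          ((image_subset_iff_of_injOn hg htY hsY).1 hst.ge)
      · intro s hs
        simp only [Finset.mem_sdiff, Finset.mem_filter, Finset.mem_powerset] at hs
        obtain ⟨⟨hsZ, hs'⟩, hnot⟩ := hs
        rcases hs' with h | ⟨t, ht, hE, rfl⟩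
        · exact absurd ⟨Finset.subset_inter hsZ (hR E s h), h⟩ hnot
        · refine ⟨t, ?_, rfl⟩
          simp only [Finset.mem_sdiff, Finset.mem_filter, Finset.mem_powerset]
          refine ⟨⟨fun y hy => Finset.mem_filter.2
            ⟨ht hy, hsZ (Finset.mem_image_of_mem g hy)⟩, hE⟩, fun h => hnot ⟨?_, ?_⟩⟩
          · refine Finset.subset_inter hsZ fun z hz => ?_
            obtain ⟨y, hy, rfl⟩ := Finset.mem_image.1 hz
            exact (hU y (ht hy)).2 (Finset.mem_filter.1 (h.1 hy)).1
          · exact (hiso.2 E t fun y hy => (Finset.mem_filter.1 (h.1 hy)).1).1 hE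
    have h1 : A.powerset.filter (S E) ⊆ B.powerset.filter (S E) :=
      Finset.filter_subset_filter _ (Finset.powerset_mono.2 hAB)
    have h2 : (Z ∩ U).powerset.filter (R E) ⊆ Z.powerset.filter (amalgam R S g Y E) := by
      intro s hs
      simp only [Finset.mem_filter, Finset.mem_powerset] at hs ⊢
      exact ⟨hs.1.trans Finset.inter_subset_left, Or.inl hs.2⟩
    have h3 := Finset.card_sdiff_add_card_eq_card h1
    have h4 := Finset.card_sdiff_add_card_eq_card h2
    omega
  have hvert : Z.card + A.card = (Z ∩ U).card + B.card := by
    have h1 : (B.image g).card = B.card :=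
      Finset.card_image_of_injOn (hg.mono (by exact_mod_cast Finset.filter_subset _ _))
    have h2 : (A.image g).card = A.card :=
      Finset.card_image_of_injOn
        (hg.mono (by exact_mod_cast (hAB.trans (Finset.filter_subset _ _))))
    have h3 : (Z ∩ U) ∪ B.image g = Z := by
      ext z
      simp only [Finset.mem_union, Finset.mem_inter, Finset.mem_image, hB, Finset.mem_filter]
      constructor
      · rintro (h | ⟨y, hy, rfl⟩)
        exacts [h.1, hy.2]
      · intro hz
        rcases Finset.mem_union.1 (hZ hz) with h | h
        · exact Or.inl ⟨hz, h⟩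
        · obtain ⟨y, hy, rfl⟩ := Finset.mem_image.1 h
          exact Or.inr ⟨y, ⟨hy, hz⟩, rfl⟩
    have h4 : (Z ∩ U) ∩ B.image g = A.image g := by
      ext z
      simp only [Finset.mem_inter, Finset.mem_image, hB, hA, Finset.mem_filter]
      constructor
      · rintro ⟨⟨hz, hzU⟩, y, ⟨hy, -⟩, rfl⟩
        exact ⟨y, ⟨(hU y hy).1 hzU, hz⟩, rfl⟩
      · rintro ⟨y, ⟨hy, hz⟩, rfl⟩
        exact ⟨⟨hz, (hU y (hXY hy)).2 hy⟩, y, ⟨hXY hy, hz⟩, rfl⟩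
    have h5 := Finset.card_union_add_card_inter (Z ∩ U) (B.image g)
    rw [h3, h4, h1, h2] at h5
    exact h5
  have hsum : ∑ E, α E * ((Z.powerset.filter (amalgam R S g Y E)).card : ℚ) +
      ∑ E, α E * ((A.powerset.filter (S E)).card : ℚ) =
      ∑ E, α E * (((Z ∩ U).powerset.filter (R E)).card : ℚ) +
      ∑ E, α E * ((B.powerset.filter (S E)).card : ℚ) := by
    rw [← Finset.sum_add_distrib, ← Finset.sum_add_distrib]
    refine Finset.sum_congr rfl fun E _ => ?_
    rw [← mul_add, ← mul_add]
    congr 1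
    exact_mod_cast hcount E
  have hvert' : (Z.card : ℚ) + A.card = (Z ∩ U).card + B.card := by exact_mod_cast hvert
  unfold rk
  linarith

/-- Intersecting with a strong subset `X` of `Y` does not raise the rank, by submodularity. -/
theorem rk_inter_le {α : ι → ℚ} (hα : ∀ E, 0 ≤ α E)
    (hstr : ∀ Z, X ⊆ Z → Z ⊆ Y → rk α S X ≤ rk α S Z) (hXY : X ⊆ Y) {Z : Finset W}
    (hZ : Z ⊆ Y) : rk α S (Z ∩ X) ≤ rk α S Z := by
  have h1 := rk_submodular hα S Z X
  have h2 := hstr (Z ∪ X) Finset.subset_union_right (Finset.union_subset hZ hXY)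
  linarith

end amalgam

theorem exists_rk_eq {α : ι → ℚ} {ε : ℚ} (h1 : ∃ k : ℤ, 1 = k * ε)
    (hα : ∀ E, ∃ k : ℤ, α E = k * ε) (R : ι → Finset V → Prop) (X : Finset V) :
    ∃ k : ℤ, rk α R X = k * ε := by
  obtain ⟨a, ha⟩ := h1
  choose b hb using hα
  refine ⟨X.card * a - ∑ E, b E * (X.powerset.filter (R E)).card, ?_⟩
  unfold rk
  push_cast
  rw [sub_mul, Finset.sum_mul, mul_assoc, ← ha, mul_one]
  congr 1
  refine Finset.sum_congr rfl fun E _ => ?_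
  rw [hb E]
  ring

/-- The reciprocal of a common denominator of the weights. -/
theorem exists_unit (α : ι → ℚ) :
    ∃ ε : ℚ, 0 < ε ∧ (∃ k : ℤ, 1 = k * ε) ∧ ∀ E, ∃ k : ℤ, α E = k * ε := by
  have hpos : (0 : ℚ) < ∏ E, ((α E).den : ℚ) :=
    Finset.prod_pos fun E _ => by exact_mod_cast (α E).den_pos
  refine ⟨(∏ E, ((α E).den : ℚ))⁻¹, inv_pos.2 hpos, ⟨∏ E, ((α E).den : ℤ), ?_⟩, fun E =>
    ⟨(α E).num * ∏ F ∈ Finset.univ.erase E, ((α F).den : ℤ), ?_⟩⟩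
  · push_cast
    rw [mul_inv_cancel₀ hpos.ne']
  · push_cast
    rw [eq_mul_inv_iff_mul_eq₀ hpos.ne', ← Finset.mul_prod_erase _ _ (Finset.mem_univ E),
      ← mul_assoc, Rat.mul_den_eq_num]

theorem exists_nat_mul_of_int_mul {x ε : ℚ} (hε : 0 < ε) (hx : 0 ≤ x) (h : ∃ k : ℤ, x = k * ε) :
    ∃ k : ℕ, x = k * ε := by
  obtain ⟨k, rfl⟩ := h
  have hk : 0 ≤ k := by exact_mod_cast nonneg_of_mul_nonneg_left hx hε
  refine ⟨k.toNat, ?_⟩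
  congr 1
  exact_mod_cast (Int.toNat_of_nonneg hk).symm

theorem exists_rk_eq_int_mul {α : ι → ℚ} {ε : ℚ}
    (h1 : ∃ k : ℕ, 1 = k * ε) (hα : ∀ E, ∃ k : ℕ, α E = k * ε) (R : ι → Finset V → Prop)
    (X : Finset V) : ∃ k : ℤ, rk α R X = k * ε :=
  exists_rk_eq (h1.imp' (fun k : ℕ => (k : ℤ)) fun _ h => by exact_mod_cast h)
    (fun E => (hα E).imp' (fun k : ℕ => (k : ℤ)) fun _ h => by exact_mod_cast h) R X

end

/-! ### Gadgets that lower the rank -/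

section

variable {ι : Type*} [Fintype ι] {V : Type*}

/-- A gadget of weight `w` over `P`: a hypergraph `G` on `D ⊇ P` that takes `w` away from the
rank `|P|` of the set `P` of isolated points, but only from sets that contain all of `P`: a set `X`
that does not keeps rank at least `|X ∩ P|`. A single edge `P = D` of sort `E` is the model case,
with `w = α E`. -/
structure IsGadget (α : ι → ℚ) (ρ : ι → ℕ) (w : ℚ) (P D : Finset V)
    (G : ι → Finset V → Prop) : Prop where
  subset : P ⊆ D
  edge_subset : ∀ E s, G E s → s ⊆ D
  edge_card : ∀ E s, G E s → s.card = ρ E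
  le_of_not_subset : ∀ X ⊆ D, ¬ P ⊆ X → ((X ∩ P).card : ℚ) ≤ rk α G X
  le_of_subset : ∀ X ⊆ D, P ⊆ X → (P.card : ℚ) - w ≤ rk α G X
  rk_eq : rk α G D = P.card - w

variable (V) in
/-- There are gadgets of weight `w` over all sets of size `s`, and their new vertices can be chosen
outside any given finite set. -/
def HasGadget (α : ι → ℚ) (ρ : ι → ℕ) (w : ℚ) (s : ℕ) : Prop :=
  ∀ P Z : Finset V, P.card = s → ∃ D G, IsGadget α ρ w P D G ∧ Disjoint (D \ P) Z

variable (V) in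
/-- As `HasGadget`, for gadgets in which no edge lies inside the base. -/
def HasProperGadget (α : ι → ℚ) (ρ : ι → ℕ) (w : ℚ) (s : ℕ) : Prop :=
  ∀ P Z : Finset V, P.card = s → ∃ D G, IsGadget α ρ w P D G ∧ Disjoint (D \ P) Z ∧
    ∀ E t, t ⊆ P → ¬ G E t

theorem HasProperGadget.hasGadget {α : ι → ℚ} {ρ : ι → ℕ} {w : ℚ} {s : ℕ}
    (h : HasProperGadget V α ρ w s) : HasGadget V α ρ w s := fun P Z hP =>
  let ⟨D, G, h1, h2, _⟩ := h P Z hP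
  ⟨D, G, h1, h2⟩

theorem hasGadget_edge {α : ι → ℚ} {ρ : ι → ℕ} (E : ι) : HasGadget V α ρ (α E) (ρ E) := by
  intro P Z hP
  obtain ⟨G, hG⟩ : ∃ G : ι → Finset V → Prop, ∀ F s, G F s ↔ F = E ∧ s = P :=
    ⟨fun F s => F = E ∧ s = P, fun _ _ => Iff.rfl⟩
  have hrk : rk α G P = P.card - α E := by
    have : ∀ F, ((P.powerset.filter (G F)).card : ℚ) = if F = E then 1 else 0 := by
      intro F
      split_ifs with h
      · have : P.powerset.filter (G F) = {P} := by
          ext s; simp only [hG, Finset.mem_filter, Finset.mem_powerset, Finset.mem_singleton]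
          exact ⟨fun hs => hs.2.2, fun hs => ⟨hs.le, h, hs⟩⟩
        simp [this]
      · have : P.powerset.filter (G F) = ∅ := by
          ext s; simp [hG, h]
        simp [this]
    have hsum : ∑ F, α F * ((P.powerset.filter (G F)).card : ℚ) = α E := by
      simp only [this, mul_ite, mul_one, mul_zero, Finset.sum_ite_eq', Finset.mem_univ, if_true]
    rw [rk, hsum]
  refine ⟨P, G, ⟨le_rfl, fun F s h => ((hG F s).1 h).2.le, ?_, ?_, ?_, hrk⟩, by simp⟩
  · intro F s h
    obtain ⟨rfl, rfl⟩ := (hG F s).1 h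
    exact hP
  · intro X hX hPX
    rw [rk_eq_card α, Finset.inter_eq_left.2 hX]
    intro F s hs h
    exact hPX (((hG F s).1 h).2 ▸ hs)
  · intro X hX hPX
    rw [hX.antisymm hPX, hrk]

variable (V) in
/-- Gadgets glued along a common vertex `x`: over `P`, of total size `S`, they have total weight
`W`, and at least `μ` of that is lost as soon as a vertex of `P` is missing. -/
def HasStar (α : ι → ℚ) (ρ : ι → ℕ) (μ W : ℚ) (S : ℕ) : Prop :=
  ∀ (x : V) (P Z : Finset V), x ∉ P → P.card = S → ∃ D G, insert x P ⊆ D ∧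
    (∀ E s, G E s → s ⊆ D) ∧ (∀ E s, G E s → s.card = ρ E) ∧ Disjoint (D \ insert x P) Z ∧
    (∀ X ⊆ D, x ∉ X → ((X ∩ P).card : ℚ) ≤ rk α G X) ∧
    (∀ X ⊆ D, x ∈ X → P ⊆ X → (P.card : ℚ) + 1 - W ≤ rk α G X) ∧
    (∀ X ⊆ D, x ∈ X → ¬ P ⊆ X → ((X ∩ P).card : ℚ) + 1 - (W - μ) ≤ rk α G X) ∧
    rk α G D = P.card + 1 - W

theorem hasStar_zero {α : ι → ℚ} {ρ : ι → ℕ} {μ : ℚ} : HasStar V α ρ μ 0 0 := by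
  intro x P Z hx hP
  obtain rfl := Finset.card_eq_zero.1 hP
  have h : ∀ X : Finset V, rk α (fun _ _ => False) X = X.card := fun X =>
    rk_eq_card α fun _ _ _ => not_false
  refine ⟨{x}, fun _ _ => False, by simp, by simp, by simp, by simp, ?_, ?_, ?_, ?_⟩
  · intro X hX hxX
    simp [h]
  · intro X hX hxX _
    have : X = {x} := hX.antisymm (by simpa using hxX)
    simp [h, this]
  · intro X hX hxX hn
    exact absurd (Finset.empty_subset X) hn
  · simp [h]

/-- One more gadget is glued to a star: its base consists of the center and new points of `P`. -/
theorem HasStar.cons {α : ι → ℚ} {ρ : ι → ℕ} (hρ : ∀ E, 2 ≤ ρ E) {μ W w : ℚ} {S s : ℕ}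
    (hμ : 0 ≤ μ) (hw : μ ≤ w) (hs : 1 ≤ s) (h : HasStar V α ρ μ W S) (hg : HasGadget V α ρ w s) :
    HasStar V α ρ μ (W + w) (S + (s - 1)) := by
  intro x P Z hx hP
  obtain ⟨P₁, hP₁, hcard₁⟩ := Finset.exists_subset_card_eq (s := P) (n := S) (by omega)
  set P₂ := P \ P₁ with hP₂
  have hcard₂ : P₂.card = s - 1 := by
    rw [hP₂, Finset.card_sdiff_of_subset hP₁]; omega
  have hP₂P : P₂ ⊆ P := Finset.sdiff_subset
  have hunion : P₁ ∪ P₂ = P := by rw [hP₂, Finset.union_sdiff_of_subset hP₁]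
  have hdisj : Disjoint P₁ P₂ := Finset.disjoint_sdiff
  have hx₁ : x ∉ P₁ := fun h => hx (hP₁ h)
  have hx₂ : x ∉ P₂ := fun h => hx (hP₂P h)
  obtain ⟨D₁, G₁, hsub₁, hes₁, hec₁, hd₁, ha₁, hb₁, hc₁, hr₁⟩ := h x P₁ (Z ∪ P) hx₁ hcard₁
  obtain ⟨D₂, G₂, hG₂, hd₂⟩ := hg (insert x P₂) (Z ∪ P ∪ D₁)
    (by rw [Finset.card_insert_of_notMem hx₂, hcard₂]; omega)
  have hxD₁ : x ∈ D₁ := hsub₁ (Finset.mem_insert_self _ _)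
  have hxD₂ : x ∈ D₂ := hG₂.subset (Finset.mem_insert_self _ _)
  have hP₁D : P₁ ⊆ D₁ := (Finset.subset_insert _ _).trans hsub₁
  have hP₂D : P₂ ⊆ D₂ := (Finset.subset_insert _ _).trans hG₂.subset
  have hinter : D₁ ∩ D₂ = {x} := by
    ext y
    simp only [Finset.mem_inter, Finset.mem_singleton]
    refine ⟨fun ⟨h1, h2⟩ => ?_, fun h => h ▸ ⟨hxD₁, hxD₂⟩⟩
    by_contra hne
    by_cases hy₂ : y ∈ P₂
    · have hy₁ : y ∉ P₁ := fun h => Finset.disjoint_left.1 hdisj h hy₂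
      exact Finset.disjoint_left.1 hd₁ (by simp [h1, hne, hy₁] : y ∈ D₁ \ insert x P₁)
        (by simp [hP₂P hy₂])
    · exact Finset.disjoint_left.1 hd₂ (by simp [h2, hne, hy₂] : y ∈ D₂ \ insert x P₂)
        (by simp [h1])
  have hglue : ∀ X ⊆ D₁ ∪ D₂, rk α (fun E s => G₁ E s ∨ G₂ E s) X =
      rk α G₁ (X ∩ D₁) + rk α G₂ (X ∩ D₂) - (X ∩ {x}).card := by
    intro X hX
    rw [← hinter]
    refine rk_glue α hes₁ hG₂.edge_subset (fun E t h1 h2 => ?_) hX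
    have h3 : t ⊆ {x} := hinter ▸ Finset.subset_inter (hes₁ E t h1) (hG₂.edge_subset E t h2)
    have h4 := Finset.card_le_card h3
    rw [hec₁ E t h1, Finset.card_singleton] at h4
    have := hρ E
    omega
  have hX₁ : ∀ X : Finset V, X ∩ D₁ ∩ P₁ = X ∩ P₁ := fun X => by
    rw [Finset.inter_assoc, Finset.inter_eq_right.2 hP₁D]
  have hX₂ : ∀ X : Finset V, X ∩ D₂ ∩ insert x P₂ = X ∩ insert x P₂ := fun X => by
    rw [Finset.inter_assoc, Finset.inter_eq_right.2 hG₂.subset]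
  have hcard : ∀ X : Finset V, ((X ∩ P).card : ℚ) = (X ∩ P₁).card + (X ∩ P₂).card := by
    intro X
    rw [← hunion, Finset.inter_union_distrib_left, Finset.card_union_of_disjoint]
    · push_cast; rfl
    · exact hdisj.mono Finset.inter_subset_right Finset.inter_subset_right
  have hPc : (P.card : ℚ) = P₁.card + P₂.card := by
    rw [← hunion, Finset.card_union_of_disjoint hdisj]; push_cast; rfl
  have hin : ∀ X : Finset V, x ∈ X → ((X ∩ insert x P₂).card : ℚ) = (X ∩ P₂).card + 1 := by
    intro X hxX
    rw [Finset.inter_insert_of_mem hxX, Finset.card_insert_of_notMem (by simp [hx₂])]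
    push_cast; rfl
  have hic : ((insert x P₂).card : ℚ) = P₂.card + 1 := by
    rw [Finset.card_insert_of_notMem hx₂]; push_cast; rfl
  refine ⟨D₁ ∪ D₂, fun E s => G₁ E s ∨ G₂ E s, ?_, ?_, ?_, ?_, ?_, ?_, ?_, ?_⟩
  · rw [← hunion]
    refine Finset.insert_subset (by simp [hxD₁]) (Finset.union_subset_union hP₁D hP₂D)
  · rintro E t (ht | ht)
    exacts [(hes₁ E t ht).trans Finset.subset_union_left,
      (hG₂.edge_subset E t ht).trans Finset.subset_union_right]
  · rintro E t (ht | ht)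
    exacts [hec₁ E t ht, hG₂.edge_card E t ht]
  · rw [Finset.disjoint_left] at hd₁ hd₂ ⊢
    intro y hy hyZ
    simp only [Finset.mem_sdiff, Finset.mem_union, Finset.mem_insert, not_or] at hy
    have hy₁ : y ∉ P₁ := fun h => hy.2.2 (hP₁ h)
    have hy₂ : y ∉ P₂ := fun h => hy.2.2 (hP₂P h)
    rcases hy.1 with h1 | h1
    · exact hd₁ (a := y) (by simp [h1, hy.2.1, hy₁]) (by simp [hyZ])
    · exact hd₂ (a := y) (by simp [h1, hy.2.1, hy₂]) (by simp [hyZ])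
  · intro X hX hxX
    have h1 := ha₁ (X ∩ D₁) Finset.inter_subset_right (by simp [hxX])
    have h2 := hG₂.le_of_not_subset (X ∩ D₂) Finset.inter_subset_right
      (fun h => hxX (Finset.mem_inter.1 (h (Finset.mem_insert_self _ _))).1)
    rw [hX₁] at h1
    rw [hX₂, Finset.inter_insert_of_notMem hxX] at h2
    rw [hglue X hX, hcard, Finset.inter_singleton_of_notMem hxX, Finset.card_empty]
    push_cast
    linarith
  · intro X hX hxX hPX
    have h1 := hb₁ (X ∩ D₁) Finset.inter_subset_right (by simp [hxX, hxD₁])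
      (Finset.subset_inter (hP₁.trans hPX) hP₁D)
    have h2 := hG₂.le_of_subset (X ∩ D₂) Finset.inter_subset_right
      (Finset.subset_inter (Finset.insert_subset hxX (hP₂P.trans hPX)) hG₂.subset)
    rw [hic] at h2
    rw [hglue X hX, hPc, Finset.inter_singleton_of_mem hxX, Finset.card_singleton]
    push_cast
    linarith
  · intro X hX hxX hPX
    rw [hglue X hX, hcard, Finset.inter_singleton_of_mem hxX, Finset.card_singleton]
    push_cast
    have hxX₁ : x ∈ X ∩ D₁ := by simp [hxX, hxD₁]
    by_cases h₁ : P₁ ⊆ X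
    · have h₂ : ¬ P₂ ⊆ X := fun h => hPX (hunion ▸ Finset.union_subset h₁ h)
      have h1 := hb₁ (X ∩ D₁) Finset.inter_subset_right hxX₁ (Finset.subset_inter h₁ hP₁D)
      have h2 := hG₂.le_of_not_subset (X ∩ D₂) Finset.inter_subset_right
        (fun h => h₂ ((Finset.subset_insert _ _).trans (h.trans Finset.inter_subset_left)))
      rw [hX₂, hin X hxX] at h2
      rw [Finset.inter_eq_right.2 h₁]
      linarith
    · have h1 := hc₁ (X ∩ D₁) Finset.inter_subset_right hxX₁
        (fun h => h₁ (h.trans Finset.inter_subset_left))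
      rw [hX₁] at h1
      by_cases h₂ : P₂ ⊆ X
      · have h2 := hG₂.le_of_subset (X ∩ D₂) Finset.inter_subset_right
          (Finset.subset_inter (Finset.insert_subset hxX h₂) hG₂.subset)
        rw [hic] at h2
        rw [Finset.inter_eq_right.2 h₂]
        linarith
      · have h2 := hG₂.le_of_not_subset (X ∩ D₂) Finset.inter_subset_right
          (fun h => h₂ ((Finset.subset_insert _ _).trans (h.trans Finset.inter_subset_left)))
        rw [hX₂, hin X hxX] at h2
        linarith
  · rw [hglue _ le_rfl, Finset.inter_eq_right.2 Finset.subset_union_left,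
      Finset.inter_eq_right.2 Finset.subset_union_right, hr₁, hG₂.rk_eq, hic, hPc,
      Finset.inter_singleton_of_mem (by simp [hxD₁]), Finset.card_singleton]
    push_cast
    ring

theorem HasStar.cons_iterate {α : ι → ℚ} {ρ : ι → ℕ} (hρ : ∀ E, 2 ≤ ρ E) {μ W w : ℚ} {S s : ℕ}
    (hμ : 0 ≤ μ) (hw : μ ≤ w) (hs : 1 ≤ s) (h : HasStar V α ρ μ W S) (hg : HasGadget V α ρ w s)
    (k : ℕ) : HasStar V α ρ μ (W + k * w) (S + k * (s - 1)) := by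
  induction k with
  | zero => simpa using h
  | succ k ih =>
    have := ih.cons hρ hμ hw hs hg
    convert this using 1
    · push_cast; ring
    · ring

/-- A star of weight between `1` and `1 + μ` is a gadget of weight `W - 1` over `P`: its center
counts as a new vertex, which costs `1`. -/
theorem HasStar.hasProperGadget [Infinite V] {α : ι → ℚ} (hα : ∀ E, 0 < α E) {ρ : ι → ℕ}
    {μ W : ℚ} {S : ℕ} (h : HasStar V α ρ μ W S) (h1 : 1 ≤ W) (h2 : W - μ ≤ 1) :
    HasProperGadget V α ρ (W - 1) S := by
  intro P Z hP
  obtain ⟨x, hx⟩ := Infinite.exists_notMem_finset (P ∪ Z)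
  rw [Finset.mem_union, not_or] at hx
  obtain ⟨D, G, hsub, hes, hec, hd, ha, hb, hc, hr⟩ := h x P Z hx.1 hP
  have hPD : P ⊆ D := (Finset.subset_insert _ _).trans hsub
  refine ⟨D, G, ⟨hPD, hes, hec, ?_, ?_, ?_⟩, ?_, ?_⟩
  · intro X hX hPX
    by_cases hxX : x ∈ X
    · have := hc X hX hxX hPX
      linarith
    · exact ha X hX hxX
  · intro X hX hPX
    by_cases hxX : x ∈ X
    · have := hb X hX hxX hPX
      linarith
    · have := ha X hX hxX
      rw [Finset.inter_eq_right.2 hPX] at this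
      linarith
  · rw [hr]; ring
  · rw [Finset.disjoint_left] at hd ⊢
    intro y hy hyZ
    rw [Finset.mem_sdiff] at hy
    have hyx : y ≠ x := fun h => hx.2 (h ▸ hyZ)
    exact hd (a := y) (by simp [hy, hyx]) hyZ
  · intro E t ht
    refine not_edge_of_card_le_rk hα ?_ ht
    simpa using ha P hPD hx.1

/-- Gadgets over the same base can be put side by side. -/
theorem HasProperGadget.add {α : ι → ℚ} {ρ : ι → ℕ} {w₁ w₂ : ℚ} {s : ℕ}
    (h₁ : HasProperGadget V α ρ w₁ s) (h₂ : HasProperGadget V α ρ w₂ s) :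
    HasProperGadget V α ρ (w₁ + w₂) s := by
  intro P Z hP
  obtain ⟨D₁, G₁, hG₁, hd₁, hp₁⟩ := h₁ P Z hP
  obtain ⟨D₂, G₂, hG₂, hd₂, hp₂⟩ := h₂ P (Z ∪ D₁) hP
  have hinter : D₁ ∩ D₂ = P := by
    refine Finset.Subset.antisymm (fun y hy => ?_) (Finset.subset_inter hG₁.subset hG₂.subset)
    rw [Finset.mem_inter] at hy
    by_contra hyP
    exact Finset.disjoint_left.1 hd₂ (by simp [hy, hyP] : y ∈ D₂ \ P) (by simp [hy])
  have hglue : ∀ X ⊆ D₁ ∪ D₂, rk α (fun E s => G₁ E s ∨ G₂ E s) X =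
      rk α G₁ (X ∩ D₁) + rk α G₂ (X ∩ D₂) - (X ∩ P).card := by
    intro X hX
    rw [← hinter]
    refine rk_glue α hG₁.edge_subset hG₂.edge_subset (fun E t h1 h2 => ?_) hX
    exact hp₁ E t (hinter ▸ Finset.subset_inter (hG₁.edge_subset E t h1)
      (hG₂.edge_subset E t h2)) h1
  have hX₁ : ∀ X : Finset V, X ∩ D₁ ∩ P = X ∩ P := fun X => by
    rw [Finset.inter_assoc, Finset.inter_eq_right.2 hG₁.subset]
  have hX₂ : ∀ X : Finset V, X ∩ D₂ ∩ P = X ∩ P := fun X => by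
    rw [Finset.inter_assoc, Finset.inter_eq_right.2 hG₂.subset]
  refine ⟨D₁ ∪ D₂, fun E s => G₁ E s ∨ G₂ E s,
    ⟨hG₁.subset.trans Finset.subset_union_left, ?_, ?_, ?_, ?_, ?_⟩, ?_, ?_⟩
  · rintro E t (ht | ht)
    exacts [(hG₁.edge_subset E t ht).trans Finset.subset_union_left,
      (hG₂.edge_subset E t ht).trans Finset.subset_union_right]
  · rintro E t (ht | ht)
    exacts [hG₁.edge_card E t ht, hG₂.edge_card E t ht]
  · intro X hX hPX
    have h1 := hG₁.le_of_not_subset (X ∩ D₁) Finset.inter_subset_right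
      fun h => hPX (h.trans Finset.inter_subset_left)
    have h2 := hG₂.le_of_not_subset (X ∩ D₂) Finset.inter_subset_right
      fun h => hPX (h.trans Finset.inter_subset_left)
    rw [hX₁] at h1
    rw [hX₂] at h2
    rw [hglue X hX]
    linarith
  · intro X hX hPX
    have h1 := hG₁.le_of_subset (X ∩ D₁) Finset.inter_subset_right
      (Finset.subset_inter hPX hG₁.subset)
    have h2 := hG₂.le_of_subset (X ∩ D₂) Finset.inter_subset_right
      (Finset.subset_inter hPX hG₂.subset)
    rw [hglue X hX, Finset.inter_eq_right.2 hPX]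
    linarith
  · rw [hglue _ le_rfl, Finset.inter_eq_right.2 Finset.subset_union_left,
      Finset.inter_eq_right.2 Finset.subset_union_right, hG₁.rk_eq, hG₂.rk_eq,
      Finset.inter_eq_right.2 (hG₁.subset.trans Finset.subset_union_left)]
    ring
  · rw [Finset.disjoint_left] at hd₁ hd₂ ⊢
    intro y hy hyZ
    simp only [Finset.mem_sdiff, Finset.mem_union] at hy
    rcases hy.1 with h | h
    · exact hd₁ (a := y) (by simp [h, hy.2]) hyZ
    · exact hd₂ (a := y) (by simp [h, hy.2]) (by simp [hyZ])
  · rintro E t ht (h | h)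
    exacts [hp₁ E t ht h, hp₂ E t ht h]

theorem hasProperGadget_zero {α : ι → ℚ} {ρ : ι → ℕ} {s : ℕ} : HasProperGadget V α ρ 0 s := by
  intro P Z _
  have h : ∀ X : Finset V, rk α (fun _ _ => False) X = X.card := fun X =>
    rk_eq_card α fun _ _ _ => not_false
  refine ⟨P, fun _ _ => False, ⟨le_rfl, by simp, by simp, ?_, ?_, by simp [h]⟩, by simp, by simp⟩
  · intro X hX _
    rw [h]
    exact_mod_cast Finset.card_le_card Finset.inter_subset_left
  · intro X _ hPX
    rw [h, sub_zero]
    exact_mod_cast Finset.card_le_card hPX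

theorem HasProperGadget.nat_mul {α : ι → ℚ} {ρ : ι → ℕ} {w : ℚ} {s : ℕ}
    (h : HasProperGadget V α ρ w s) (k : ℕ) : HasProperGadget V α ρ (k * w) s := by
  induction k with
  | zero => simpa using hasProperGadget_zero
  | succ k ih =>
    have := ih.add h
    convert this using 1
    push_cast; ring

/-- The weights of gadgets have a least element `ε`. Stars of gadgets of weight `ε`, with at most
one edge added, have weights in `(0, ε]`, so exactly `ε`; that makes `1` and all `α E` multiples
of `ε`. -/
theorem exists_gadget_unit [Infinite V] [Nonempty ι] {α : ι → ℚ} (hα : ∀ E, 0 < α E ∧ α E < 1)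
    {ρ : ι → ℕ} (hρ : ∀ E, 2 ≤ ρ E) :
    ∃ ε : ℚ, 0 < ε ∧ (∃ k : ℕ, 1 = k * ε) ∧ (∀ E, ∃ k : ℕ, α E = k * ε) ∧
      ∀ n : ℕ, ∃ s ≥ n, HasProperGadget V α ρ ε s := by
  have hα0 : ∀ E, 0 < α E := fun E => (hα E).1
  obtain ⟨η, hη, hη1, hηα⟩ := exists_unit α
  let Q : ℕ → Prop := fun k => 0 < k ∧ ∃ s ≥ 2, HasGadget V α ρ (k * η) s
  -- a weight is a difference of a cardinality and a rank, so it is a multiple of `η`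
  have hmul : ∀ w s, 0 < w → HasGadget V α ρ w s → ∃ k : ℕ, 0 < k ∧ w = k * η := by
    intro w s hw h
    obtain ⟨P, hP⟩ := Infinite.exists_subset_card_eq V s
    obtain ⟨D, G, hG, -⟩ := h P ∅ hP
    obtain ⟨a, ha⟩ := exists_rk_eq hη1 hηα G D
    obtain ⟨b, hb⟩ := hη1
    have h1 := hG.rk_eq
    have h2 : w = ((P.card * b - a : ℤ) : ℚ) * η := by
      push_cast
      rw [sub_mul, mul_assoc, ← hb, ← ha]
      linarith
    have h3 : 0 < (P.card * b - a : ℤ) := by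
      have : (0 : ℚ) < ((P.card * b - a : ℤ) : ℚ) := by
        by_contra hcon
        rw [h2] at hw
        exact absurd hw (not_lt.2 (mul_nonpos_of_nonpos_of_nonneg (not_lt.1 hcon) hη.le))
      exact_mod_cast this
    refine ⟨(P.card * b - a : ℤ).toNat, by omega, ?_⟩
    rw [h2]
    congr 1
    have : (((P.card * b - a : ℤ).toNat : ℤ) : ℚ) = ((P.card * b - a : ℤ) : ℚ) := by
      rw [Int.toNat_of_nonneg h3.le]
    exact_mod_cast this.symm
  have hex : ∃ k, Q k := by
    obtain ⟨E⟩ := ‹Nonempty ι›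
    obtain ⟨k, hk, hk'⟩ := hmul _ _ (hα0 E) (hasGadget_edge (V := V) (α := α) (ρ := ρ) E)
    exact ⟨k, hk, ρ E, hρ E, hk' ▸ hasGadget_edge E⟩
  obtain ⟨hk0, s, hs, hgs⟩ := Nat.find_spec hex
  set ε : ℚ := Nat.find hex * η with hε
  have hε0 : 0 < ε := mul_pos (by exact_mod_cast hk0) hη
  have hmin : ∀ w t, 0 < w → 2 ≤ t → HasGadget V α ρ w t → ε ≤ w := by
    intro w t hw ht h
    obtain ⟨k, hk, rfl⟩ := hmul w t hw h
    exact mul_le_mul_of_nonneg_right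
      (by exact_mod_cast Nat.find_min' hex ⟨hk, t, ht, h⟩) hη.le
  have hεα : ∀ E, ε ≤ α E := fun E => hmin _ _ (hα0 E) (hρ E) (hasGadget_edge E)
  have hε1 : ε < 1 := by
    obtain ⟨E⟩ := ‹Nonempty ι›
    exact (hεα E).trans_lt (hα E).2
  have hstar : ∀ {W : ℚ} {S : ℕ}, HasStar V α ρ ε W S → 1 < W → W - ε ≤ 1 → 2 ≤ S →
      W = 1 + ε := by
    intro W S h h1 h2 hS
    have := hmin (W - 1) S (by linarith) hS (h.hasProperGadget hα0 h1.le h2).hasGadget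
    linarith
  have hfloor : ∀ W : ℚ, W ≤ 1 → ∃ k : ℕ, 1 ≤ k ∧ 1 < W + k * ε ∧ W + k * ε - ε ≤ 1 := by
    intro W hW
    have h0 : 0 ≤ (1 - W) / ε := div_nonneg (by linarith) hε0.le
    refine ⟨⌊(1 - W) / ε⌋₊ + 1, by omega, ?_, ?_⟩
    · have := Nat.lt_floor_add_one ((1 - W) / ε)
      rw [div_lt_iff₀ hε0] at this
      push_cast
      linarith
    · have := Nat.floor_le h0
      rw [le_div_iff₀ hε0] at this
      push_cast
      linarith
  have hstars : ∀ {t : ℕ} (k : ℕ), 2 ≤ t → HasGadget V α ρ ε t →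
      HasStar V α ρ ε (0 + k * ε) (0 + k * (t - 1)) := fun k ht h =>
    hasStar_zero.cons_iterate hρ hε0.le le_rfl (by omega) h k
  obtain ⟨k, hk1, hk2, hk3⟩ := hfloor 0 zero_le_one
  have hk4 : 3 ≤ k := by
    -- `ε < 1`, and `k ε = 1 + ε`
    have hk5 : 2 ≤ k := by
      by_contra hcon
      have : k = 1 := by omega
      rw [this] at hk2
      push_cast at hk2
      linarith
    have h1 := hstar (hstars k hs hgs) hk2 hk3 (by
      have : 2 * 1 ≤ k * (s - 1) := Nat.mul_le_mul hk5 (by omega)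
      omega)
    by_contra hcon
    have : k = 2 := by omega
    rw [this] at h1
    push_cast at h1
    linarith
  have hgrow : ∀ {t : ℕ}, 2 ≤ t → HasGadget V α ρ ε t →
      ∃ t' > t, HasProperGadget V α ρ ε t' := by
    intro t ht h
    have h1 : 3 * (t - 1) ≤ k * (t - 1) := Nat.mul_le_mul_right _ hk4
    have h2 := hstar (hstars k ht h) hk2 hk3 (by omega)
    refine ⟨0 + k * (t - 1), by omega, ?_⟩
    have h3 := (hstars k ht h).hasProperGadget hα0 hk2.le hk3
    rwa [h2, add_sub_cancel_left] at h3
  refine ⟨ε, hε0, ⟨k - 1, ?_⟩, fun E => ?_, fun n => ?_⟩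
  · have h1 := hstar (hstars k hs hgs) hk2 hk3 (by
      have : 3 * 1 ≤ k * (s - 1) := Nat.mul_le_mul hk4 (by omega)
      omega)
    rw [Nat.cast_sub hk1]
    push_cast
    linarith
  · obtain ⟨j, hj1, hj2, hj3⟩ := hfloor (α E) (hα E).2.le
    have h1 : HasStar V α ρ ε (0 + α E) (0 + (ρ E - 1)) :=
      hasStar_zero.cons hρ hε0.le (hεα E) (by have := hρ E; omega) (hasGadget_edge E)
    have h2 := h1.cons_iterate hρ hε0.le le_rfl (by omega : 1 ≤ s) hgs j
    rw [zero_add] at h2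
    have h3 := hstar h2 hj2 hj3 (by
      have h4 : 1 * 1 ≤ j * (s - 1) := Nat.mul_le_mul hj1 (by omega)
      have h5 := hρ E
      omega)
    -- `α E + j ε = 1 + ε = k ε`
    have h6 := hstar (hstars k hs hgs) hk2 hk3 (by
      have : 3 * 1 ≤ k * (s - 1) := Nat.mul_le_mul hk4 (by omega)
      omega)
    have hjk : j ≤ k := by
      have : (j : ℚ) * ε ≤ k * ε := by have := hα0 E; linarith
      exact_mod_cast le_of_mul_le_mul_right this hε0
    refine ⟨k - j, ?_⟩
    rw [Nat.cast_sub hjk]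
    linarith
  · induction n with
    | zero =>
      obtain ⟨t, -, h⟩ := hgrow hs hgs
      exact ⟨t, by omega, h⟩
    | succ n ih =>
      obtain ⟨t, ht, h⟩ := ih
      by_cases ht2 : 2 ≤ t
      · obtain ⟨t', ht', h'⟩ := hgrow ht2 h.hasGadget
        exact ⟨t', by omega, h'⟩
      · obtain ⟨t', ht', h'⟩ := hgrow hs hgs
        exact ⟨t', by omega, h'⟩

/-- The rank of a finite hypergraph `P` can be lowered by any multiple `r` of `ε`, by an extension
`D` that has no effect on the rank of sets not containing `P`. -/
theorem exists_rank_drop [Infinite V] {α : ι → ℚ} {ρ : ι → ℕ} {ε : ℚ} (hε : 0 < ε)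
    (h1 : ∃ k : ℕ, 1 = k * ε) (hgad : ∀ n : ℕ, ∃ s ≥ n, HasProperGadget V α ρ ε s)
    {R : ι → Finset V → Prop} {P : Finset V} (hR : ∀ E s, R E s → s ⊆ P)
    (hRc : ∀ E s, R E s → s.card = ρ E) {r : ℚ} (hr : ∃ k : ℕ, r = k * ε) :
    ∃ (D : Finset V) (R' : ι → Finset V → Prop), P ⊆ D ∧ (∀ E s, R' E s → s.card = ρ E) ∧
      (∀ E s, s ⊆ P → (R' E s ↔ R E s)) ∧ rk α R' D = rk α R P - r ∧
      (∀ X ⊆ D, ¬ P ⊆ X → rk α R (X ∩ P) ≤ rk α R' X) ∧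
      (∀ X ⊆ D, P ⊆ X → rk α R P - r ≤ rk α R' X) := by
  obtain ⟨s, hs, hg⟩ := hgad P.card
  obtain ⟨k, hk⟩ := h1
  obtain ⟨j, hj⟩ := hr
  -- pad `P` with isolated points to a set `Q` of a size for which there are gadgets
  obtain ⟨Q, hPQ, hQ⟩ := Infinite.exists_superset_card_eq P s hs
  obtain ⟨D, G, hG, -, hp⟩ := hg.nat_mul (j + (s - P.card) * k) Q ∅ hQ
  have hQc : (Q.card : ℚ) = P.card + ((s - P.card : ℕ) : ℚ) := by
    rw [hQ, Nat.cast_sub hs]; ring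
  have hw : ((j + (s - P.card) * k : ℕ) : ℚ) * ε = r + (Q.card - P.card) := by
    rw [hQc, hj]
    push_cast
    rw [add_mul, mul_assoc, ← hk]
    ring
  rw [hw] at hG
  have hRQ : ∀ X : Finset V, rk α R X = rk α R (X ∩ P) + X.card - (X ∩ P).card := rk_inter α hR
  have hglue : ∀ X ⊆ D, rk α (fun E s => R E s ∨ G E s) X =
      rk α R (X ∩ P) - (X ∩ P).card + rk α G X := by
    intro X hX
    have h2 : Q ∪ D = D := Finset.union_eq_right.2 hG.subset
    have h3 := rk_glue α (fun E s h => (hR E s h).trans hPQ) hG.edge_subset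
      (fun E t h h' => hp E t ((hR E t h).trans hPQ) h') (h2.symm ▸ hX)
    rw [h3, hRQ (X ∩ Q), Finset.inter_assoc, Finset.inter_eq_right.2 hPQ,
      Finset.inter_eq_left.2 hX, Finset.inter_eq_left.2 hG.subset]
    ring
  refine ⟨D, fun E s => R E s ∨ G E s, hPQ.trans hG.subset, ?_, ?_, ?_, ?_, ?_⟩
  · rintro E t (h | h)
    exacts [hRc E t h, hG.edge_card E t h]
  · intro E t ht
    exact or_iff_left (hp E t (ht.trans hPQ))
  · rw [hglue _ le_rfl, hG.rk_eq, Finset.inter_eq_right.2 (hPQ.trans hG.subset)]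
    ring
  · intro X hX hPX
    have h2 := hG.le_of_not_subset X hX fun h => hPX (hPQ.trans h)
    have h3 : ((X ∩ P).card : ℚ) ≤ (X ∩ Q).card := by
      exact_mod_cast Finset.card_le_card (Finset.inter_subset_inter le_rfl hPQ)
    rw [hglue X hX]
    linarith
  · intro X hX hPX
    rw [hglue X hX, Finset.inter_eq_right.2 hPX]
    by_cases hQX : Q ⊆ X
    · have := hG.le_of_subset X hX hQX
      linarith
    · have h2 := hG.le_of_not_subset X hX hQX
      have h3 : (P.card : ℚ) ≤ (X ∩ Q).card := by
        exact_mod_cast Finset.card_le_card (Finset.subset_inter hPX hPQ)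
      have h4 : 0 ≤ r := by rw [hj]; positivity
      linarith

end

/-! ### Structures as hypergraphs -/

section

variable {L : FirstOrder.Language.{u, v}}

/-- The hypergraph of a structure: `s` is an edge of sort `E` if `E` holds of some enumeration
of `s`. -/
def Edge (L : FirstOrder.Language.{u, v}) (M : Type*) [L.Structure M] (E : Σ n, L.Relations n)
    (s : Finset M) : Prop :=
  ∃ x : Fin E.1 → M, Structure.RelMap E.2 x ∧ Set.range x = (s : Set M)

section structure_edges

variable {M : Type*} {N : Type*} [L.Structure M] [L.Structure N]

theorem delta_eq_rk [Fintype (Σ n, L.Relations n)] (α : (Σ n, L.Relations n) → ℚ)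
    (A : Finset M) : delta α A = rk α (Edge L M) A := by
  have : ∀ E, numEdges (L := L) E A = (A.powerset.filter (Edge L M E)).card := by
    intro E
    rw [← Set.ncard_coe_finset, numEdges]
    congr 1
    ext s
    simp [Edge]
  simp only [delta, rk, this]

theorem edge_card (hM : SymmIrrefl L M) {E : Σ n, L.Relations n} {s : Finset M}
    (h : Edge L M E s) : s.card = E.1 := by
  obtain ⟨x, hx, hxs⟩ := h
  have : s = Finset.univ.image x := by
    apply Finset.coe_injective
    rw [← hxs]; simp
  rw [this, Finset.card_image_of_injective _ (hM _ _ _ hx).1, Finset.card_univ, Fintype.card_fin]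

theorem relMap_iff (hM : SymmIrrefl L M) {n : ℕ} (R : L.Relations n) (x : Fin n → M) :
    Structure.RelMap R x ↔
      Function.Injective x ∧ Edge L M ⟨n, R⟩ (Finset.univ.image x) := by
  constructor
  · exact fun h => ⟨(hM _ _ _ h).1, x, h, by simp⟩
  · rintro ⟨hx, y, hy, hyx⟩
    obtain ⟨hyi, hyp⟩ := hM _ _ _ hy
    dsimp only at y hy hyx hyi hyp
    have hr : Set.range y = Set.range x := by rw [hyx]; simp
    have : ∀ i, ∃ j, y j = x i := fun i => by
      have : x i ∈ Set.range y := hr ▸ ⟨i, rfl⟩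
      exact this
    choose π hπ using this
    have hinj : Function.Injective π := fun i j hij => hx (by rw [← hπ, ← hπ, hij])
    have := hyp (Equiv.ofBijective π (Finite.injective_iff_bijective.1 hinj))
    have hxy : y ∘ π = x := funext hπ
    rw [← hxy]
    exact this

theorem IsoOn.relMap_iff (hM : SymmIrrefl L M) (hN : SymmIrrefl L N) {f : M → N}
    {A : Finset M} (h : IsoOn (Edge L M) (Edge L N) f A) {n : ℕ} (R : L.Relations n)
    {x : Fin n → M} (hx : ∀ i, x i ∈ A) :
    Structure.RelMap R (f ∘ x) ↔ Structure.RelMap R x := by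
  rw [BaldwinShi.relMap_iff hM, BaldwinShi.relMap_iff hN, ← Finset.image_image, ← h.2]
  · refine and_congr_left fun _ => ⟨fun h' => h'.of_comp, fun h' i j hij => h' ?_⟩
    exact h.1 (hx i) (hx j) hij
  · intro y hy
    obtain ⟨i, -, rfl⟩ := Finset.mem_image.1 hy
    exact hx i

theorem isoOn_of_relMap_iff {f : M → N} {A : Finset M} (hf : Set.InjOn f A)
    (h : ∀ (n : ℕ) (R : L.Relations n) (x : Fin n → M), (∀ i, x i ∈ A) →
      (Structure.RelMap R (f ∘ x) ↔ Structure.RelMap R x)) :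
    IsoOn (Edge L M) (Edge L N) f A := by
  refine ⟨hf, fun E s hs => ⟨?_, ?_⟩⟩
  · rintro ⟨x, hx, hxs⟩
    refine ⟨f ∘ x, (h _ _ _ fun i => hs ?_).2 hx, ?_⟩
    · exact Finset.mem_coe.1 (hxs ▸ ⟨i, rfl⟩)
    · rw [Set.range_comp, hxs, Finset.coe_image]
  · rintro ⟨y, hy, hys⟩
    have : ∀ i, ∃ a ∈ s, f a = y i := fun i => by
      have h1 : y i ∈ Set.range y := ⟨i, rfl⟩
      rw [hys] at h1
      simpa using h1
    choose x hxs hxy using this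
    obtain rfl : f ∘ x = y := funext hxy
    refine ⟨x, (h _ _ _ fun i => hs (hxs i)).1 hy, ?_⟩
    apply (hf.image_eq_image_iff (by rintro _ ⟨i, rfl⟩; exact hs (hxs i))
      (by exact_mod_cast hs)).1
    rw [← Set.range_comp, hys, Finset.coe_image]

theorem isoOn_embedding (f : M ↪[L] N) (A : Finset M) : IsoOn (Edge L M) (Edge L N) f A :=
  isoOn_of_relMap_iff f.injective.injOn fun _ R x _ => f.map_rel R x

theorem strong_iff [Fintype (Σ n, L.Relations n)] {α : (Σ n, L.Relations n) → ℚ}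
    {A : Finset M} : Strong α A ↔ ∀ B, A ⊆ B → delta α A ≤ delta α B :=
  ⟨fun h B hB => (h B hB).2 B hB le_rfl, fun h _ hB => ⟨hB, fun A' hA' _ => h A' hA'⟩⟩

theorem delta_empty [Fintype (Σ n, L.Relations n)] (arity : ∀ n, L.Relations n → 2 ≤ n)
    (hM : SymmIrrefl L M) (α : (Σ n, L.Relations n) → ℚ) : delta α (∅ : Finset M) = 0 := by
  rw [delta_eq_rk, rk_empty]
  intro E s h
  have := edge_card hM h
  have := arity _ E.2
  exact Finset.card_pos.1 (by omega)

theorem strong_empty [Fintype (Σ n, L.Relations n)] {α : (Σ n, L.Relations n) → ℚ}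
    (arity : ∀ n, L.Relations n → 2 ≤ n) (hM : InK α M) : Strong α (∅ : Finset M) :=
  strong_iff.2 fun B _ => by
    rw [delta_empty arity hM.1]
    exact hM.2 B

/-- Every finite subset of a structure in `K_α` is contained in a finite strong one, since the
ranks are nonnegative multiples of a common unit. -/
theorem exists_strong_superset [Fintype (Σ n, L.Relations n)] {α : (Σ n, L.Relations n) → ℚ}
    (hM : InK α M) (A : Finset M) : ∃ B, A ⊆ B ∧ Strong α B := by
  obtain ⟨η, hη, h1, h2⟩ := exists_unit α
  have hnat : ∀ B : Finset M, ∃ k : ℕ, delta α B = k * η := fun B =>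
    exists_nat_mul_of_int_mul hη (hM.2 B) (delta_eq_rk α B ▸ exists_rk_eq h1 h2 (Edge L M) B)
  have hex : ∃ k : ℕ, ∃ B, A ⊆ B ∧ delta α B = k * η :=
    let ⟨k, hk⟩ := hnat A
    ⟨k, A, le_rfl, hk⟩
  obtain ⟨B, hAB, hB⟩ := Nat.find_spec hex
  refine ⟨B, hAB, strong_iff.2 fun C hC => ?_⟩
  obtain ⟨k, hk⟩ := hnat C
  rw [hB, hk]
  exact mul_le_mul_of_nonneg_right
    (by exact_mod_cast Nat.find_min' hex ⟨C, hAB.trans hC, hk⟩) hη.le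

end structure_edges

variable [L.IsRelational]

/-- The structure on `I` induced by a hypergraph on `V` along a map `φ : I → V`. Injectivity of
the related tuples is required, as the hypergraph does not see repetitions. -/
@[reducible] def inducedStructure {I V : Type*} (R : (Σ n, L.Relations n) → Finset V → Prop)
    (φ : I → V) : L.Structure I where
  funMap f := isEmptyElim f
  RelMap {n} r x := Function.Injective x ∧ R ⟨n, r⟩ (Finset.univ.image (φ ∘ x))

theorem symmIrrefl_inducedStructure {I V : Type*} (R : (Σ n, L.Relations n) → Finset V → Prop)
    (φ : I → V) : @SymmIrrefl L I (inducedStructure R φ) := by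
  let _ := inducedStructure R φ
  rintro n r x ⟨h1, h2⟩
  refine ⟨h1, fun π => ⟨h1.comp π.injective, ?_⟩⟩
  have : Finset.univ.image (φ ∘ x ∘ π) = Finset.univ.image (φ ∘ x) := by
    ext v
    simp only [Finset.mem_image, Finset.mem_univ, true_and, Function.comp]
    exact ⟨fun ⟨i, hi⟩ => ⟨π i, hi⟩, fun ⟨i, hi⟩ => ⟨π.symm i, by simpa using hi⟩⟩
  rw [this]
  exact h2

theorem isoOn_inducedStructure {I V : Type*} {R : (Σ n, L.Relations n) → Finset V → Prop}
    (hR : ∀ E s, R E s → s.card = E.1) {φ : I → V} (hφ : Function.Injective φ) (A : Finset I) :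
    IsoOn (@Edge L I (inducedStructure R φ)) R φ A := by
  let _ := inducedStructure R φ
  refine ⟨hφ.injOn, fun E s _ => ⟨?_, fun h => ?_⟩⟩
  · rintro ⟨x, ⟨-, hx⟩, hxs⟩
    have : s.image φ = Finset.univ.image (φ ∘ x) := by
      apply Finset.coe_injective
      rw [Finset.coe_image, ← hxs, ← Set.range_comp]
      simp [Function.comp_def]
    rw [this]
    exact hx
  · have hc := hR E _ h
    rw [Finset.card_image_of_injective _ hφ] at hc
    let e := (s.equivFin.trans (finCongr hc)).symm
    refine ⟨fun i => e i, ⟨Subtype.val_injective.comp e.injective, ?_⟩, ?_⟩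
    · have : Finset.univ.image (φ ∘ fun i => (e i : I)) = s.image φ := by
        ext v
        simp only [Finset.mem_image, Finset.mem_univ, true_and, Function.comp]
        refine ⟨fun ⟨i, hi⟩ => ⟨e i, (e i).2, hi⟩, fun ⟨a, ha, hav⟩ => ⟨e.symm ⟨a, ha⟩, ?_⟩⟩
        simpa using hav
      rw [this]
      exact h
    · ext a
      simp only [Set.mem_range, Finset.mem_coe]
      exact ⟨fun ⟨i, hi⟩ => hi ▸ (e i).2, fun ha => ⟨e.symm ⟨a, ha⟩, by simp⟩⟩

variable [Fintype (Σ n, L.Relations n)] {α : (Σ n, L.Relations n) → ℚ}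

theorem inK_inducedStructure {I V : Type*} {R : (Σ n, L.Relations n) → Finset V → Prop}
    (hR : ∀ E s, R E s → s.card = E.1) {φ : I → V} (hφ : Function.Injective φ)
    (hpos : ∀ A : Finset I, 0 ≤ rk α R (A.image φ)) : @InK L _ α I (inducedStructure R φ) := by
  let _ := inducedStructure R φ
  refine ⟨symmIrrefl_inducedStructure R φ, fun A => ?_⟩
  rw [delta_eq_rk, ← (isoOn_inducedStructure hR hφ A).rk_image α]
  exact hpos A

/-! ### The extension property in models of `S_α` -/

section model

variable {N : Type*} [L.Structure N]

theorem nonempty_of_model (arity : ∀ n, L.Relations n → 2 ≤ n) (hN : N ⊨ theoryS α) :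
    Nonempty N := by
  obtain ⟨-, h⟩ := (model_theoryS_iff α N).1 hN
  have hR : ∀ (E : Σ n, L.Relations n) (s : Finset (Fin 1)), False → s.card = E.1 :=
    fun _ _ => False.elim
  have hrk : ∀ A : Finset (Fin 1), rk α (fun _ _ => False) A = A.card := fun A =>
    rk_eq_card α fun _ _ _ => not_false
  let s1 := inducedStructure (L := L) (fun _ _ => False) (id : Fin 1 → Fin 1)
  let s0 := inducedStructure (L := L) (fun _ _ => False) (Fin.elim0 : Fin 0 → Fin 1)
  have hiso := fun A => isoOn_inducedStructure (L := L) hR Function.injective_id A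
  have harity : ∀ {n} (_ : L.Relations n) (_ : Fin n → Fin 0), False := fun r x =>
    (x ⟨0, by have := arity _ r; omega⟩).elim0
  let e : Fin 0 ↪[L] Fin 1 := ⟨⟨Fin.elim0, fun i => i.elim0⟩, fun f => isEmptyElim f,
    fun r x => (harity r x).elim⟩
  obtain ⟨g, -⟩ := h 0 1 s0 s1 e
    (inK_inducedStructure hR Function.injective_id fun A => by rw [hrk]; positivity)
    ⟨Finset.subset_univ _, fun A hA _ => by
      rw [delta_eq_rk, delta_eq_rk, ← (hiso _).rk_image α, ← (hiso _).rk_image α, hrk, hrk]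
      simp⟩
    ⟨⟨Fin.elim0, fun i => i.elim0⟩, fun f => isEmptyElim f, fun r x => (harity r x).elim⟩
  exact ⟨g 0⟩

/-- The extension property of the models of `S_α`, for hypergraphs on arbitrary types and maps that
are partial isomorphisms. -/
theorem exists_extension (hN : N ⊨ theoryS α) {V : Type*}
    {R : (Σ n, L.Relations n) → Finset V → Prop} (hR : ∀ E s, R E s → s.card = E.1)
    {X Y : Finset V} (hXY : X ⊆ Y) (hpos : ∀ Z ⊆ Y, 0 ≤ rk α R Z)
    (hstr : ∀ Z, X ⊆ Z → Z ⊆ Y → rk α R X ≤ rk α R Z) {f : V → N}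
    (hf : IsoOn R (Edge L N) f X) :
    ∃ g : V → N, IsoOn R (Edge L N) g Y ∧ ∀ x ∈ X, g x = f x := by
  obtain ⟨hK, h⟩ := (model_theoryS_iff α N).1 hN
  let φ : Fin Y.card → V := fun i => Y.equivFin.symm i
  let ψ : Fin X.card → V := fun i => X.equivFin.symm i
  have hφ : Function.Injective φ := Subtype.val_injective.comp Y.equivFin.symm.injective
  have hψ : Function.Injective ψ := Subtype.val_injective.comp X.equivFin.symm.injective
  have hφY : Finset.univ.image φ = Y := by
    ext v
    simp only [Finset.mem_image, Finset.mem_univ, true_and]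
    exact ⟨fun ⟨i, hi⟩ => hi ▸ (Y.equivFin.symm i).2, fun hv => ⟨Y.equivFin ⟨v, hv⟩, by simp [φ]⟩⟩
  have hψX : Finset.univ.image ψ = X := by
    ext v
    simp only [Finset.mem_image, Finset.mem_univ, true_and]
    exact ⟨fun ⟨i, hi⟩ => hi ▸ (X.equivFin.symm i).2, fun hv => ⟨X.equivFin ⟨v, hv⟩, by simp [ψ]⟩⟩
  have hψm : ∀ i, ψ i ∈ X := fun i => (X.equivFin.symm i).2
  let sY := inducedStructure (L := L) R φ
  let sX := inducedStructure (L := L) R ψ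
  have hisoY := fun A => isoOn_inducedStructure (L := L) hR hφ A
  have hisoX := fun A => isoOn_inducedStructure (L := L) hR hψ A
  have hlift : ∀ i, ∃ j, φ j = ψ i := fun i =>
    ⟨Y.equivFin ⟨ψ i, hXY (hψm i)⟩, by simp [φ]⟩
  choose e₀ he₀ using hlift
  have he₀' : φ ∘ e₀ = ψ := funext he₀
  have he₀i : Function.Injective e₀ := fun i j hij => hψ (by rw [← he₀, ← he₀, hij])
  let e : Fin X.card ↪[L] Fin Y.card := ⟨⟨e₀, he₀i⟩, fun f => isEmptyElim f, fun {n} r x => by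
    change (Function.Injective (e₀ ∘ x) ∧ R ⟨n, r⟩ (Finset.univ.image (φ ∘ e₀ ∘ x))) ↔
      Function.Injective x ∧ R ⟨n, r⟩ (Finset.univ.image (ψ ∘ x))
    rw [← Function.comp_assoc, he₀', he₀i.of_comp_iff]⟩
  let f' : Fin X.card ↪[L] N := ⟨⟨f ∘ ψ, fun i j hij => hψ (hf.1 (hψm i) (hψm j) hij)⟩,
    fun f => isEmptyElim f, fun {n} r x => by
      have h1 : IsoOn (Edge L (Fin X.card)) (Edge L N) (f ∘ ψ) Finset.univ :=
        IsoOn.comp (hψX.symm ▸ hf) (hisoX _)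
      exact h1.relMap_iff (symmIrrefl_inducedStructure R ψ) hK.1 r fun _ => Finset.mem_univ _⟩
  have hsub : ∀ A : Finset (Fin Y.card), A.image φ ⊆ Y := fun A v hv => by
    obtain ⟨i, -, rfl⟩ := Finset.mem_image.1 hv
    exact (Y.equivFin.symm i).2
  have heX : (Finset.univ.map e.toEmbedding).image φ = X := by
    refine Eq.trans ?_ hψX
    ext v
    simp only [Finset.mem_image, Finset.mem_map, Finset.mem_univ, true_and, exists_exists_eq_and]
    exact exists_congr fun i => by rw [← he₀]; rfl
  obtain ⟨g', hg'⟩ := h _ _ sX sY e (inK_inducedStructure hR hφ fun A => hpos _ (hsub A))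
    ⟨Finset.subset_univ _, fun A hA _ => by
      rw [delta_eq_rk, delta_eq_rk, ← (hisoY _).rk_image α, ← (hisoY A).rk_image α, heX]
      exact hstr _ (heX ▸ Finset.image_subset_image hA) (hsub A)⟩ f'
  refine ⟨Function.extend φ g' f, ?_, fun x hx => ?_⟩
  · have h1 : IsoOn (Edge L (Fin Y.card)) (Edge L N) (Function.extend φ g' f ∘ φ) Finset.univ := by
      rw [Function.extend_comp hφ]
      exact isoOn_embedding g' _
    have := (hisoY Finset.univ).of_comp h1
    rwa [hφY] at this
  · rw [← hψX, Finset.mem_image] at hx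
    obtain ⟨i, -, rfl⟩ := hx
    have : ψ i = φ (e i) := (he₀ i).symm
    rw [this, hφ.extend_apply, hg', ← this]
    rfl

/-- Sets without edges are in `K_α`, and the empty set is strong in them, so all of them embed. -/
theorem infinite_of_model (arity : ∀ n, L.Relations n → 2 ≤ n) (hN : N ⊨ theoryS α) :
    Infinite N := by
  obtain ⟨x⟩ := nonempty_of_model arity hN
  have h : ∀ X : Finset ℕ, rk α (fun _ _ => False) X = X.card := fun X =>
    rk_eq_card α fun _ _ _ => not_false
  have h0 : ∀ (E : Σ n, L.Relations n), ¬ Edge L N E ∅ := fun E hE => by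
    have := edge_card ((model_theoryS_iff α N).1 hN).1.1 hE
    have := arity _ E.2
    simp at *
    omega
  by_contra hfin
  rw [not_infinite_iff_finite] at hfin
  have := Fintype.ofFinite N
  obtain ⟨g, hg, -⟩ := exists_extension hN (R := fun _ _ => False) (X := ∅)
    (Y := Finset.range (Fintype.card N + 1)) (by simp) (Finset.empty_subset _)
    (fun Z _ => by rw [h]; positivity) (fun Z _ _ => by rw [h, h]; simp)
    (f := fun _ => x) ⟨by simp, fun E s hs => by
      rw [Finset.subset_empty.1 hs, Finset.image_empty]
      simp [h0]⟩
  have h1 := Finset.card_image_of_injOn hg.1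
  have h2 := Finset.card_le_univ ((Finset.range (Fintype.card N + 1)).image g)
  rw [h1, Finset.card_range] at h2
  omega

end model

end

/-! ### Amalgamation and strong extensions inside models -/

section

variable {L : FirstOrder.Language.{u, v}} [L.IsRelational] [Fintype (Σ n, L.Relations n)]
  {α : (Σ n, L.Relations n) → ℚ} {N : Type w} [L.Structure N]

/-- Inside a model of `S_α`, amalgamate `B` with a finite set `C` over `A ≤ B` and lower the rank
of the amalgam back to that of `C`. The outcome `D` lies over `C` in the model, and `B` is strong
in `D` if `A` is strong and the rank of `C` is at least that of `B`. -/
theorem exists_amalgam_drop [Nonempty (Σ n, L.Relations n)]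
    (arity : ∀ n, L.Relations n → 2 ≤ n) (hα : ∀ E, 0 < α E ∧ α E < 1) (hN : N ⊨ theoryS α)
    {W : Type w'} {S : (Σ n, L.Relations n) → Finset W → Prop} (hS : ∀ E s, S E s → s.card = E.1)
    {A B : Finset W} (hAB : A ⊆ B) (hstr : ∀ Z, A ⊆ Z → Z ⊆ B → rk α S A ≤ rk α S Z) {f : W → N}
    (hf : IsoOn S (Edge L N) f A) {C : Finset N} (hC : A.image f ⊆ C) :
    ∃ (g : W → N) (D : Finset N), IsoOn S (Edge L N) g B ∧ (∀ a ∈ A, g a = f a) ∧ C ⊆ D ∧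
      B.image g ⊆ D ∧ delta α D = delta α C ∧
      (Strong α (A.image f) → rk α S B ≤ delta α C →
        ∀ X ⊆ D, B.image g ⊆ X → rk α S B ≤ delta α X) := by
  have hK : InK α N := ((model_theoryS_iff α N).1 hN).1
  have hα0 : ∀ E, 0 ≤ α E := fun E => (hα E).1.le
  have := nonempty_of_model arity hN
  obtain ⟨V, hV, i, j, hi, hj, hij⟩ : ∃ (V : Type (max w w')) (_ : Infinite V) (i : N → V)
      (j : W → V), Function.Injective i ∧ Function.Injective j ∧ ∀ x y, i x ≠ j y :=
    ⟨N ⊕ (W ⊕ ℕ), inferInstance, Sum.inl, Sum.inr ∘ Sum.inl, Sum.inl_injective,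
      Sum.inr_injective.comp Sum.inl_injective, fun _ _ => Sum.inl_ne_inr⟩
  obtain ⟨ε, hε, h1, hαε, hgad⟩ := exists_gadget_unit (V := V) hα
    (ρ := fun E => E.1) fun E => arity _ E.2
  let b : W → V := fun w => if w ∈ A then i (f w) else j w
  set U := C.image i with hU
  obtain ⟨R₀, hR₀⟩ : ∃ R₀ : (Σ n, L.Relations n) → Finset (V) → Prop,
      ∀ E s, R₀ E s ↔ ∃ t ⊆ C, Edge L N E t ∧ t.image i = s := ⟨_, fun _ _ => Iff.rfl⟩
  have hR₀U : ∀ E s, R₀ E s → s ⊆ U := fun E s h => by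
    obtain ⟨t, ht, -, rfl⟩ := (hR₀ E s).1 h
    exact Finset.image_subset_image ht
  have hiso₀ : IsoOn (Edge L N) R₀ i C := by
    refine ⟨hi.injOn, fun E s hs => ?_⟩
    rw [hR₀]
    refine ⟨fun h => ⟨s, hs, h, rfl⟩, ?_⟩
    rintro ⟨t, -, ht, hts⟩
    rwa [← Finset.image_injective hi hts]
  have hbA : ∀ a ∈ A, b a = i (f a) := fun a ha => if_pos ha
  have hbn : ∀ a ∉ A, b a = j a := fun a ha => if_neg ha
  have hb : Set.InjOn b B := by
    intro x _ y _ hxy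
    by_cases hxA : x ∈ A <;> by_cases hyA : y ∈ A
    · rw [hbA x hxA, hbA y hyA] at hxy
      exact hf.1 hxA hyA (hi hxy)
    · rw [hbA x hxA, hbn y hyA] at hxy
      exact absurd hxy (hij _ _)
    · rw [hbn x hxA, hbA y hyA] at hxy
      exact absurd hxy.symm (hij _ _)
    · rw [hbn x hxA, hbn y hyA] at hxy
      exact hj hxy
  have hbU : ∀ y ∈ B, b y ∈ U ↔ y ∈ A := by
    intro y _
    by_cases hyA : y ∈ A
    · rw [hbA y hyA]
      simp only [hyA, iff_true]
      exact Finset.mem_image_of_mem i (hC (Finset.mem_image_of_mem f hyA))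
    · rw [hbn y hyA]
      simp [hyA, hU, hij]
  have hiso₁ : IsoOn S R₀ b A :=
    (IsoOn.comp (hiso₀.mono hC) hf).congr hbA
  set R₁ := amalgam R₀ S b B with hR₁
  set P := U ∪ B.image b with hP
  have hUP : U ⊆ P := Finset.subset_union_left
  have hBP : B.image b ⊆ P := Finset.subset_union_right
  have hR₁P : ∀ E s, R₁ E s → s ⊆ P := by
    rintro E s (h | ⟨t, ht, -, rfl⟩)
    exacts [(hR₀U E s h).trans hUP, (Finset.image_subset_image ht).trans hBP]
  have hR₁c : ∀ E s, R₁ E s → s.card = E.1 := by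
    rintro E s (h | ⟨t, ht, hE, rfl⟩)
    · obtain ⟨t, -, ht, rfl⟩ := (hR₀ E s).1 h
      rw [Finset.card_image_of_injective _ hi, edge_card hK.1 ht]
    · rw [Finset.card_image_of_injOn (hb.mono (by exact_mod_cast ht)), hS E t hE]
  have hrk : ∀ Z ⊆ P, rk α R₁ Z = rk α R₀ (Z ∩ U) + rk α S (B.filter (b · ∈ Z)) -
      rk α S (A.filter (b · ∈ Z)) := fun Z hZ => rk_amalgam α hb hAB hR₀U hbU hiso₁ hZ
  have hrkU : ∀ Z ⊆ P, rk α R₀ (Z ∩ U) ≤ rk α R₁ Z := by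
    intro Z hZ
    have h2 := rk_inter_le hα0 hstr hAB (Z := B.filter (b · ∈ Z)) (Finset.filter_subset _ _)
    have h3 : B.filter (b · ∈ Z) ∩ A = A.filter (b · ∈ Z) := by
      ext y
      simp only [Finset.mem_inter, Finset.mem_filter]
      exact ⟨fun h => ⟨h.2, h.1.2⟩, fun h => ⟨⟨hAB h.1, h.2⟩, h.1⟩⟩
    rw [h3] at h2
    rw [hrk Z hZ]
    linarith
  have hrk₀ : ∀ t ⊆ C, rk α R₀ (t.image i) = delta α t := fun t ht => by
    rw [delta_eq_rk, (hiso₀.mono ht).rk_image α]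
  have hpos₀ : ∀ Z : Finset V, 0 ≤ rk α R₀ (Z ∩ U) := by
    intro Z
    obtain ⟨t, ht, hts⟩ := Finset.subset_image_iff.1 (Finset.inter_subset_right : Z ∩ U ⊆ U)
    rw [← hts, hrk₀ t (by exact_mod_cast ht)]
    exact hK.2 t
  obtain ⟨k, hk⟩ : ∃ k : ℕ, rk α S B - rk α S A = k * ε := by
    refine exists_nat_mul_of_int_mul hε (sub_nonneg.2 (hstr B hAB le_rfl)) ?_
    obtain ⟨x, hx⟩ := exists_rk_eq_int_mul h1 hαε S B
    obtain ⟨y, hy⟩ := exists_rk_eq_int_mul h1 hαε S A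
    exact ⟨x - y, by rw [hx, hy]; push_cast; ring⟩
  obtain ⟨D, R, hPD, hRc, hRP, hrD, hlow, hhigh⟩ :=
    exists_rank_drop hε h1 hgad hR₁P hR₁c ⟨k, hk⟩
  have hrP : rk α R₁ P - (rk α S B - rk α S A) = delta α C := by
    have h2 : B.filter (b · ∈ P) = B :=
      Finset.filter_true_of_mem fun y hy => hBP (Finset.mem_image_of_mem b hy)
    have h3 : A.filter (b · ∈ P) = A :=
      Finset.filter_true_of_mem fun y hy => hBP (Finset.mem_image_of_mem b (hAB hy))
    rw [hrk P le_rfl, h2, h3, Finset.inter_eq_right.2 hUP, hU, hrk₀ C le_rfl]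
    ring
  rw [hrP] at hrD hhigh
  have hlow' : ∀ X ⊆ D, ¬ P ⊆ X → rk α R₀ (X ∩ U) ≤ rk α R X := by
    intro X hX hPX
    have h2 := hrkU (X ∩ P) Finset.inter_subset_right
    rw [Finset.inter_assoc, Finset.inter_eq_right.2 hUP] at h2
    exact h2.trans (hlow X hX hPX)
  -- the hypergraph on `D` contains a copy of `C` as a strong part, so it embeds over `C`
  have hisoU : IsoOn R (Edge L N) (Function.invFun i) U := by
    have h2 : IsoOn (Edge L N) R i C := by
      refine ⟨hi.injOn, fun E s hs => ?_⟩
      have h3 : s.image i ⊆ U := Finset.image_subset_image hs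
      rw [hiso₀.2 E s hs, hRP E _ (h3.trans hUP)]
      exact (amalgam_left hbU hiso₁ h3).symm
    refine h2.of_comp ?_
    have h3 : Function.invFun i ∘ i = id := Function.invFun_comp hi
    rw [h3]
    exact ⟨Function.injective_id.injOn, fun E s _ => by rw [Finset.image_id]⟩
  obtain ⟨h, hh, hhU⟩ := exists_extension hN hRc (hUP.trans hPD)
    (fun Z hZ => by
      by_cases hPZ : P ⊆ Z
      · exact (hK.2 C).trans (hhigh Z hZ hPZ)
      · exact (hpos₀ Z).trans (hlow' Z hZ hPZ))
    (fun Z hUZ hZ => by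
      have h2 : rk α R U = delta α C := by
        rw [rk_congr α (fun E s hs => hRP E s (hs.trans hUP)),
          rk_congr α (fun E s hs => amalgam_left hbU hiso₁ hs), hU, hrk₀ C le_rfl]
      rw [h2]
      by_cases hPZ : P ⊆ Z
      · exact hhigh Z hZ hPZ
      · have h3 := hlow' Z hZ hPZ
        rwa [Finset.inter_eq_right.2 hUZ, hU, hrk₀ C le_rfl] at h3) hisoU
  have hhi : ∀ c ∈ C, h (i c) = c := fun c hc =>
    (hhU _ (Finset.mem_image_of_mem i hc)).trans (Function.leftInverse_invFun hi c)
  have hisoB : IsoOn S R b B := by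
    refine ⟨hb, fun E s hs => ?_⟩
    rw [(isoOn_amalgam hb hR₀U hbU hiso₁).2 E s hs,
      hRP E _ ((Finset.image_subset_image hs).trans hBP)]
  refine ⟨h ∘ b, D.image h, IsoOn.comp (hh.mono (hBP.trans hPD)) hisoB, ?_, ?_, ?_, ?_, ?_⟩
  · intro a ha
    rw [Function.comp, hbA a ha, hhi _ (hC (Finset.mem_image_of_mem f ha))]
  · intro c hc
    exact Finset.mem_image.2 ⟨i c, hPD (hUP (Finset.mem_image_of_mem i hc)), hhi c hc⟩
  · rw [← Finset.image_image]
    exact Finset.image_subset_image (hBP.trans hPD)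
  · rw [delta_eq_rk, hh.rk_image α, hrD]
  · intro hstrong hBC X hX hBX
    obtain ⟨Z, hZ, rfl⟩ := Finset.subset_image_iff.1 hX
    have hZ' : Z ⊆ D := by exact_mod_cast hZ
    rw [delta_eq_rk, (hh.mono hZ').rk_image α]
    rw [← Finset.image_image, image_subset_iff_of_injOn hh.1 (hBP.trans hPD) hZ'] at hBX
    by_cases hPZ : P ⊆ Z
    · exact hBC.trans (hhigh Z hZ' hPZ)
    · refine le_trans ?_ (hlow Z hZ' hPZ)
      have h2 : B.filter (b · ∈ Z ∩ P) = B :=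
        Finset.filter_true_of_mem fun y hy => Finset.mem_inter.2
          ⟨hBX (Finset.mem_image_of_mem b hy), hBP (Finset.mem_image_of_mem b hy)⟩
      have h3 : A.filter (b · ∈ Z ∩ P) = A :=
        Finset.filter_true_of_mem fun y hy => Finset.mem_inter.2
          ⟨hBX (Finset.mem_image_of_mem b (hAB hy)), hBP (Finset.mem_image_of_mem b (hAB hy))⟩
      rw [hrk _ Finset.inter_subset_right, h2, h3, Finset.inter_assoc,
        Finset.inter_eq_right.2 hUP]
      obtain ⟨t, ht, hts⟩ := Finset.subset_image_iff.1 (Finset.inter_subset_right : Z ∩ U ⊆ U)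
      rw [← hts, hrk₀ t (by exact_mod_cast ht)]
      have h4 : A.image f ⊆ t := by
        intro y hy
        obtain ⟨a, ha, rfl⟩ := Finset.mem_image.1 hy
        have h5 : i (f a) ∈ t.image i := by
          rw [hts, ← hbA a ha]
          exact Finset.mem_inter.2 ⟨hBX (Finset.mem_image_of_mem b (hAB ha)),
            (hbU a (hAB ha)).2 ha⟩
        obtain ⟨c, hc, hca⟩ := Finset.mem_image.1 h5
        rwa [← hi hca]
      have h6 := strong_iff.1 hstrong t h4
      rw [delta_eq_rk, hf.rk_image α] at h6
      linarith

/-- Richness: over a strong set, every strong extension whose rank is at most that of some strong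
set embeds strongly. -/
theorem exists_strong_extension
    (arity : ∀ n, L.Relations n → 2 ≤ n) (hα : ∀ E, 0 < α E ∧ α E < 1) (hN : N ⊨ theoryS α)
    {W : Type*} {S : (Σ n, L.Relations n) → Finset W → Prop} (hS : ∀ E s, S E s → s.card = E.1)
    {A B : Finset W} (hAB : A ⊆ B) (hpos : ∀ Z ⊆ B, 0 ≤ rk α S Z)
    (hstr : ∀ Z, A ⊆ Z → Z ⊆ B → rk α S A ≤ rk α S Z) {f : W → N}
    (hf : IsoOn S (Edge L N) f A) (hfA : Strong α (A.image f))
    (hdim : ∃ C : Finset N, Strong α C ∧ rk α S B ≤ delta α C) :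
    ∃ g : W → N, IsoOn S (Edge L N) g B ∧ (∀ a ∈ A, g a = f a) ∧ Strong α (B.image g) := by
  have hK : InK α N := ((model_theoryS_iff α N).1 hN).1
  cases isEmpty_or_nonempty (Σ n, L.Relations n) with
  | inl hempty =>
    obtain ⟨g, hg, hgf⟩ := exists_extension hN hS hAB hpos hstr hf
    refine ⟨g, hg, hgf, strong_iff.2 fun X hX => ?_⟩
    rw [delta_eq_rk, delta_eq_rk, rk_eq_card α fun E => isEmptyElim E,
      rk_eq_card α fun E => isEmptyElim E]
    exact_mod_cast Finset.card_le_card hX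
  | inr hne =>
    obtain ⟨C₀, hC₀, hBC₀⟩ := hdim
    obtain ⟨C, hC, hCs⟩ := exists_strong_superset hK (C₀ ∪ A.image f)
    obtain ⟨g, D, hg, hgf, hCD, hBD, hDC, hgB⟩ := exists_amalgam_drop arity hα hN hS hAB hstr hf
      (Finset.union_subset_right hC)
    refine ⟨g, hg, hgf, strong_iff.2 fun X hX => ?_⟩
    have hBC : rk α S B ≤ delta α C :=
      hBC₀.trans (strong_iff.1 hC₀ C (Finset.union_subset_left hC))
    -- `D` is strong, as it contains the strong set `C` and has the same rank
    have h1 : delta α D ≤ delta α (X ∪ D) := by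
      rw [hDC]
      exact strong_iff.1 hCs _ (hCD.trans Finset.subset_union_right)
    have h2 := rk_submodular (fun E => (hα E).1.le) (Edge L N) X D
    simp only [← delta_eq_rk] at h2
    have h3 := hgB hfA hBC (X ∩ D) Finset.inter_subset_right (Finset.subset_inter hX hBD)
    rw [delta_eq_rk, hg.rk_image α]
    linarith

/-- Every model of `S_α`, of finite dimension or not, contains `m` points that look independent to
sets of fewer than `m` elements. They form the base of a set of rank `0`; the loss of rank is
visible only to sets that contain all of them. -/
theorem exists_locally_free (arity : ∀ n, L.Relations n → 2 ≤ n) (hα : ∀ E, 0 < α E ∧ α E < 1)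
    (hN : N ⊨ theoryS α) (m : ℕ) :
    ∃ c : ℕ → N, Set.InjOn c (Finset.range m) ∧ ∀ B : Finset N, B.card < m →
      ((B ∩ (Finset.range m).image c).card : ℚ) ≤ delta α B := by
  have hK : InK α N := ((model_theoryS_iff α N).1 hN).1
  cases isEmpty_or_nonempty (Σ n, L.Relations n) with
  | inl hempty =>
    have := infinite_of_model arity hN
    refine ⟨Infinite.natEmbedding N, (Infinite.natEmbedding N).injective.injOn, fun B _ => ?_⟩
    rw [delta_eq_rk, rk_eq_card α fun E => isEmptyElim E]
    exact_mod_cast Finset.card_le_card Finset.inter_subset_left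
  | inr hne =>
    obtain ⟨n₀⟩ := nonempty_of_model arity hN
    obtain ⟨ε, hε, h1, hαε, hgad⟩ := exists_gadget_unit (V := ℕ) hα
      (ρ := fun E => E.1) fun E => arity _ E.2
    have hrk : ∀ X : Finset ℕ, rk α (fun _ _ => False) X = X.card := fun X =>
      rk_eq_card α fun _ _ _ => not_false
    obtain ⟨k, hk⟩ := h1
    obtain ⟨D, R, hPD, hRc, -, hrD, hlow, hhigh⟩ := exists_rank_drop hε ⟨k, hk⟩ hgad
      (R := fun _ _ => False) (P := Finset.range m) (by simp) (by simp) (r := m)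
      ⟨m * k, by push_cast; rw [mul_assoc, ← hk, mul_one]⟩
    simp only [hrk, Finset.card_range, sub_self] at hrD hlow hhigh
    have hpos : ∀ Z ⊆ D, 0 ≤ rk α R Z := fun Z hZ => by
      by_cases hPZ : Finset.range m ⊆ Z
      · exact hhigh Z hZ hPZ
      · exact le_trans (Nat.cast_nonneg _) (hlow Z hZ hPZ)
    have hne : ∀ E, ¬ R E ∅ := fun E hE => by
      have h2 := hRc E _ hE
      have h3 := arity _ E.2
      rw [Finset.card_empty] at h2
      omega
    have hneN : ∀ E, ¬ Edge L N E ∅ := fun E hE => by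
      have h2 := edge_card hK.1 hE
      have h3 := arity _ E.2
      rw [Finset.card_empty] at h2
      omega
    obtain ⟨h, hh, -⟩ := exists_extension hN hRc (Finset.empty_subset D) hpos
      (fun Z _ hZ => by
        rw [rk_empty]
        · exact hpos Z hZ
        · intro E s hs
          exact Finset.nonempty_iff_ne_empty.2 fun h => hne E (h ▸ hs)) (f := fun _ => n₀)
      ⟨by simp, fun E s hs => by
        rw [Finset.subset_empty.1 hs, Finset.image_empty]
        exact iff_of_false (hne E) (hneN E)⟩
    refine ⟨h, hh.1.mono (by exact_mod_cast hPD), fun B hB => ?_⟩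
    -- the image of `D` has rank `0`, so it is strong
    have h2 := rk_submodular (fun E => (hα E).1.le) (Edge L N) B (D.image h)
    rw [hh.rk_image α, hrD, add_zero, ← delta_eq_rk, ← delta_eq_rk, ← delta_eq_rk] at h2
    have h3 := hK.2 (B ∪ D.image h)
    obtain ⟨Z, hZ, hZB⟩ := Finset.subset_image_iff.1
      (Finset.inter_subset_right : B ∩ D.image h ⊆ D.image h)
    have hZ' : Z ⊆ D := by exact_mod_cast hZ
    have hZc : Z.card ≤ B.card := by
      rw [← Finset.card_image_of_injOn (hh.1.mono hZ), hZB]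
      exact Finset.card_le_card Finset.inter_subset_left
    have h4 : ((Z ∩ Finset.range m).card : ℚ) ≤ rk α R Z := by
      convert hlow Z hZ' fun hP => ?_
      have := Finset.card_le_card hP
      rw [Finset.card_range] at this
      omega
    have h5 : B ∩ (Finset.range m).image h ⊆ (Z ∩ Finset.range m).image h := by
      intro y hy
      rw [Finset.mem_inter] at hy
      obtain ⟨x, hx, rfl⟩ := Finset.mem_image.1 hy.2
      have h6 : h x ∈ Z.image h := by
        rw [hZB]
        exact Finset.mem_inter.2 ⟨hy.1, Finset.mem_image_of_mem h (hPD hx)⟩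
      obtain ⟨z, hz, hzx⟩ := Finset.mem_image.1 h6
      have : z = x := hh.1 (hZ' hz) (hPD hx) hzx
      exact Finset.mem_image_of_mem h (Finset.mem_inter.2 ⟨this ▸ hz, hx⟩)
    have h7 : ((B ∩ (Finset.range m).image h).card : ℚ) ≤ (Z ∩ Finset.range m).card := by
      exact_mod_cast (Finset.card_le_card h5).trans Finset.card_image_le
    have h8 : delta α (B ∩ D.image h) = rk α R Z := by
      rw [← hZB, delta_eq_rk, (hh.mono hZ').rk_image α]
    linarith

end

/-! ### Strong isomorphisms preserve formulas -/

section

variable {L : FirstOrder.Language.{u, v}} {M : Type w} {N : Type w'} [L.Structure M]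
  [L.Structure N]

variable (M) in
/-- The ultrapower of `M` by a nonprincipal ultrafilter on `ℕ`. -/
abbrev Ultrapower : Type w :=
  ((Filter.hyperfilter ℕ : Ultrafilter ℕ) : Filter ℕ).Product fun _ => M

/-- The class of a sequence in the ultrapower. -/
noncomputable def Ultrapower.mk (x : ℕ → M) : Ultrapower M := (x : Ultrapower M)

/-- The diagonal embedding into the ultrapower. -/
noncomputable def diag (a : M) : Ultrapower M := Ultrapower.mk fun _ => a

theorem Ultrapower.mk_eq_iff {x y : ℕ → M} :
    mk x = mk y ↔ ∀ᶠ m in (Filter.hyperfilter ℕ : Filter ℕ), x m = y m :=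
  Quotient.eq''

/-- A choice of representatives for the elements of the ultrapower. -/
noncomputable def Ultrapower.rep (z : Ultrapower M) : ℕ → M := Quotient.out z

@[simp] theorem Ultrapower.mk_rep (z : Ultrapower M) : mk z.rep = z := Quotient.out_eq' z

theorem Ultrapower.rep_mk (x : ℕ → M) :
    ∀ᶠ m in (Filter.hyperfilter ℕ : Filter ℕ), (mk x).rep m = x m :=
  mk_eq_iff.1 (mk_rep _)

theorem Ultrapower.relMap_mk {n : ℕ} (R : L.Relations n) (x : Fin n → ℕ → M) :
    Structure.RelMap R (fun i => mk (x i)) ↔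
      ∀ᶠ m in (Filter.hyperfilter ℕ : Filter ℕ), Structure.RelMap R fun i => x i m :=
  relMap_quotient_mk' _ _ _

theorem Ultrapower.model [Nonempty M] {T : L.Theory} (hM : M ⊨ T) : Ultrapower M ⊨ T := by
  rw [Theory.model_iff] at hM ⊢
  intro φ hφ
  rw [Ultraproduct.sentence_realize]
  exact Filter.Eventually.of_forall fun _ => hM φ hφ

theorem realize_diag_iff [Nonempty M] {β : Type*} (φ : L.Formula β) (x : β → M) :
    φ.Realize (fun b => diag (x b)) ↔ φ.Realize x :=
  (Ultraproduct.realize_formula_cast φ fun b _ => x b).trans Filter.eventually_const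

theorem isoOn_diag (A : Finset M) : IsoOn (Edge L M) (Edge L (Ultrapower M)) diag A := by
  refine isoOn_of_relMap_iff (fun a _ b _ h => ?_) fun n R x _ => ?_
  · exact Filter.eventually_const.1 (Ultrapower.mk_eq_iff.1 h)
  · exact (Ultrapower.relMap_mk R fun i _ => x i).trans Filter.eventually_const

variable [Fintype (Σ n, L.Relations n)] {α : (Σ n, L.Relations n) → ℚ}

/-- A finite set of pairs that is the graph of an isomorphism between finite strong
substructures of `M` and `N`. -/
def IsStrongIso (α : (Σ n, L.Relations n) → ℚ) (p : Finset (M × N)) : Prop :=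
  ∃ f : M → N, IsoOn (Edge L M) (Edge L N) f (p.image Prod.fst) ∧ (∀ z ∈ p, f z.1 = z.2) ∧
    Strong α (p.image Prod.fst) ∧ Strong α (p.image Prod.snd)

variable (M N) in
/-- The ranks of the finite strong sets in `M` are bounded by those in `N`. For models of `S_α`
this is equivalent to `dim M ≤ dim N`. -/
def DimLE (α : (Σ n, L.Relations n) → ℚ) : Prop :=
  ∀ B : Finset M, Strong α B → ∃ C : Finset N, Strong α C ∧ delta α B ≤ delta α C

theorem image_snd_eq {p : Finset (M × N)} {f : M → N} (hf : ∀ z ∈ p, f z.1 = z.2) :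
    p.image Prod.snd = (p.image Prod.fst).image f := by
  rw [Finset.image_image]
  exact Finset.image_congr fun z hz => (hf z hz).symm

theorem isStrongIso_graph {f : M → N} {A : Finset M} (hf : IsoOn (Edge L M) (Edge L N) f A)
    (hA : Strong α A) (hfA : Strong α (A.image f)) :
    IsStrongIso α (A.image fun a => (a, f a)) := by
  have h1 : (A.image fun a => (a, f a)).image Prod.fst = A := by
    rw [Finset.image_image]; exact Finset.image_id
  have h2 : (A.image fun a => (a, f a)).image Prod.snd = A.image f := by
    rw [Finset.image_image]; rfl
  refine ⟨f, by rwa [h1], fun z hz => ?_, by rwa [h1], by rwa [h2]⟩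
  obtain ⟨a, -, rfl⟩ := Finset.mem_image.1 hz
  rfl

theorem IsStrongIso.swap [Nonempty M] {p : Finset (M × N)} (hp : IsStrongIso α p) :
    IsStrongIso α (p.image Prod.swap) := by
  obtain ⟨f, hf, hfp, h1, h2⟩ := hp
  obtain ⟨g, hgf, hg⟩ := hf.exists_inverse
  have h3 : (p.image Prod.swap).image Prod.fst = p.image Prod.snd := by
    rw [Finset.image_image]; rfl
  have h4 : (p.image Prod.swap).image Prod.snd = p.image Prod.fst := by
    rw [Finset.image_image]; rfl
  refine ⟨g, ?_, fun z hz => ?_, by rwa [h3], by rwa [h4]⟩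
  · rwa [h3, image_snd_eq hfp]
  · obtain ⟨y, hy, rfl⟩ := Finset.mem_image.1 hz
    change g y.2 = y.1
    rw [← hfp y hy]
    exact hgf _ (Finset.mem_image_of_mem _ hy)

theorem isStrongIso_empty (arity : ∀ n, L.Relations n → 2 ≤ n) (hM : InK α M) (hN : InK α N)
    [Nonempty N] : IsStrongIso α (∅ : Finset (M × N)) := by
  obtain ⟨n₀⟩ := ‹Nonempty N›
  have hM0 : Strong α (∅ : Finset M) := strong_empty arity hM
  have hN0 : Strong α (∅ : Finset N) := strong_empty arity hN
  refine ⟨fun _ => n₀, ⟨by simp, fun E s hs => ?_⟩, by simp, by simpa using hM0, by simpa using hN0⟩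
  have hs0 : s = ∅ := by simpa using hs
  rw [hs0, Finset.image_empty]
  have := arity _ E.2
  refine iff_of_false (fun h => ?_) fun h => ?_
  · have := edge_card hM.1 h
    rw [Finset.card_empty] at this
    omega
  · have := edge_card hN.1 h
    rw [Finset.card_empty] at this
    omega

/-- Choosing representatives, almost all coordinates of a finite subset of the ultrapower are
isomorphic copies of it. -/
theorem Ultrapower.eventually_isoOn (B : Finset (Ultrapower M)) :
    ∀ᶠ m in (Filter.hyperfilter ℕ : Filter ℕ),
      IsoOn (Edge L (Ultrapower M)) (Edge L M) (fun z => z.rep m) B := by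
  have h1 : ∀ᶠ m in (Filter.hyperfilter ℕ : Filter ℕ),
      ∀ z ∈ B, ∀ z' ∈ B, z.rep m = z'.rep m → z = z' := by
    rw [Filter.eventually_all_finset]
    intro z _
    rw [Filter.eventually_all_finset]
    intro z' _
    by_cases h : z = z'
    · exact Filter.Eventually.of_forall fun _ _ => h
    · have h2 : ¬ ∀ᶠ m in (Filter.hyperfilter ℕ : Filter ℕ), z.rep m = z'.rep m := by
        rw [← mk_eq_iff, mk_rep, mk_rep]
        exact h
      exact (Ultrafilter.eventually_not.2 h2).mono fun m hm h => absurd h hm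
  have h2 : ∀ᶠ m in (Filter.hyperfilter ℕ : Filter ℕ), ∀ (E : Σ n, L.Relations n)
      (x : Fin E.1 → B), Structure.RelMap E.2 (fun i => (x i : Ultrapower M).rep m) ↔
        Structure.RelMap E.2 fun i => (x i : Ultrapower M) := by
    rw [Filter.eventually_all]
    intro E
    rw [Filter.eventually_all]
    intro x
    have h3 := relMap_mk E.2 fun i => (x i : Ultrapower M).rep
    simp only [mk_rep] at h3
    by_cases h : Structure.RelMap E.2 fun i => (x i : Ultrapower M)
    · exact (h3.1 h).mono fun m hm => iff_of_true hm h
    · exact (Ultrafilter.eventually_not.2 (mt h3.2 h)).mono fun m hm => iff_of_false hm h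
  filter_upwards [h1, h2] with m hm1 hm2
  refine isoOn_of_relMap_iff (fun z hz z' hz' h => hm1 z hz z' hz' h) fun n R x hx => ?_
  exact hm2 ⟨n, R⟩ fun i => ⟨x i, hx i⟩

/-- A superset of lower rank in the ultrapower would have copies of lower rank in `M`. -/
theorem strong_image_diag {A : Finset M} (hA : Strong α A) : Strong α (A.image diag) := by
  refine strong_iff.2 fun B hB => ?_
  have h1 : ∀ᶠ m in (Filter.hyperfilter ℕ : Filter ℕ), ∀ a ∈ A, (diag a).rep m = a := by
    rw [Filter.eventually_all_finset]
    exact fun a _ => Ultrapower.rep_mk _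
  obtain ⟨m, hm1, hm2⟩ := (h1.and (Ultrapower.eventually_isoOn (L := L) B)).exists
  rw [delta_eq_rk, (isoOn_diag A).rk_image α, delta_eq_rk, ← hm2.rk_image α, ← delta_eq_rk,
    ← delta_eq_rk]
  refine strong_iff.1 hA _ fun a ha => ?_
  exact Finset.mem_image.2 ⟨diag a, hB (Finset.mem_image_of_mem _ ha), hm1 a ha⟩

variable [L.IsRelational]

theorem IsStrongIso.exists_extension_left (arity : ∀ n, L.Relations n → 2 ≤ n)
    (hα : ∀ E, 0 < α E ∧ α E < 1) (hM : InK α M) (hN : N ⊨ theoryS α) (hdim : DimLE M N α)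
    {p : Finset (M × N)} (hp : IsStrongIso α p) (m : M) :
    ∃ q, p ⊆ q ∧ IsStrongIso α q ∧ ∃ y, (m, y) ∈ q := by
  obtain ⟨f, hf, hfp, h1, h2⟩ := hp
  obtain ⟨B, hB, hBs⟩ := exists_strong_superset hM (insert m (p.image Prod.fst))
  have hmB : m ∈ B := hB (Finset.mem_insert_self _ _)
  have hpB : p.image Prod.fst ⊆ B := (Finset.subset_insert _ _).trans hB
  rw [image_snd_eq hfp] at h2
  obtain ⟨C, hC, hBC⟩ := hdim B hBs
  obtain ⟨g, hg, hgf, hgB⟩ := exists_strong_extension arity hα hN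
    (fun E s h => edge_card hM.1 h) hpB
    (fun Z _ => by rw [← delta_eq_rk]; exact hM.2 Z)
    (fun Z hZ _ => by
      rw [← delta_eq_rk, ← delta_eq_rk]
      exact strong_iff.1 h1 Z hZ) hf h2 ⟨C, hC, by rwa [← delta_eq_rk]⟩
  refine ⟨B.image fun a => (a, g a), fun z hz => ?_, isStrongIso_graph hg hBs hgB,
    g m, Finset.mem_image_of_mem _ hmB⟩
  have hz1 : z.1 ∈ p.image Prod.fst := Finset.mem_image_of_mem _ hz
  refine Finset.mem_image.2 ⟨z.1, hpB hz1, ?_⟩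
  rw [hgf _ hz1, hfp z hz]

theorem IsStrongIso.exists_extension_right (arity : ∀ n, L.Relations n → 2 ≤ n)
    (hα : ∀ E, 0 < α E ∧ α E < 1) (hM : M ⊨ theoryS α) (hN : N ⊨ theoryS α)
    (hdim : DimLE N M α) {p : Finset (M × N)} (hp : IsStrongIso α p) (y : N) :
    ∃ q, p ⊆ q ∧ IsStrongIso α q ∧ ∃ m, (m, y) ∈ q := by
  have := nonempty_of_model arity hM
  have := nonempty_of_model arity hN
  obtain ⟨q, hpq, hq, m, hm⟩ := hp.swap.exists_extension_left arity hα
    ((model_theoryS_iff α N).1 hN).1 hM hdim y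
  refine ⟨q.image Prod.swap, fun z hz => ?_, hq.swap, m,
    Finset.mem_image.2 ⟨(y, m), hm, rfl⟩⟩
  exact Finset.mem_image.2 ⟨z.swap, hpq (Finset.mem_image_of_mem _ hz), z.swap_swap⟩

/-- Between models whose strong sets have mutually bounded ranks, the finite strong isomorphisms
form a back-and-forth system, so they preserve all formulas. -/
theorem IsStrongIso.realize_iff_of_dimLE (arity : ∀ n, L.Relations n → 2 ≤ n)
    (hα : ∀ E, 0 < α E ∧ α E < 1) (hM : M ⊨ theoryS α) (hN : N ⊨ theoryS α)
    (hMN : DimLE M N α) (hNM : DimLE N M α) {β : Type*} {n : ℕ} (φ : L.BoundedFormula β n) :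
    ∀ {p : Finset (M × N)} (_ : IsStrongIso α p) (x : β → M × N) (y : Fin n → M × N)
      (_ : ∀ b, x b ∈ p) (_ : ∀ i, y i ∈ p),
      φ.Realize (fun b => (x b).1) (fun i => (y i).1) ↔
        φ.Realize (fun b => (x b).2) (fun i => (y i).2) := by
  have hKM := ((model_theoryS_iff α M).1 hM).1
  have hKN := ((model_theoryS_iff α N).1 hN).1
  induction φ with
  | falsum => exact fun _ _ _ _ _ => Iff.rfl
  | @equal n t₁ t₂ =>
    intro p hp x y hx hy
    have hvar : ∀ t : L.Term (β ⊕ Fin n), ∃ c : β ⊕ Fin n, t = var c := fun t => by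
      cases t with
      | var c => exact ⟨c, rfl⟩
      | func f _ => exact isEmptyElim f
    obtain ⟨c₁, rfl⟩ := hvar t₁
    obtain ⟨c₂, rfl⟩ := hvar t₂
    obtain ⟨f, hf, hfp, -, -⟩ := hp
    have hz : ∀ c, Sum.elim x y c ∈ p := fun c => by cases c <;> simp [hx, hy]
    have h1 : Sum.elim (fun b => (x b).1) (fun i => (y i).1) = fun c => (Sum.elim x y c).1 := by
      ext c; cases c <;> rfl
    have h2 : Sum.elim (fun b => (x b).2) (fun i => (y i).2) = fun c => (Sum.elim x y c).2 := by
      ext c; cases c <;> rfl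
    simp only [BoundedFormula.Realize, Term.realize_var, h1, h2]
    rw [← hfp _ (hz c₁), ← hfp _ (hz c₂)]
    exact ⟨congrArg f, fun h => hf.1 (Finset.mem_coe.2 (Finset.mem_image_of_mem _ (hz c₁)))
      (Finset.mem_coe.2 (Finset.mem_image_of_mem _ (hz c₂))) h⟩
  | @rel n l R ts =>
    intro p hp x y hx hy
    have hvar : ∀ i, ∃ c : β ⊕ Fin n, ts i = var c := fun i => by
      cases ts i with
      | var c => exact ⟨c, rfl⟩
      | func f _ => exact isEmptyElim f
    choose c hc using hvar
    obtain ⟨f, hf, hfp, -, -⟩ := hp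
    have hz : ∀ c, Sum.elim x y c ∈ p := fun c => by cases c <;> simp [hx, hy]
    have h1 : Sum.elim (fun b => (x b).1) (fun i => (y i).1) = fun c => (Sum.elim x y c).1 := by
      ext c; cases c <;> rfl
    have h2 : Sum.elim (fun b => (x b).2) (fun i => (y i).2) =
        fun c => f (Sum.elim x y c).1 := by
      ext d
      rw [hfp _ (hz d)]
      cases d <;> rfl
    simp only [BoundedFormula.Realize, hc, Term.realize_var, h1, h2]
    exact (hf.relMap_iff hKM.1 hKN.1 R (x := fun i => (Sum.elim x y (c i)).1)
      fun i => Finset.mem_image_of_mem _ (hz _)).symm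
  | imp φ ψ ih₁ ih₂ =>
    intro p hp x y hx hy
    simp only [BoundedFormula.Realize]
    rw [ih₁ hp x y hx hy, ih₂ hp x y hx hy]
  | @all n φ ih =>
    intro p hp x y hx hy
    have hsnoc : ∀ {q : Finset (M × N)} (z : M × N), p ⊆ q → z ∈ q →
        ∀ i, (Fin.snoc y z : Fin (n + 1) → M × N) i ∈ q := by
      intro q z hpq hz i
      refine Fin.lastCases ?_ (fun i => ?_) i
      · simpa using hz
      · simpa using hpq (hy i)
    have h1 : ∀ z : M × N, (fun i => ((Fin.snoc y z : Fin (n + 1) → M × N) i).1) =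
        Fin.snoc (fun i => (y i).1) z.1 := fun z => by
      ext i; refine Fin.lastCases ?_ (fun i => ?_) i <;> simp
    have h2 : ∀ z : M × N, (fun i => ((Fin.snoc y z : Fin (n + 1) → M × N) i).2) =
        Fin.snoc (fun i => (y i).2) z.2 := fun z => by
      ext i; refine Fin.lastCases ?_ (fun i => ?_) i <;> simp
    simp only [BoundedFormula.Realize]
    constructor
    · intro h b
      obtain ⟨q, hpq, hq, a, hab⟩ := hp.exists_extension_right arity hα hM hN hNM b
      have := ih hq x (Fin.snoc y (a, b)) (fun b => hpq (hx b)) (hsnoc _ hpq hab)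
      rw [h1, h2] at this
      exact this.1 (h a)
    · intro h a
      obtain ⟨q, hpq, hq, b, hab⟩ := hp.exists_extension_left arity hα hKM hN hMN a
      have := ih hq x (Fin.snoc y (a, b)) (fun b => hpq (hx b)) (hsnoc _ hpq hab)
      rw [h1, h2] at this
      exact this.2 (h b)

/-- The ultrapower has infinite dimension: sequences of locally free sets in `M` give strong sets
without edges. -/
theorem exists_strong_ultrapower (arity : ∀ n, L.Relations n → 2 ≤ n)
    (hα : ∀ E, 0 < α E ∧ α E < 1) (hM : M ⊨ theoryS α) (k : ℕ) :
    ∃ C : Finset (Ultrapower M), Strong α C ∧ (k : ℚ) ≤ delta α C := by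
  choose c hc hcB using exists_locally_free arity hα hM
  set K : Finset (Ultrapower M) := (Finset.range k).image fun i => Ultrapower.mk fun m => c m i
    with hK
  have key : ∀ B, K ⊆ B → (k : ℚ) ≤ delta α B := by
    intro B hB
    have h1 : ∀ᶠ m in (Filter.hyperfilter ℕ : Filter ℕ), ∀ i ∈ Finset.range k,
        (Ultrapower.mk fun m => c m i).rep m = c m i := by
      rw [Filter.eventually_all_finset]
      exact fun i _ => Ultrapower.rep_mk _
    have h2 : ∀ᶠ m in (Filter.hyperfilter ℕ : Filter ℕ), max k (B.card + 1) ≤ m :=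
      Nat.hyperfilter_le_atTop (Filter.eventually_ge_atTop _)
    obtain ⟨m, hm1, hm2, hm3⟩ :=
      (h1.and (h2.and (Ultrapower.eventually_isoOn (L := L) B))).exists
    have hkm : k ≤ m := (le_max_left _ _).trans hm2
    have hBm : B.card + 1 ≤ m := (le_max_right _ _).trans hm2
    have h3 := hcB m (B.image fun z => z.rep m)
      (lt_of_le_of_lt Finset.card_image_le (by omega))
    rw [delta_eq_rk, hm3.rk_image α, ← delta_eq_rk] at h3
    refine le_trans ?_ h3
    have h4 : (Finset.range k).image (c m) ⊆
        (B.image fun z => z.rep m) ∩ (Finset.range m).image (c m) := by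
      refine Finset.subset_inter ?_ (Finset.image_subset_image (Finset.range_mono hkm))
      intro y hy
      obtain ⟨i, hi, rfl⟩ := Finset.mem_image.1 hy
      exact Finset.mem_image.2 ⟨_, hB (Finset.mem_image_of_mem _ hi), hm1 i hi⟩
    have h5 : ((Finset.range k).image (c m)).card = k := by
      rw [Finset.card_image_of_injOn, Finset.card_range]
      exact (hc m).mono (by exact_mod_cast Finset.range_mono hkm)
    have h6 := Finset.card_le_card h4
    rw [h5] at h6
    exact_mod_cast h6
  refine ⟨K, strong_iff.2 fun B hB => le_trans ?_ (key B hB), key K le_rfl⟩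
  rw [delta_eq_rk]
  refine (rk_le_card (fun E => (hα E).1.le) _ _).trans ?_
  exact_mod_cast Finset.card_image_le.trans (Finset.card_range k).le

theorem dimLE_ultrapower (arity : ∀ n, L.Relations n → 2 ≤ n)
    (hα : ∀ E, 0 < α E ∧ α E < 1) (hN : N ⊨ theoryS α) : DimLE M (Ultrapower N) α := by
  intro B _
  obtain ⟨k, hk⟩ := exists_nat_ge (delta α B)
  obtain ⟨C, hC, hkC⟩ := exists_strong_ultrapower arity hα hN k
  exact ⟨C, hC, hk.trans hkC⟩

/-- Isomorphisms between finite strong sets of models of `S_α` preserve all formulas: pass to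
ultrapowers, which have infinite dimension. -/
theorem IsStrongIso.realize_iff (arity : ∀ n, L.Relations n → 2 ≤ n)
    (hα : ∀ E, 0 < α E ∧ α E < 1) (hM : M ⊨ theoryS α) (hN : N ⊨ theoryS α)
    {p : Finset (M × N)} (hp : IsStrongIso α p) {β : Type*} (φ : L.Formula β) (x : β → M × N)
    (hx : ∀ b, x b ∈ p) :
    φ.Realize (fun b => (x b).1) ↔ φ.Realize (fun b => (x b).2) := by
  have := nonempty_of_model arity hM
  have := nonempty_of_model arity hN
  have hp' : IsStrongIso α (p.image (Prod.map diag diag) :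
      Finset (Ultrapower M × Ultrapower N)) := by
    obtain ⟨f, hf, hfp, h1, h2⟩ := hp
    obtain ⟨g, hg, hgiso⟩ := (isoOn_diag (L := L) (p.image Prod.fst)).exists_inverse
    have h3 : (p.image (Prod.map diag diag)).image Prod.fst =
        ((p.image Prod.fst).image diag : Finset (Ultrapower M)) := by
      rw [Finset.image_image, Finset.image_image]; rfl
    have h4 : (p.image (Prod.map diag diag)).image Prod.snd =
        ((p.image Prod.snd).image diag : Finset (Ultrapower N)) := by
      rw [Finset.image_image, Finset.image_image]; rfl
    have h5 : ((p.image Prod.fst).image diag).image g = p.image Prod.fst := by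
      rw [Finset.image_image]
      conv_rhs => rw [← Finset.image_id (s := p.image Prod.fst)]
      exact Finset.image_congr fun a ha => hg a ha
    refine ⟨diag ∘ f ∘ g, ?_, ?_, ?_, ?_⟩
    · rw [h3]
      refine IsoOn.comp (isoOn_diag _) (IsoOn.comp ?_ hgiso)
      rwa [h5]
    · intro z hz
      obtain ⟨y, hy, rfl⟩ := Finset.mem_image.1 hz
      simp only [Function.comp, Prod.map]
      rw [hg _ (Finset.mem_image_of_mem _ hy), hfp y hy]
    · rw [h3]
      exact strong_image_diag h1
    · rw [h4]
      exact strong_image_diag h2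
  rw [← realize_diag_iff φ fun b => (x b).1, ← realize_diag_iff φ fun b => (x b).2]
  have := hp'.realize_iff_of_dimLE arity hα (Ultrapower.model hM) (Ultrapower.model hN)
    (dimLE_ultrapower arity hα hN) (dimLE_ultrapower arity hα hM) φ
    (fun b => Prod.map diag diag (x b)) default
    (fun b => Finset.mem_image_of_mem _ (hx b)) (fun i => i.elim0)
  simp only [Formula.Realize]
  convert this using 2 <;> rfl

/-- A map whose finite restrictions are parts of strong isomorphisms is elementary. -/
def elementaryEmbeddingOfStrongIso (arity : ∀ n, L.Relations n → 2 ≤ n)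
    (hα : ∀ E, 0 < α E ∧ α E < 1) (hM : M ⊨ theoryS α) (hN : N ⊨ theoryS α) (F : M → N)
    (hF : ∀ A : Finset M, ∃ p : Finset (M × N), IsStrongIso α p ∧ ∀ a ∈ A, (a, F a) ∈ p) :
    M ↪ₑ[L] N where
  toFun := F
  map_formula' n φ x := by
    obtain ⟨p, hp, h⟩ := hF (Finset.univ.image x)
    exact (hp.realize_iff arity hα hM hN φ (fun i => (x i, F (x i)))
      fun i => h _ (Finset.mem_image_of_mem _ (Finset.mem_univ i))).symm

/-! ### Back and forth -/

/-- Back and forth for countable `M`. The elements of `J` are put into the range; for this the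
ranks in `N` have to be bounded by those in `M`. -/
theorem exists_map_of_dimLE (arity : ∀ n, L.Relations n → 2 ≤ n)
    (hα : ∀ E, 0 < α E ∧ α E < 1) (hM : M ⊨ theoryS α) (hN : N ⊨ theoryS α) [Countable M]
    (hMN : DimLE M N α) (J : Set N) [Countable J] (hJ : J.Nonempty → DimLE N M α) :
    ∃ F : M → N, J ⊆ Set.range F ∧
      ∀ A : Finset M, ∃ p : Finset (M × N), IsStrongIso α p ∧ ∀ a ∈ A, (a, F a) ∈ p := by
  have hKM := ((model_theoryS_iff α M).1 hM).1
  have hKN := ((model_theoryS_iff α N).1 hN).1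
  have := nonempty_of_model arity hM
  have := nonempty_of_model arity hN
  have := Encodable.ofCountable (M ⊕ J)
  let P := {p : Finset (M × N) // IsStrongIso α p}
  let D : M ⊕ J → Order.Cofinal P := fun i =>
    { carrier := {p | match i with
        | Sum.inl m => ∃ y, (m, y) ∈ p.1
        | Sum.inr y => ∃ m, (m, (y : N)) ∈ p.1}
      isCofinal := by
        intro p
        cases i with
        | inl m =>
          obtain ⟨q, hpq, hq, h⟩ := p.2.exists_extension_left arity hα hKM hN hMN m
          exact ⟨⟨q, hq⟩, h, hpq⟩
        | inr y =>
          obtain ⟨q, hpq, hq, h⟩ :=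
            p.2.exists_extension_right arity hα hM hN (hJ ⟨y, y.2⟩) (y : N)
          exact ⟨⟨q, hq⟩, h, hpq⟩ }
  let I := Order.idealOfCofinals (⟨∅, isStrongIso_empty arity hKM hKN⟩ : P) D
  have hF : ∀ m, ∃ y, ∃ p ∈ I, (m, y) ∈ p.1 := fun m =>
    let ⟨p, ⟨y, hy⟩, hp⟩ := Order.cofinal_meets_idealOfCofinals
      (⟨∅, isStrongIso_empty arity hKM hKN⟩ : P) D (Sum.inl m)
    ⟨y, p, hp, hy⟩
  choose F hF using hF
  have hfin : ∀ A : Finset M, ∃ p ∈ I, ∀ a ∈ A, (a, F a) ∈ p.1 := by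
    intro A
    induction A using Finset.induction_on with
    | empty =>
      obtain ⟨p, hp⟩ := I.nonempty
      exact ⟨p, hp, by simp⟩
    | insert a A _ ih =>
      obtain ⟨p, hp, h⟩ := ih
      obtain ⟨q, hq, h'⟩ := hF a
      obtain ⟨r, hr, hpr, hqr⟩ := I.directed p hp q hq
      refine ⟨r, hr, fun b hb => ?_⟩
      rcases Finset.mem_insert.1 hb with rfl | hb
      exacts [hqr h', hpr (h b hb)]
  refine ⟨F, fun y hy => ?_, fun A => ?_⟩
  · obtain ⟨p, ⟨m, hm⟩, hp⟩ := Order.cofinal_meets_idealOfCofinals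
      (⟨∅, isStrongIso_empty arity hKM hKN⟩ : P) D (Sum.inr ⟨y, hy⟩)
    obtain ⟨q, hq, hmq⟩ := hF m
    obtain ⟨r, hr, hpr, hqr⟩ := I.directed p hp q hq
    obtain ⟨f, -, hf, -, -⟩ := r.2
    exact ⟨m, (hf _ (hqr hmq)).symm.trans (hf _ (hpr hm))⟩
  · obtain ⟨p, -, h⟩ := hfin A
    exact ⟨p.1, p.2, h⟩

theorem nonempty_elementaryEmbedding (arity : ∀ n, L.Relations n → 2 ≤ n)
    (hα : ∀ E, 0 < α E ∧ α E < 1) (hM : M ⊨ theoryS α) (hN : N ⊨ theoryS α) [Countable M]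
    (hMN : DimLE M N α) : Nonempty (M ↪ₑ[L] N) := by
  obtain ⟨F, -, hF⟩ := exists_map_of_dimLE arity hα hM hN hMN ∅ (by simp)
  exact ⟨elementaryEmbeddingOfStrongIso arity hα hM hN F hF⟩

theorem nonempty_equiv (arity : ∀ n, L.Relations n → 2 ≤ n)
    (hα : ∀ E, 0 < α E ∧ α E < 1) (hM : M ⊨ theoryS α) (hN : N ⊨ theoryS α) [Countable M]
    [Countable N] (hMN : DimLE M N α) (hNM : DimLE N M α) : Nonempty (M ≃[L] N) := by
  obtain ⟨F, hsurj, hF⟩ := exists_map_of_dimLE arity hα hM hN hMN Set.univ fun _ => hNM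
  let g := elementaryEmbeddingOfStrongIso arity hα hM hN F hF
  have hg : Function.Bijective g := ⟨g.injective, fun y => hsurj (Set.mem_univ y)⟩
  exact ⟨{ Equiv.ofBijective g hg with
    map_fun' := fun f => isEmptyElim f
    map_rel' := fun R x => g.map_rel R x }⟩

end

/-! ### A countable model of infinite dimension -/

section

section construction

variable {ι : Type*} {V : Type*}

/-- The first `N` elements of `V` in a given enumeration. -/
noncomputable def seg (e : ℕ ≃ V) (N : ℕ) : Finset V := (Finset.range N).image e

theorem mem_seg {e : ℕ ≃ V} {N i : ℕ} : e i ∈ seg e N ↔ i < N := by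
  simp [seg]

theorem seg_mono {e : ℕ ≃ V} {N N' : ℕ} (h : N ≤ N') : seg e N ⊆ seg e N' :=
  Finset.image_subset_image (Finset.range_mono h)

theorem exists_subset_seg (e : ℕ ≃ V) (X : Finset V) : ∃ N, X ⊆ seg e N := by
  refine ⟨X.sup e.symm + 1, fun x hx => ?_⟩
  obtain ⟨i, rfl⟩ := e.surjective x
  rw [mem_seg]
  have := Finset.le_sup (f := e.symm) hx
  simp only [Equiv.symm_apply_apply] at this
  omega

variable [Fintype ι]

/-- A hypergraph in `K_α` with edges among the first `N` vertices. -/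
structure IsStage (α : ι → ℚ) (ρ : ι → ℕ) (e : ℕ ≃ V) (N : ℕ) (G : ι → Finset V → Prop) :
    Prop where
  edge_subset : ∀ E s, G E s → s ⊆ seg e N
  edge_card : ∀ E s, G E s → s.card = ρ E
  rk_nonneg : ∀ X, 0 ≤ rk α G X

/-- The stage `(N', G')` is a strong extension of `(N, G)` of larger rank. -/
structure IsStep (α : ι → ℚ) (e : ℕ ≃ V) (N : ℕ) (G : ι → Finset V → Prop) (N' : ℕ)
    (G' : ι → Finset V → Prop) : Prop where
  lt : N < N'
  edge_iff : ∀ E s, s ⊆ seg e N → (G' E s ↔ G E s)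
  rk_le : ∀ X, rk α G (X ∩ seg e N) ≤ rk α G' X
  rk_succ_le : rk α G (seg e N) + 1 ≤ rk α G' (seg e N')

/-- `S` on `Y` is in `K_α`, and `X` is strong in `Y`. -/
structure IsStrongExtension {W : Type*} (α : ι → ℚ) (ρ : ι → ℕ) (S : ι → Finset W → Prop)
    (X Y : Finset W) : Prop where
  subset : X ⊆ Y
  edge_card : ∀ E s, S E s → s.card = ρ E
  rk_nonneg : ∀ Z ⊆ Y, 0 ≤ rk α S Z
  rk_le : ∀ Z, X ⊆ Z → Z ⊆ Y → rk α S X ≤ rk α S Z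

/-- Adding an isolated vertex. -/
theorem IsStage.exists_step {α : ι → ℚ} {ρ : ι → ℕ} {e : ℕ ≃ V} {N : ℕ} {G : ι → Finset V → Prop}
    (hG : IsStage α ρ e N G) : IsStage α ρ e (N + 1) G ∧ IsStep α e N G (N + 1) G := by
  refine ⟨⟨fun E s h => (hG.edge_subset E s h).trans (seg_mono (Nat.le_succ N)), hG.edge_card,
    hG.rk_nonneg⟩, Nat.lt_succ_self N, fun _ _ _ => Iff.rfl, fun X => ?_, ?_⟩
  · rw [rk_inter α hG.edge_subset X]
    have : ((X ∩ seg e N).card : ℚ) ≤ X.card := by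
      exact_mod_cast Finset.card_le_card Finset.inter_subset_left
    linarith
  · have h1 : ∀ n, (seg e n).card = n := fun n => by
      rw [seg, Finset.card_image_of_injective _ e.injective, Finset.card_range]
    rw [rk_inter α hG.edge_subset (seg e (N + 1)),
      Finset.inter_eq_right.2 (seg_mono (Nat.le_succ N)), h1, h1]
    push_cast
    linarith

/-- Amalgamating a stage with a strong extension `X ≤ Y` of one of its parts. -/
theorem IsStage.exists_amalgam_step {α : ι → ℚ} (hα : ∀ E, 0 ≤ α E) {ρ : ι → ℕ} {e : ℕ ≃ V}
    {N : ℕ} {G : ι → Finset V → Prop} (hG : IsStage α ρ e N G) {n : ℕ}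
    {S : ι → Finset (Fin n) → Prop} {X Y : Finset (Fin n)} (hS : IsStrongExtension α ρ S X Y)
    {f : Fin n → V} (hf : IsoOn S G f X) (hfN : ∀ x ∈ X, f x ∈ seg e N) :
    ∃ N' G', IsStage α ρ e N' G' ∧ IsStep α e N G N' G' ∧
      ∃ g : Fin n → V, IsoOn S G' g Y ∧ (∀ y ∈ Y, g y ∈ seg e N') ∧ ∀ x ∈ X, g x = f x := by
  let g : Fin n → V := fun i => if i ∈ X then f i else e (N + i)
  have hgX : ∀ i ∈ X, g i = f i := fun i hi => if_pos hi
  have hgn : ∀ i ∉ X, g i = e (N + i) := fun i hi => if_neg hi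
  have hgU : ∀ y ∈ Y, g y ∈ seg e N ↔ y ∈ X := by
    intro y _
    by_cases hy : y ∈ X
    · simpa [hgX y hy, hy] using hfN y hy
    · simp [hgn y hy, hy, mem_seg]
  have hgi : Set.InjOn g Y := by
    intro x hx y hy hxy
    have hiff : x ∈ X ↔ y ∈ X := by rw [← hgU x hx, ← hgU y hy, hxy]
    by_cases hxX : x ∈ X
    · rw [hgX x hxX, hgX y (hiff.1 hxX)] at hxy
      exact hf.1 hxX (hiff.1 hxX) hxy
    · rw [hgn x hxX, hgn y (mt hiff.2 hxX)] at hxy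
      have := e.injective hxy
      exact Fin.ext (by omega)
  have hgN : ∀ y ∈ Y, g y ∈ seg e (N + n) := by
    intro y _
    by_cases hy : y ∈ X
    · rw [hgX y hy]
      exact seg_mono (Nat.le_add_right _ _) (hfN y hy)
    · rw [hgn y hy, mem_seg]
      omega
  have hiso : IsoOn S G g X := hf.congr hgX
  set G' := amalgam G S g Y with hG'
  set P := seg e N ∪ Y.image g with hP
  have hPN : P ⊆ seg e (N + n) := by
    refine Finset.union_subset (seg_mono (Nat.le_add_right _ _)) fun v hv => ?_
    obtain ⟨y, hy, rfl⟩ := Finset.mem_image.1 hv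
    exact hgN y hy
  have hG'P : ∀ E s, G' E s → s ⊆ P := by
    rintro E s (h | ⟨t, ht, -, rfl⟩)
    exacts [(hG.edge_subset E s h).trans Finset.subset_union_left,
      (Finset.image_subset_image ht).trans Finset.subset_union_right]
  have hiff : ∀ E s, s ⊆ seg e N → (G' E s ↔ G E s) := fun E s hs => amalgam_left hgU hiso hs
  have hrkP : ∀ X, rk α G (X ∩ seg e N) ≤ rk α G' (X ∩ P) := by
    intro Z
    rw [rk_amalgam α hgi hS.subset hG.edge_subset hgU hiso Finset.inter_subset_right]
    have h1 := rk_inter_le hα hS.rk_le hS.subset (Z := Y.filter (g · ∈ Z ∩ P))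
      (Finset.filter_subset _ _)
    have h2 : Y.filter (g · ∈ Z ∩ P) ∩ X = X.filter (g · ∈ Z ∩ P) := by
      ext y
      simp only [Finset.mem_inter, Finset.mem_filter]
      exact ⟨fun h => ⟨h.2, h.1.2⟩, fun h => ⟨⟨hS.subset h.1, h.2⟩, h.1⟩⟩
    have h3 : Z ∩ P ∩ seg e N = Z ∩ seg e N := by
      rw [Finset.inter_assoc, Finset.inter_eq_right.2 Finset.subset_union_left]
    rw [h3]
    have h4 : rk α S (X.filter (g · ∈ Z ∩ P)) ≤ rk α S (Y.filter (g · ∈ Z ∩ P)) := by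
      rw [← h2]
      convert h1
    linarith
  have hle : ∀ X, rk α G (X ∩ seg e N) ≤ rk α G' X := by
    intro Z
    have h1 : ((Z ∩ P).card : ℚ) ≤ Z.card := by
      exact_mod_cast Finset.card_le_card Finset.inter_subset_left
    have h2 := hrkP Z
    rw [rk_inter α hG'P Z]
    linarith
  have hstage : IsStage α ρ e (N + n) G' := by
    refine ⟨fun E s h => (hG'P E s h).trans hPN, ?_, fun X => (hG.rk_nonneg _).trans (hle X)⟩
    rintro E s (h | ⟨t, ht, hE, rfl⟩)
    · exact hG.edge_card E s h
    · rw [Finset.card_image_of_injOn (hgi.mono (by exact_mod_cast ht)), hS.edge_card E t hE]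
  obtain ⟨h1, h2⟩ := hstage.exists_step
  refine ⟨N + n + 1, G', h1, ⟨by omega, hiff, hle, ?_⟩, g,
    isoOn_amalgam hgi hG.edge_subset hgU hiso, fun y hy => seg_mono (Nat.le_succ _) (hgN y hy), hgX⟩
  refine le_trans ?_ h2.rk_succ_le
  have h3 := hle (seg e (N + n))
  rw [Finset.inter_eq_right.2 (seg_mono (Nat.le_add_right N n))] at h3
  linarith

/-- An `ω`-chain of stages in which every task is met: whenever `X ≤ Y` and `X` embeds in the
union of the chain, the embedding extends to `Y`. Tasks are finite data, so they can be enumerated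
with infinite repetition. -/
theorem exists_rich_hypergraph {α : ι → ℚ} (hα : ∀ E, 0 ≤ α E) (ρ : ι → ℕ) (e : ℕ ≃ V) :
    ∃ G : ι → Finset V → Prop, (∀ E s, G E s → s.card = ρ E) ∧ (∀ X, 0 ≤ rk α G X) ∧
      (∀ (n : ℕ) (S : ι → Finset (Fin n) → Prop) (X Y : Finset (Fin n)) (f : Fin n → V),
        IsStrongExtension α ρ S X Y → IsoOn S G f X →
        ∃ g : Fin n → V, IsoOn S G g Y ∧ ∀ x ∈ X, g x = f x) ∧
      ∀ k : ℕ, ∃ C : Finset V, (k : ℚ) ≤ rk α G C ∧ ∀ B, C ⊆ B → rk α G C ≤ rk α G B := by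
  have : Countable V := e.symm.injective.countable
  have : Nonempty V := ⟨e 0⟩
  let T := Σ n : ℕ, Finset (ι × Finset (Fin n)) × Finset (Fin n) × Finset (Fin n) × (Fin n → V)
  obtain ⟨τ, hτ⟩ := exists_surjective_nat T
  let St := {x : ℕ × (ι → Finset V → Prop) // IsStage α ρ e x.1 x.2}
  have hnext : ∀ (x : St) (t : T), ∃ y : St, IsStep α e x.1.1 x.1.2 y.1.1 y.1.2 ∧
      (IsStrongExtension α ρ (fun E s => (E, s) ∈ t.2.1) t.2.2.1 t.2.2.2.1 →
        IsoOn (fun E s => (E, s) ∈ t.2.1) x.1.2 t.2.2.2.2 t.2.2.1 →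
        (∀ i ∈ t.2.2.1, t.2.2.2.2 i ∈ seg e x.1.1) →
        ∃ g : Fin t.1 → V, IsoOn (fun E s => (E, s) ∈ t.2.1) y.1.2 g t.2.2.2.1 ∧
          (∀ i ∈ t.2.2.2.1, g i ∈ seg e y.1.1) ∧ ∀ i ∈ t.2.2.1, g i = t.2.2.2.2 i) := by
    rintro ⟨⟨N, G⟩, hG⟩ ⟨n, H, X, Y, f⟩
    by_cases h : IsStrongExtension α ρ (fun E s => (E, s) ∈ H) X Y ∧
        IsoOn (fun E s => (E, s) ∈ H) G f X ∧ ∀ i ∈ X, f i ∈ seg e N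
    · obtain ⟨N', G', h1, h2, h3⟩ := hG.exists_amalgam_step hα h.1 h.2.1 h.2.2
      exact ⟨⟨⟨N', G'⟩, h1⟩, h2, fun _ _ _ => h3⟩
    · obtain ⟨h1, h2⟩ := hG.exists_step
      exact ⟨⟨⟨N + 1, G⟩, h1⟩, h2, fun h3 h4 h5 => absurd ⟨h3, h4, h5⟩ h⟩
  choose next hstep htask using hnext
  have hstart : IsStage α ρ e 0 fun _ _ => False :=
    ⟨fun _ _ h => h.elim, fun _ _ h => h.elim, fun X => by
      rw [rk_eq_card α fun _ _ _ => not_false]; positivity⟩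
  let σ : ℕ → St := fun j => Nat.rec ⟨(0, fun _ _ => False), hstart⟩
    (fun j x => next x (τ j.unpair.1)) j
  have hσ : ∀ j, σ (j + 1) = next (σ j) (τ j.unpair.1) := fun j => rfl
  have hσstep : ∀ j, IsStep α e (σ j).1.1 (σ j).1.2 (σ (j + 1)).1.1 (σ (j + 1)).1.2 := fun j =>
    hσ j ▸ hstep _ _
  have hmono : StrictMono fun j => (σ j).1.1 := strictMono_nat_of_lt_succ fun j => (hσstep j).lt
  have hstable : ∀ j d E s, s ⊆ seg e (σ j).1.1 → ((σ (j + d)).1.2 E s ↔ (σ j).1.2 E s) := by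
    intro j d E s hs
    induction d with
    | zero => rfl
    | succ d ih =>
      rw [← ih]
      exact (hσstep (j + d)).edge_iff E s (hs.trans (seg_mono (hmono.monotone (by omega))))
  have hlow : ∀ j d X, rk α (σ j).1.2 (X ∩ seg e (σ j).1.1) ≤ rk α (σ (j + d)).1.2 X := by
    intro j d
    induction d with
    | zero =>
      intro X
      rw [Nat.add_zero, rk_inter α (σ j).2.edge_subset X]
      have : ((X ∩ seg e (σ j).1.1).card : ℚ) ≤ X.card := by
        exact_mod_cast Finset.card_le_card Finset.inter_subset_left
      linarith
    | succ d ih =>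
      intro X
      refine le_trans ?_ ((hσstep (j + d)).rk_le X)
      have h1 := ih (X ∩ seg e (σ (j + d)).1.1)
      rwa [Finset.inter_assoc,
        Finset.inter_eq_right.2 (seg_mono (hmono.monotone (by omega)))] at h1
  have hgain : ∀ j : ℕ, (j : ℚ) ≤ rk α (σ j).1.2 (seg e (σ j).1.1) := by
    intro j
    induction j with
    | zero =>
      rw [Nat.cast_zero]
      exact (σ 0).2.rk_nonneg _
    | succ j ih =>
      have h1 := (hσstep j).rk_succ_le
      rw [Nat.cast_succ]
      exact (add_le_add_left ih 1).trans h1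
  obtain ⟨G, hG⟩ : ∃ G : ι → Finset V → Prop, ∀ E s, G E s ↔ ∃ j, (σ j).1.2 E s :=
    ⟨_, fun _ _ => Iff.rfl⟩
  have hGj : ∀ j E s, s ⊆ seg e (σ j).1.1 → (G E s ↔ (σ j).1.2 E s) := by
    intro j E s hs
    refine ⟨fun h => ?_, fun h => (hG E s).2 ⟨j, h⟩⟩
    obtain ⟨i, hi⟩ := (hG E s).1 h
    rcases le_total i j with hij | hij
    · obtain ⟨d, rfl⟩ := Nat.exists_eq_add_of_le hij
      exact (hstable i d E s ((σ i).2.edge_subset E s hi)).2 hi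
    · obtain ⟨d, rfl⟩ := Nat.exists_eq_add_of_le hij
      exact (hstable j d E s hs).1 hi
  have hrk : ∀ j X, X ⊆ seg e (σ j).1.1 → rk α G X = rk α (σ j).1.2 X := fun j X hX =>
    rk_congr α fun E s hs => hGj j E s (hs.trans hX)
  have hcover : ∀ (X : Finset V), ∃ j₀, ∀ j ≥ j₀, X ⊆ seg e (σ j).1.1 := by
    intro X
    obtain ⟨N, hN⟩ := exists_subset_seg e X
    exact ⟨N, fun j hj => hN.trans (seg_mono (hj.trans (hmono.le_apply)))⟩
  refine ⟨G, fun E s h => ?_, fun X => ?_, fun n S X Y f hS hf => ?_, fun k => ?_⟩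
  · obtain ⟨j, hj⟩ := (hG E s).1 h
    exact (σ j).2.edge_card E s hj
  · obtain ⟨j, hj⟩ := hcover X
    rw [hrk j X (hj j le_rfl)]
    exact (σ j).2.rk_nonneg X
  · obtain ⟨H, hH⟩ : ∃ H : Finset (ι × Finset (Fin n)), ∀ E s, S E s ↔ (E, s) ∈ H :=
      ⟨Finset.univ.filter fun p => S p.1 p.2, fun E s => by simp⟩
    obtain rfl : S = fun E s => (E, s) ∈ H := funext fun E => funext fun s => propext (hH E s)
    obtain ⟨a, ha⟩ := hτ ⟨n, H, X, Y, f⟩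
    obtain ⟨j₀, hj₀⟩ := hcover (X.image f)
    have hja : (Nat.pair a j₀).unpair.1 = a := by rw [Nat.unpair_pair]
    have hj := hj₀ _ (Nat.right_le_pair a j₀)
    have h1 := htask (σ (Nat.pair a j₀)) ⟨n, H, X, Y, f⟩ hS
      ⟨hf.1, fun E s hs => (hf.2 E s hs).trans
        (hGj _ E _ ((Finset.image_subset_image hs).trans hj))⟩
      (fun i hi => hj (Finset.mem_image_of_mem f hi))
    have h2 : σ (Nat.pair a j₀ + 1) = next (σ (Nat.pair a j₀)) ⟨n, H, X, Y, f⟩ := by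
      rw [hσ, hja, ha]
    rw [← h2] at h1
    obtain ⟨g, hg, hgN, hgX⟩ := h1
    refine ⟨g, ⟨hg.1, fun E s hs => (hg.2 E s hs).trans
      (hGj (Nat.pair a j₀ + 1) E (s.image g) fun v hv => ?_).symm⟩, hgX⟩
    obtain ⟨y, hy, rfl⟩ := Finset.mem_image.1 hv
    exact hgN y (hs hy)
  · refine ⟨seg e (σ k).1.1, ?_, fun B hB => ?_⟩
    · rw [hrk k _ le_rfl]
      exact hgain k
    · obtain ⟨j₀, hj₀⟩ := hcover B
      have h1 := hlow k j₀ B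
      rw [Finset.inter_eq_right.2 hB] at h1
      rw [hrk k _ le_rfl, hrk (k + j₀) B (hj₀ _ (Nat.le_add_left _ _))]
      exact h1

end construction

variable {L : FirstOrder.Language.{u, v}} [L.IsRelational] [Fintype (Σ n, L.Relations n)]

/-- A map that is an isomorphism of hypergraphs is an embedding of structures. -/
def embeddingOfIsoOn {M N : Type*} [L.Structure M] [L.Structure N] (hM : SymmIrrefl L M)
    (hN : SymmIrrefl L N) {f : M → N} (hf : ∀ A, IsoOn (Edge L M) (Edge L N) f A) : M ↪[L] N where
  toFun := f
  inj' a b hab := (hf {a, b}).1 (by simp) (by simp) hab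
  map_fun' F := isEmptyElim F
  map_rel' R x := (hf (Finset.univ.image x)).relMap_iff hM hN R fun i =>
    Finset.mem_image_of_mem _ (Finset.mem_univ i)

/-- There is a countable model of `S_α` with strong sets of arbitrarily large rank. -/
theorem exists_countable_model {α : (Σ n, L.Relations n) → ℚ} (hα : ∀ E, 0 < α E ∧ α E < 1) :
    ∃ (V : Type) (_ : L.Structure V), Countable V ∧ V ⊨ theoryS α ∧
      ∀ k : ℕ, ∃ C : Finset V, Strong α C ∧ (k : ℚ) ≤ delta α C := by
  obtain ⟨V, ⟨e⟩⟩ : ∃ V : Type, Nonempty (ℕ ≃ V) := ⟨ℕ, ⟨Equiv.refl ℕ⟩⟩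
  obtain ⟨G, hGc, hG0, hext, hdim⟩ := exists_rich_hypergraph (fun E => (hα E).1.le)
    (fun E : Σ n, L.Relations n => E.1) e
  let _ : L.Structure V := inducedStructure G (id : V → V)
  have hiso : ∀ A, IsoOn (Edge L V) G (id : V → V) A := fun A =>
    isoOn_inducedStructure hGc Function.injective_id A
  have hEdge : ∀ E s, Edge L V E s ↔ G E s := fun E s => by
    have := (hiso s).2 E s le_rfl
    rwa [Finset.image_id] at this
  have hdelta : ∀ A : Finset V, delta α A = rk α G A := fun A => by
    rw [delta_eq_rk]
    exact rk_congr α fun E s _ => hEdge E s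
  have hK : InK α V := ⟨symmIrrefl_inducedStructure G id, fun A => hdelta A ▸ hG0 A⟩
  refine ⟨V, inferInstance, e.symm.injective.countable, ?_, fun k => ?_⟩
  · rw [model_theoryS_iff]
    refine ⟨hK, fun m n sm sn h hB hle f => ?_⟩
    have h1 : IsoOn (Edge L (Fin n)) G (Function.extend h f fun _ => e 0)
        (Finset.univ.map h.toEmbedding) := by
      have h2 : IsoOn (Edge L (Fin m)) G (Function.extend h f (fun _ => e 0) ∘ h) Finset.univ := by
        rw [Function.extend_comp h.injective]
        exact IsoOn.comp (g := (id : V → V)) (hiso _) (isoOn_embedding f Finset.univ)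
      have h3 := (isoOn_embedding h Finset.univ).of_comp h2
      convert h3
      ext; simp; rfl
    obtain ⟨g, hg, hgf⟩ := hext n (Edge L (Fin n)) _ Finset.univ _
      ⟨Finset.subset_univ _, fun E s hs => edge_card hB.1 hs,
        fun Z _ => delta_eq_rk α Z ▸ hB.2 Z,
        fun Z hZ hZ' => by
          rw [← delta_eq_rk, ← delta_eq_rk]
          exact hle.2 Z hZ hZ'⟩ h1
    have hg' : ∀ A, IsoOn (Edge L (Fin n)) (Edge L V) g A := fun A =>
      ⟨hg.1.mono (by simp), fun E s _ =>
        (hg.2 E s (Finset.subset_univ _)).trans (hEdge E _).symm⟩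
    refine ⟨embeddingOfIsoOn hB.1 hK.1 hg', fun a => ?_⟩
    exact (hgf (h a) (Finset.mem_map.2 ⟨a, Finset.mem_univ a, rfl⟩)).trans
      (h.injective.extend_apply _ _ a)
  · obtain ⟨C, hC, hCs⟩ := hdim k
    refine ⟨C, strong_iff.2 fun B hB => ?_, by rwa [hdelta]⟩
    rw [hdelta, hdelta]
    exact hCs B hB

end

/-! ### Dimensions -/

section

variable {L : FirstOrder.Language.{u, v}} [Fintype (Σ n, L.Relations n)]
  {α : (Σ n, L.Relations n) → ℚ} {M : Type w} {N : Type w'} [L.Structure M] [L.Structure N]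

/-- Bounded ranks of strong sets have a maximum, since they are natural multiples of a unit. -/
theorem exists_strong_max (arity : ∀ n, L.Relations n → 2 ≤ n) (hM : InK α M) {q : ℚ}
    (hq : ∀ B : Finset M, Strong α B → delta α B ≤ q) :
    ∃ B : Finset M, Strong α B ∧ ∀ C : Finset M, Strong α C → delta α C ≤ delta α B := by
  obtain ⟨η, hη, h1, h2⟩ := exists_unit α
  have hnat : ∀ B : Finset M, ∃ k : ℕ, delta α B = k * η := fun B =>
    exists_nat_mul_of_int_mul hη (hM.2 B) (delta_eq_rk α B ▸ exists_rk_eq h1 h2 (Edge L M) B)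
  let S : Set ℕ := {k | ∃ B : Finset M, Strong α B ∧ delta α B = k * η}
  have hne : S.Nonempty :=
    ⟨0, ∅, strong_empty arity hM, by rw [delta_empty arity hM.1]; simp⟩
  have hbdd : BddAbove S := by
    obtain ⟨k, hk⟩ := exists_nat_ge (q / η)
    refine ⟨k, fun j hj => ?_⟩
    obtain ⟨B, hB, hBj⟩ := hj
    have h3 := hq B hB
    rw [hBj, ← le_div_iff₀ hη] at h3
    exact_mod_cast h3.trans hk
  obtain ⟨B, hB, hBj⟩ := Nat.sSup_mem hne hbdd
  refine ⟨B, hB, fun C hC => ?_⟩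
  obtain ⟨k, hk⟩ := hnat C
  rw [hk, hBj]
  exact mul_le_mul_of_nonneg_right (by exact_mod_cast le_csSup hbdd ⟨C, hC, hk⟩) hη.le

theorem isGreatest_iff (arity : ∀ n, L.Relations n → 2 ≤ n) (hM : InK α M) {d : ℚ} :
    IsGreatest {d | ∃ B : Finset M, StrongLE α ∅ B ∧ Strong α B ∧
      d = delta α B - delta α (∅ : Finset M)} d ↔
    ∃ B : Finset M, Strong α B ∧ delta α B = d ∧ ∀ C : Finset M, Strong α C → delta α C ≤ d := by
  have hle : ∀ B : Finset M, StrongLE α ∅ B := fun B =>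
    ⟨Finset.empty_subset B, fun A _ _ => by
      rw [delta_empty arity hM.1]
      exact hM.2 A⟩
  simp only [IsGreatest, upperBounds, Set.mem_ofPred_eq, delta_empty arity hM.1, sub_zero, hle,
    true_and]
  constructor
  · rintro ⟨⟨B, hB, rfl⟩, h⟩
    exact ⟨B, hB, rfl, fun C hC => h ⟨C, hC, rfl⟩⟩
  · rintro ⟨B, hB, rfl, h⟩
    refine ⟨⟨B, hB, rfl⟩, ?_⟩
    rintro _ ⟨C, hC, rfl⟩
    exact h C hC

theorem dim_eq_of_isMax (arity : ∀ n, L.Relations n → 2 ≤ n) (hM : InK α M) {B : Finset M}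
    (hB : Strong α B) (hmax : ∀ C : Finset M, Strong α C → delta α C ≤ delta α B) :
    dim α M = (delta α B : WithTop ℚ) := by
  have h := (isGreatest_iff arity hM).2 ⟨B, hB, rfl, hmax⟩
  have hex : ∃ d, IsGreatest {d | ∃ B : Finset M, StrongLE α ∅ B ∧ Strong α B ∧
      d = delta α B - delta α (∅ : Finset M)} d := ⟨_, h⟩
  rw [dim, dimOver, dif_pos hex, hex.choose_spec.unique h]

theorem dim_eq_top (arity : ∀ n, L.Relations n → 2 ≤ n) (hM : InK α M)
    (h : ¬ ∃ B : Finset M, Strong α B ∧ ∀ C : Finset M, Strong α C → delta α C ≤ delta α B) :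
    dim α M = ⊤ := by
  rw [dim, dimOver, dif_neg]
  rintro ⟨d, hd⟩
  obtain ⟨B, hB, rfl, hmax⟩ := (isGreatest_iff arity hM).1 hd
  exact h ⟨B, hB, hmax⟩

/-- If `N` has infinite dimension, the ranks of its strong sets are unbounded: a bounded set of
ranks has a maximum. -/
theorem dimLE_of_dim_le (arity : ∀ n, L.Relations n → 2 ≤ n) (hM : InK α M) (hN : InK α N)
    (h : dim α M ≤ dim α N) : DimLE M N α := by
  intro B hB
  by_cases hmaxN : ∃ C : Finset N, Strong α C ∧ ∀ C' : Finset N, Strong α C' →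
      delta α C' ≤ delta α C
  · obtain ⟨C, hC, hCmax⟩ := hmaxN
    rw [dim_eq_of_isMax arity hN hC hCmax] at h
    by_cases hmaxM : ∃ B : Finset M, Strong α B ∧ ∀ B' : Finset M, Strong α B' →
        delta α B' ≤ delta α B
    · obtain ⟨B', hB', hBmax⟩ := hmaxM
      rw [dim_eq_of_isMax arity hM hB' hBmax, WithTop.coe_le_coe] at h
      exact ⟨C, hC, (hBmax B hB).trans h⟩
    · rw [dim_eq_top arity hM hmaxM] at h
      exact absurd (top_le_iff.1 h) WithTop.coe_ne_top
  · by_contra hcon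
    push Not at hcon
    exact hmaxN (exists_strong_max arity hN (q := delta α B) fun C hC => (hcon C hC).le)

/-! ### Dimension closures and the chain -/

theorem exists_map_subtype_eq {L : FirstOrder.Language.{u, v}} {M : Type w} [L.Structure M]
    {S : L.Substructure M} {Z : Finset M} (hZ : ∀ z ∈ Z, z ∈ S) :
    ∃ T : Finset S, T.map S.subtype.toEmbedding = Z := by
  refine ⟨Z.attach.image fun z : {z // z ∈ Z} => (⟨z.1, hZ z.1 z.2⟩ : S), ?_⟩
  ext z
  simp only [Finset.mem_map, Finset.mem_image, Finset.mem_attach, true_and]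
  constructor
  · rintro ⟨_, ⟨y, rfl⟩, rfl⟩
    exact y.2
  · exact fun hz => ⟨_, ⟨⟨z, hz⟩, rfl⟩, rfl⟩

theorem InK.of_embedding [L.IsRelational] (f : M ↪[L] N) (hN : InK α N) : InK α M := by
  refine ⟨fun k E x hx => ?_, fun A => delta_map α f A ▸ hN.2 _⟩
  obtain ⟨h1, h2⟩ := hN.1 k E (f ∘ x) ((f.map_rel _ _).2 hx)
  exact ⟨h1.of_comp, fun π => (f.map_rel _ (x ∘ π)).1 (h2 π)⟩

theorem exists_isStrongIso_of_embedding (hM : InK α M) (f : M ↪[L] N)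
    (hstr : ∀ X : Finset M, Strong α X → Strong α (X.map f.toEmbedding)) (A : Finset M) :
    ∃ p : Finset (M × N), IsStrongIso α p ∧ ∀ a ∈ A, (a, f a) ∈ p := by
  obtain ⟨B, hAB, hB⟩ := exists_strong_superset hM A
  refine ⟨_, isStrongIso_graph (isoOn_embedding f B) hB ?_,
    fun a ha => Finset.mem_image_of_mem _ (hAB ha)⟩
  have h := hstr B hB
  rwa [Finset.map_eq_image] at h

theorem delta_submodular (hα : ∀ E, 0 < α E ∧ α E < 1) (X Y : Finset M) :
    delta α (X ∪ Y) + delta α (X ∩ Y) ≤ delta α X + delta α Y := by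
  simp only [delta_eq_rk]
  exact rk_submodular (fun E => (hα E).1.le) _ _ _

theorem strong_of_delta_eq {A : Finset M} (hA : Strong α A) {B : Finset M} (hAB : A ⊆ B)
    (hB : delta α B = delta α A) : Strong α B :=
  strong_iff.2 fun X hX => hB ▸ strong_iff.1 hA X (hAB.trans hX)

variable [L.IsRelational]

/-- The dimension closure of a strong set `A`: the union of the finite sets that contain `A` and
have the same rank as `A`. -/
def dimClosure (α : (Σ n, L.Relations n) → ℚ) (A : Finset M) : L.Substructure M where
  carrier := {x | ∃ B : Finset M, A ⊆ B ∧ delta α B = delta α A ∧ x ∈ B}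
  fun_mem f := isEmptyElim f

section dimClosure

variable {A : Finset M}

theorem exists_superset_of_subset_dimClosure (hα : ∀ E, 0 < α E ∧ α E < 1) (hA : Strong α A)
    {Z : Finset M} (hZ : ∀ z ∈ Z, z ∈ dimClosure α A) :
    ∃ B, A ⊆ B ∧ Z ⊆ B ∧ delta α B = delta α A := by
  induction Z using Finset.induction_on with
  | empty => exact ⟨A, le_rfl, Finset.empty_subset _, rfl⟩
  | insert z Z _ ih =>
    obtain ⟨B, hAB, hZB, hB⟩ := ih fun y hy => hZ y (Finset.mem_insert_of_mem hy)
    obtain ⟨C, hAC, hC, hzC⟩ := hZ z (Finset.mem_insert_self _ _)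
    have hAU : A ⊆ B ∪ C := hAB.trans Finset.subset_union_left
    refine ⟨B ∪ C, hAU, Finset.insert_subset (Finset.mem_union_right _ hzC)
      (hZB.trans Finset.subset_union_left), le_antisymm ?_ (strong_iff.1 hA _ hAU)⟩
    have h1 := delta_submodular hα B C
    have h2 := strong_iff.1 hA _ (Finset.subset_inter hAB hAC)
    linarith

theorem dimClosure_mono (hα : ∀ E, 0 < α E ∧ α E < 1) (hA : Strong α A) {A' : Finset M}
    (hA' : Strong α A') (hAA' : A ⊆ A') : dimClosure α A ≤ dimClosure α A' := by
  rintro x ⟨B, hAB, hB, hx⟩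
  refine ⟨B ∪ A', Finset.subset_union_right,
    le_antisymm ?_ (strong_iff.1 hA' _ Finset.subset_union_right), Finset.mem_union_left _ hx⟩
  have h1 := delta_submodular hα B A'
  have h2 := strong_iff.1 hA _ (Finset.subset_inter hAB hAA')
  linarith

/-- Strong sets of the dimension closure are strong in `M`: the closure is a union of strong sets
`B`, and `X ↦ X ∩ B` does not raise the rank. -/
theorem strong_map_dimClosure (hα : ∀ E, 0 < α E ∧ α E < 1) (hA : Strong α A)
    {T : Finset (dimClosure α A)} (hT : Strong α T) :
    Strong α (T.map (dimClosure α A).subtype.toEmbedding) := by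
  refine strong_iff.2 fun X hX => ?_
  have hmem : ∀ z ∈ T.map (dimClosure α A).subtype.toEmbedding, z ∈ dimClosure α A := by
    intro z hz
    obtain ⟨y, -, rfl⟩ := Finset.mem_map.1 hz
    exact y.2
  obtain ⟨B, hAB, hTB, hB⟩ := exists_superset_of_subset_dimClosure hα hA hmem
  obtain ⟨T', hT'⟩ := exists_map_subtype_eq (S := dimClosure α A) (Z := X ∩ B)
    fun z hz => ⟨B, hAB, hB, (Finset.mem_inter.1 hz).2⟩
  have h1 : delta α T ≤ delta α T' := strong_iff.1 hT T' (Finset.map_subset_map.1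
    (hT' ▸ Finset.subset_inter hX hTB))
  have h2 := delta_submodular hα X B
  have h3 := strong_iff.1 (strong_of_delta_eq hA hAB hB) (X ∪ B) Finset.subset_union_right
  rw [delta_map]
  rw [← delta_map α (dimClosure α A).subtype T', hT'] at h1
  linarith

theorem delta_le_of_dimClosure (hα : ∀ E, 0 < α E ∧ α E < 1) (hA : Strong α A)
    {T : Finset (dimClosure α A)} (hT : Strong α T) : delta α T ≤ delta α A := by
  have hmem : ∀ z ∈ T.map (dimClosure α A).subtype.toEmbedding, z ∈ dimClosure α A := by
    intro z hz
    obtain ⟨y, -, rfl⟩ := Finset.mem_map.1 hz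
    exact y.2
  obtain ⟨B, hAB, hTB, hB⟩ := exists_superset_of_subset_dimClosure hα hA hmem
  have := strong_iff.1 (strong_map_dimClosure hα hA hT) B hTB
  rwa [delta_map, hB] at this

theorem exists_strong_dimClosure (hA : Strong α A) :
    ∃ T : Finset (dimClosure α A), Strong α T ∧ delta α T = delta α A := by
  obtain ⟨T, hT⟩ := exists_map_subtype_eq (S := dimClosure α A) (Z := A)
    fun z hz => ⟨A, le_rfl, rfl, hz⟩
  have hTA : delta α T = delta α A :=
    (delta_map α (dimClosure α A).subtype T).symm.trans (congrArg (delta α) hT)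
  refine ⟨T, strong_iff.2 fun X hX => ?_, hTA⟩
  rw [hTA, ← delta_map α (dimClosure α A).subtype X]
  exact strong_iff.1 hA _ (hT.ge.trans (Finset.map_subset_map.2 hX))

/-- The dimension closure is a model: the amalgam needed for the extension property can be chosen
with the rank of `A`. -/
theorem model_dimClosure [Nonempty (Σ n, L.Relations n)] (arity : ∀ n, L.Relations n → 2 ≤ n)
    (hα : ∀ E, 0 < α E ∧ α E < 1) (hM : M ⊨ theoryS α) (hA : Strong α A) :
    dimClosure α A ⊨ theoryS α := by
  have hK := ((model_theoryS_iff α M).1 hM).1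
  obtain ⟨x₀⟩ := nonempty_of_model arity hM
  have hKS : InK α (dimClosure α A) := InK.of_embedding (dimClosure α A).subtype hK
  rw [model_theoryS_iff]
  refine ⟨hKS, fun m n sm sn e hB hle f => ?_⟩
  let F : Fin n → M := Function.extend e (fun i => (f i : M)) fun _ => x₀
  have hFe : ∀ i, F (e i) = f i := fun i => e.injective.extend_apply _ _ i
  have hF : IsoOn (Edge L (Fin n)) (Edge L M) F (Finset.univ.map e.toEmbedding) := by
    have h2 : IsoOn (Edge L (Fin m)) (Edge L M) (F ∘ e) Finset.univ := by
      rw [show F ∘ e = (dimClosure α A).subtype.comp f from funext hFe]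
      exact isoOn_embedding _ Finset.univ
    have h3 := (isoOn_embedding e Finset.univ).of_comp h2
    convert h3
    ext; simp; rfl
  have hmem : ∀ z ∈ (Finset.univ.map e.toEmbedding).image F, z ∈ dimClosure α A := by
    intro z hz
    obtain ⟨y, hy, rfl⟩ := Finset.mem_image.1 hz
    obtain ⟨i, -, rfl⟩ := Finset.mem_map.1 hy
    have : F (e.toEmbedding i) = f i := hFe i
    rw [this]
    exact (f i).2
  obtain ⟨B, hAB, hFB, hBd⟩ := exists_superset_of_subset_dimClosure hα hA hmem
  obtain ⟨g, D, hg, hgF, hBD, hgD, hD, -⟩ := exists_amalgam_drop arity hα hM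
    (fun E s h => edge_card hB.1 h) hle.1
    (fun Z hZ hZ' => by
      rw [← delta_eq_rk, ← delta_eq_rk]
      exact hle.2 Z hZ hZ') hF hFB
  have hgmem : ∀ i, g i ∈ dimClosure α A := fun i =>
    ⟨D, hAB.trans hBD, hD.trans hBd, hgD (Finset.mem_image_of_mem g (Finset.mem_univ i))⟩
  refine ⟨⟨⟨fun i => ⟨g i, hgmem i⟩, fun i j hij => hg.1 (by simp) (by simp)
    (congrArg Subtype.val hij)⟩, fun f => isEmptyElim f, fun {k} R x => ?_⟩, fun a => ?_⟩
  · exact hg.relMap_iff hB.1 hK.1 R (x := x) fun i => Finset.mem_univ _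
  · refine Subtype.ext ((hgF (e a) (Finset.mem_map.2 ⟨a, Finset.mem_univ a, rfl⟩)).trans (hFe a))

end dimClosure

/-- Inclusions between submodels of `M` are elementary if the strong sets of the smaller one are
strong in `M`. -/
theorem exists_elementary_inclusion (arity : ∀ n, L.Relations n → 2 ≤ n)
    (hα : ∀ E, 0 < α E ∧ α E < 1) {S T : L.Substructure M} (hST : S ≤ T) (hS : S ⊨ theoryS α)
    (hT : T ⊨ theoryS α)
    (hstr : ∀ X : Finset S, Strong α X → Strong α (X.map S.subtype.toEmbedding)) :
    ∃ g : S ↪ₑ[L] T, ∀ x, (g x : M) = (x : M) := by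
  refine ⟨elementaryEmbeddingOfStrongIso arity hα hS hT (Substructure.inclusion hST)
    (exists_isStrongIso_of_embedding ((model_theoryS_iff α S).1 hS).1
      (Substructure.inclusion hST) fun B hB => strong_iff.2 fun X hX => ?_), fun x => rfl⟩
  rw [delta_map, ← delta_map α S.subtype B, ← delta_map α T.subtype X]
  refine strong_iff.1 (hstr B hB) _ fun z hz => ?_
  obtain ⟨y, hy, rfl⟩ := Finset.mem_map.1 hz
  exact Finset.mem_map.2 ⟨_, hX (Finset.mem_map_of_mem _ hy), rfl⟩

/-- In a model of infinite dimension, the rank of a strong set can be raised by exactly `ε`: add a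
point and lower the rank by `1 - ε`. -/
theorem exists_strong_succ (arity : ∀ n, L.Relations n → 2 ≤ n)
    (hα : ∀ E, 0 < α E ∧ α E < 1) (hM : M ⊨ theoryS α)
    (hdim : ∀ k : ℕ, ∃ C : Finset M, Strong α C ∧ (k : ℚ) ≤ delta α C) {ε : ℚ} (hε : 0 < ε)
    (h1 : ∃ k : ℕ, 1 = k * ε)
    (hgad : ∀ n : ℕ, ∃ s ≥ n,
      HasProperGadget M α (fun E : Σ n, L.Relations n => E.1) ε s)
    {A : Finset M} (hA : Strong α A) :
    ∃ B, A ⊆ B ∧ Strong α B ∧ delta α B = delta α A + ε := by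
  have hK := ((model_theoryS_iff α M).1 hM).1
  have := infinite_of_model arity hM
  obtain ⟨x, hx⟩ := Infinite.exists_notMem_finset A
  obtain ⟨R, hR⟩ : ∃ R : (Σ n, L.Relations n) → Finset M → Prop,
      ∀ E s, R E s ↔ s ⊆ A ∧ Edge L M E s := ⟨_, fun _ _ => Iff.rfl⟩
  have hRA : ∀ E s, R E s → s ⊆ A := fun E s h => ((hR E s).1 h).1
  have hRM : ∀ Z ⊆ A, rk α R Z = delta α Z := fun Z hZ => by
    rw [delta_eq_rk]
    refine rk_congr α fun E s hs => ?_
    rw [hR]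
    exact and_iff_right (hs.trans hZ)
  have hAP : A ⊆ insert x A := Finset.subset_insert _ _
  have hP : rk α R (insert x A) = delta α A + 1 := by
    rw [rk_inter α hRA, Finset.inter_eq_right.2 hAP, hRM A le_rfl,
      Finset.card_insert_of_notMem hx]
    push_cast
    ring
  obtain ⟨k, hk⟩ := h1
  have hk0 : 1 ≤ k := by
    rcases Nat.eq_zero_or_pos k with rfl | h
    · simp at hk
    · exact h
  obtain ⟨D, R', hPD, hRc, hRP, hrD, hlow, hhigh⟩ := exists_rank_drop hε ⟨k, hk⟩ hgad
    (fun E s h => (hRA E s h).trans hAP) (fun E s h => edge_card hK.1 ((hR E s).1 h).2)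
    (r := 1 - ε) ⟨k - 1, by rw [Nat.cast_sub hk0]; push_cast; linarith⟩
  have hD : delta α A + 1 - (1 - ε) = delta α A + ε := by ring
  rw [hP, hD] at hrD hhigh
  have hAD : A ⊆ D := hAP.trans hPD
  have hlowA : ∀ X ⊆ D, ¬ insert x A ⊆ X → delta α (X ∩ A) ≤ rk α R' X := by
    intro X hX hPX
    refine le_trans ?_ (hlow X hX hPX)
    rw [rk_inter α hRA, Finset.inter_assoc, Finset.inter_eq_right.2 hAP,
      hRM _ Finset.inter_subset_right]
    have : ((X ∩ A).card : ℚ) ≤ (X ∩ insert x A).card := by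
      exact_mod_cast Finset.card_le_card (Finset.inter_subset_inter le_rfl hAP)
    linarith
  have hR'A : ∀ E s, s ⊆ A → (R' E s ↔ Edge L M E s) := fun E s hs => by
    rw [hRP E s (hs.trans hAP), hR]
    exact and_iff_right hs
  have hrA : rk α R' A = delta α A := by
    rw [delta_eq_rk]
    exact rk_congr α hR'A
  obtain ⟨n, hn⟩ := exists_nat_ge (rk α R' D)
  obtain ⟨C, hC, hnC⟩ := hdim n
  obtain ⟨g, hg, hgA, hgD⟩ := exists_strong_extension arity hα hM hRc hAD
    (fun Z hZ => by
      by_cases hPZ : insert x A ⊆ Z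
      · exact (add_nonneg (hK.2 A) hε.le).trans (hhigh Z hZ hPZ)
      · exact (hK.2 _).trans (hlowA Z hZ hPZ))
    (fun Z hAZ hZ => by
      rw [hrA]
      by_cases hPZ : insert x A ⊆ Z
      · have := hhigh Z hZ hPZ
        linarith
      · have := hlowA Z hZ hPZ
        rwa [Finset.inter_eq_right.2 hAZ] at this)
    (f := id) ⟨Function.injective_id.injOn, fun E s hs => by rw [Finset.image_id, hR'A E s hs]⟩
    (by rwa [Finset.image_id]) ⟨C, hC, hn.trans hnC⟩
  refine ⟨D.image g, fun a ha => Finset.mem_image.2 ⟨a, hAD ha, hgA a ha⟩, hgD, ?_⟩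
  rw [delta_eq_rk, hg.rk_image α, hrD]

/-- An increasing sequence of elementary submodels of a countable model of infinite dimension,
which together with that model represents all dimensions. -/
theorem exists_chain (arity : ∀ n, L.Relations n → 2 ≤ n) (hα : ∀ E, 0 < α E ∧ α E < 1)
    {V : Type} [L.Structure V] (hV : V ⊨ theoryS α)
    (hdim : ∀ k : ℕ, ∃ C : Finset V, Strong α C ∧ (k : ℚ) ≤ delta α C) :
    ∃ S : ℕ → L.Substructure V, Monotone S ∧ (∀ k, S k ⊨ theoryS α) ∧
      (∀ k (X : Finset (S k)), Strong α X → Strong α (X.map (S k).subtype.toEmbedding)) ∧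
      ∀ (M : Type w) [L.Structure M], M ⊨ theoryS α →
        DimLE V M α ∨ ∃ k, DimLE M (S k) α ∧ DimLE (S k) M α := by
  have hKV := ((model_theoryS_iff α V).1 hV).1
  have htop : ∀ (M : Type w) [L.Structure M], M ⊨ theoryS α →
      (¬ ∃ q, ∀ B : Finset M, Strong α B → delta α B ≤ q) → DimLE V M α := by
    intro M _ _ h B _
    push Not at h
    obtain ⟨C, hC, hBC⟩ := h (delta α B)
    exact ⟨C, hC, hBC.le⟩
  cases isEmpty_or_nonempty (Σ n, L.Relations n) with
  | inl hempty =>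
    refine ⟨fun _ => ⊤, monotone_const, fun _ => ?_, fun _ X _ => ?_, fun M _ hM => Or.inl ?_⟩
    · have := hV
      exact StrongHomClass.theory_model (Substructure.topEquiv (L := L) (M := V)).symm
    · refine strong_iff.2 fun B hB => ?_
      rw [delta_eq_rk, delta_eq_rk, rk_eq_card α fun E => isEmptyElim E,
        rk_eq_card α fun E => isEmptyElim E]
      exact_mod_cast Finset.card_le_card hB
    · -- without relations the rank is the cardinality, and models are infinite
      intro B _
      have := infinite_of_model arity hM
      obtain ⟨C, hC⟩ := Infinite.exists_subset_card_eq M B.card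
      refine ⟨C, strong_iff.2 fun X hX => ?_, ?_⟩
      · rw [delta_eq_rk, delta_eq_rk, rk_eq_card α fun E => isEmptyElim E,
          rk_eq_card α fun E => isEmptyElim E]
        exact_mod_cast Finset.card_le_card hX
      · rw [delta_eq_rk, delta_eq_rk, rk_eq_card α fun E => isEmptyElim E,
          rk_eq_card α fun E => isEmptyElim E, hC]
  | inr hne =>
    have := infinite_of_model arity hV
    obtain ⟨ε, hε, h1, hαε, hgad⟩ := exists_gadget_unit (V := V) hα
      (ρ := fun E => E.1) fun E => arity _ E.2
    choose next hsub hstr hdelta using fun A : {A : Finset V // Strong α A} =>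
      exists_strong_succ arity hα hV hdim hε h1 hgad A.2
    let σ : ℕ → {A : Finset V // Strong α A} := fun k =>
      Nat.rec ⟨∅, strong_empty arity hKV⟩ (fun _ A => ⟨next A, hstr A⟩) k
    have hσ : ∀ k, delta α (σ k).1 = k * ε := by
      intro k
      induction k with
      | zero =>
        have h0 : delta α (σ 0).1 = 0 := delta_empty arity hKV.1 α
        rw [h0]
        simp
      | succ k ih =>
        have h2 : delta α (σ (k + 1)).1 = delta α (σ k).1 + ε := hdelta (σ k)
        rw [h2, ih]
        push_cast
        ring
    refine ⟨fun k => dimClosure α (σ k).1, monotone_nat_of_le_succ fun k =>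
      dimClosure_mono hα (σ k).2 (σ (k + 1)).2 (hsub (σ k)),
      fun k => model_dimClosure arity hα hV (σ k).2,
      fun k X hX => strong_map_dimClosure hα (σ k).2 hX, fun M _ hM => ?_⟩
    have hKM := ((model_theoryS_iff α M).1 hM).1
    by_cases hq : ∃ q, ∀ B : Finset M, Strong α B → delta α B ≤ q
    · right
      obtain ⟨q, hq⟩ := hq
      obtain ⟨B, hB, hmax⟩ := exists_strong_max arity hKM hq
      obtain ⟨k, hk⟩ := exists_nat_mul_of_int_mul hε (hKM.2 B)
        (delta_eq_rk α B ▸ exists_rk_eq_int_mul h1 hαε (Edge L M) B)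
      refine ⟨k, fun B' hB' => ?_, fun X hX => ⟨B, hB, ?_⟩⟩
      · obtain ⟨T, hT, hTA⟩ := exists_strong_dimClosure (σ k).2
        refine ⟨T, hT, ?_⟩
        rw [hTA, hσ, ← hk]
        exact hmax B' hB'
      · rw [hk, ← hσ]
        exact delta_le_of_dimClosure hα (σ k).2 hX
    · exact Or.inl (htop M hM hq)

end

end BaldwinShi

theorem theorem4p6 {L : FirstOrder.Language.{u, v}} [L.IsRelational]
    [Fintype (Σ n, L.Relations n)] (arity_ge_two : ∀ n, L.Relations n → 2 ≤ n)
    (α : (Σ n, L.Relations n) → ℚ) (hα : ∀ E, 0 < α E ∧ α E < 1) :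
    (∀ (M : Type w) (N : Type w') [L.Structure M] [L.Structure N] [Countable M] [Countable N],
      M ⊨ BaldwinShi.theoryS α → N ⊨ BaldwinShi.theoryS α →
      BaldwinShi.dim α M ≤ BaldwinShi.dim α N → Nonempty (M ↪ₑ[L] N)) ∧
    -- The chain is indexed by `ℕ∞`, that is by the ordinals up to and including `ω`. Its members
    -- are substructures of the last one.
    ∃ (Mω : Type) (_ : L.Structure Mω) (C : ℕ∞ → L.Substructure Mω),
      C ⊤ = ⊤ ∧
      (∀ β, Countable (C β) ∧ (C β) ⊨ BaldwinShi.theoryS α) ∧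
      (∀ β γ, β ≤ γ → ∃ g : C β ↪ₑ[L] C γ, ∀ x, (g x : Mω) = (x : Mω)) ∧
      (∀ (M : Type w) [L.Structure M] [Countable M], M ⊨ BaldwinShi.theoryS α →
        ∃ β, Nonempty (M ≃[L] C β)) := by
  refine ⟨fun M N _ _ _ _ hM hN h => ?_, ?_⟩
  · exact BaldwinShi.nonempty_elementaryEmbedding arity_ge_two hα hM hN
      (BaldwinShi.dimLE_of_dim_le arity_ge_two ((BaldwinShi.model_theoryS_iff α M).1 hM).1
        ((BaldwinShi.model_theoryS_iff α N).1 hN).1 h)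
  obtain ⟨V, _, _, hV, hdim⟩ := BaldwinShi.exists_countable_model (α := α) hα
  obtain ⟨S, hmono, hmodel, hstr, hclass⟩ :=
    BaldwinShi.exists_chain.{u, v, w} arity_ge_two hα hV hdim
  let C : ℕ∞ → L.Substructure V := fun β => ENat.recTopCoe (C := fun _ => L.Substructure V) ⊤ S β
  have hCtop : C ⊤ = ⊤ := rfl
  have hCnat : ∀ k : ℕ, C k = S k := fun k => rfl
  have hmodelC : ∀ β, C β ⊨ BaldwinShi.theoryS α := by
    intro β
    induction β using ENat.recTopCoe with
    | top => exact StrongHomClass.theory_model (Substructure.topEquiv (L := L) (M := V)).symm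
    | coe k => exact hmodel k
  refine ⟨V, inferInstance, C, hCtop, fun β => ⟨inferInstance, hmodelC β⟩, fun β γ hβγ => ?_,
    fun M _ _ hM => ?_⟩
  · have hle : C β ≤ C γ := by
      induction γ using ENat.recTopCoe with
      | top => exact le_top
      | coe k =>
        obtain ⟨j, rfl⟩ := ENat.ne_top_iff_exists.1
          (ne_top_of_le_ne_top (ENat.natCast_ne_top k) hβγ)
        exact hmono (by exact_mod_cast hβγ)
    refine BaldwinShi.exists_elementary_inclusion arity_ge_two hα hle (hmodelC β) (hmodelC γ) ?_
    induction β using ENat.recTopCoe with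
    | top =>
      intro X hX
      refine BaldwinShi.strong_iff.2 fun B hB => ?_
      obtain ⟨T, rfl⟩ := BaldwinShi.exists_map_subtype_eq (S := C ⊤) (Z := B) fun z _ => trivial
      rw [BaldwinShi.delta_map, BaldwinShi.delta_map]
      exact BaldwinShi.strong_iff.1 hX T (Finset.map_subset_map.1 hB)
    | coe k => exact hstr k
  · rcases hclass M hM with h | ⟨k, h1, h2⟩
    · refine ⟨⊤, ?_⟩
      have hMV : BaldwinShi.DimLE M V α := fun B _ => by
        obtain ⟨k, hk⟩ := exists_nat_ge (BaldwinShi.delta α B)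
        obtain ⟨C, hC, hkC⟩ := hdim k
        exact ⟨C, hC, hk.trans hkC⟩
      obtain ⟨f⟩ := BaldwinShi.nonempty_equiv arity_ge_two hα hM hV hMV h
      exact ⟨(Substructure.topEquiv (L := L) (M := V)).symm.comp f⟩
    · exact ⟨k, BaldwinShi.nonempty_equiv arity_ge_two hα hM (hmodel k) h1 h2⟩
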